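/- **Setting.** Let $(W,\mathcal S)$ be a finite Coxeter system with Coxeter matrix $(m_{st})$ and let $m\ge 0$ be an integer. Let $B^+$ be the positive Artin monoid of $(W,\mathcal S)$, i.e. the monoid of words in $\mathcal S$ modulo the braid relations $sts\cdots=tst\cdots$ ($m_{st}$ letters on each side), ordered by the (right) weak order: $u\le w$ iff $w=uv$ for some $v\in B^+$ with $\ell(u)+\ell(v)=\ell(w)$. Let $w_\circ\in B^+$ be the element given by a reduced word of the longest element of $W$, and let $W^{(m)}=[1,w_\circ^m]\subseteq B^+$, with the induced order. Let $\mathbf c=s_1s_2\cdots s_n$ be a word containing every simple reflection exactly once, i.e. a reduced word for a Coxeter element $c$. The $c$-sorting word of $w\in B^+$ is the lexicographically first (as a sequence of positions) subword of $\mathbf c^\infty=\mathbf c\,\mathbf c\,\mathbf c\cdots$ that is a word for $w$. An element $w\in W^{(m)}$ is called $c$-sortable, $w\in\mathrm{Sort}^{(m)}(W,c)$, if the sets $I_0,I_1,I_2,\ldots\subseteq\{1,\dots,n\}$ of positions used by its $c$-sorting word in the successive copies of $\mathbf c$ satisfy $I_0\supseteq I_1\supseteq I_2\supseteq\cdots$.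 Let $(a_{st})_{s,t\in\mathcal S}$ be a real matrix with $a_{ss}=2$ and, for $s\ne t$, $a_{st}\le 0$, $a_{st}a_{ts}=4\cos^2(\pi/m_{st})$ and $a_{st}=0\Leftrightarrow a_{ts}=0$. Let $V$ be the real vector space with basis the simple roots $(\alpha_s)_{s\in\mathcal S}$, let $s\in\mathcal S$ act linearly on $V$ by $s(\alpha_t)=\alpha_t-a_{st}\alpha_s$, and let $\Phi=\{s_1\cdots s_k(\alpha_s)\}$ be the set of roots. Assume that $\Phi\cap\mathbb R\beta=\{\beta,-\beta\}$ for every $\beta\in\Phi$. A simple reflection $s$ acts on colored positive roots $\beta^{(k)}$, $k\in\mathbb Z_{\ge0}$, by $s(\beta^{(k)})=[s(\beta)]^{(k)}$ if $\beta\ne\alpha_s$ and $s(\alpha_s^{(k)})=\alpha_s^{(k+1)}$. The colored inversion set of $w\in B^+$ is $$\mathrm{inv}(w)=\{\,s_1\cdots s_{i-1}(\alpha_{s_i}^{(0)}) : 1\le i\le p\,\},$$ where $s_1\cdots s_p$ is any word for $w$; it does not depend on the word. **Theorem.** For all $w,u\in\mathrm{Sort}^{(m)}(W,c)$: 1. $w\le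 u$ if and only if $\mathrm{inv}(w)\subseteq\mathrm{inv}(u)$; 2. the meet $w\wedge u$ in $W^{(m)}$ exists, and $\mathrm{inv}(w\wedge u)=\mathrm{inv}(w)\cap\mathrm{inv}(u)$. -/

import Mathlib

open scoped Matrix

noncomputable section

/-! ### The positive Artin monoid and its weak order -/

/-- The braid relations `s t s ⋯ = t s t ⋯` (both sides of length `M s t`) as relations between
words. If `M s t = 0` (which encodes `∞`), both sides are the empty word. -/
def braidRel {B : Type*} (M : CoxeterMatrix B) (x y : FreeMonoid B) : Prop :=
  ∃ s t : B, x = FreeMonoid.ofList (CoxeterSystem.braidWord M s t) ∧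
    y = FreeMonoid.ofList (CoxeterSystem.braidWord M t s)

/-- The positive Artin monoid `B⁺`: words in the simple generators modulo braid moves. -/
def ArtinMonoid {B : Type*} (M : CoxeterMatrix B) : Type _ := PresentedMonoid (braidRel M)

namespace ArtinMonoid

variable {B : Type*} {M : CoxeterMatrix B}

instance : Monoid (ArtinMonoid M) := inferInstanceAs (Monoid (PresentedMonoid (braidRel M)))

/-- The element of `B⁺` given by a word in the simple generators. -/
def ofWord (M : CoxeterMatrix B) (Q : List B) : ArtinMonoid M :=
  PresentedMonoid.mk (braidRel M) (FreeMonoid.ofList Q)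

theorem ofWord_append (Q R : List B) : ofWord M (Q ++ R) = ofWord M Q * ofWord M R :=
  map_mul (PresentedMonoid.mk (braidRel M)) (FreeMonoid.ofList Q) (FreeMonoid.ofList R)

theorem ofWord_nil : ofWord M [] = 1 := rfl

theorem ofWord_surjective : Function.Surjective (ofWord M) := fun x => by
  obtain ⟨q, hq⟩ := PresentedMonoid.surjective_mk (rels := braidRel M) x
  exact ⟨FreeMonoid.toList q, hq⟩

/-- The length of `w ∈ B⁺`: the length of a shortest word for `w`. -/
def length (w : ArtinMonoid M) : ℕ := sInf {k | ∃ Q : List B, ofWord M Q = w ∧ Q.length = k}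

theorem length_eq_of_ofWord_eq {Q R : List B} (h : ofWord M Q = ofWord M R) :
    Q.length = R.length := by
  have hrel : ∀ a b : FreeMonoid B, braidRel M a b →
      FreeMonoid.lift (fun _ : B => Multiplicative.ofAdd (1 : ℕ)) a =
        FreeMonoid.lift (fun _ : B => Multiplicative.ofAdd (1 : ℕ)) b := by
    rintro a b ⟨s, t, rfl, rfl⟩
    simp [FreeMonoid.lift_apply, CoxeterSystem.length_alternatingWord, M.symmetric s t]
  have key : ∀ L : List B,
      (PresentedMonoid.lift (fun _ : B => Multiplicative.ofAdd (1 : ℕ)) hrel)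
        (PresentedMonoid.mk (braidRel M) (FreeMonoid.ofList L)) =
          Multiplicative.ofAdd (1 : ℕ) ^ L.length := by
    intro L
    change FreeMonoid.lift (fun _ : B => Multiplicative.ofAdd (1 : ℕ)) (FreeMonoid.ofList L) = _
    simp [FreeMonoid.lift_apply]
  have h' := (key Q).symm.trans ((congrArg _ h).trans (key R))
  simpa [← ofAdd_nsmul] using h'

/-- All words for an element of `B⁺` have the same length. -/
theorem length_ofWord (Q : List B) : length (ofWord M Q) = Q.length := by
  have : {k | ∃ R : List B, ofWord M R = ofWord M Q ∧ R.length = k} = {Q.length} := by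
    ext k
    constructor
    · rintro ⟨R, hR, rfl⟩
      exact length_eq_of_ofWord_eq hR
    · rintro rfl
      exact ⟨Q, rfl, rfl⟩
  rw [length, this, csInf_singleton]

theorem length_mul (u v : ArtinMonoid M) : length (u * v) = length u + length v := by
  obtain ⟨Q, rfl⟩ := ofWord_surjective u
  obtain ⟨R, rfl⟩ := ofWord_surjective v
  rw [← ofWord_append, length_ofWord, length_ofWord, length_ofWord, List.length_append]

theorem eq_one_of_length_eq_zero {u : ArtinMonoid M} (h : length u = 0) : u = 1 := by
  obtain ⟨Q, rfl⟩ := ofWord_surjective u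
  rw [length_ofWord, List.length_eq_zero_iff] at h
  rw [h, ofWord_nil]

/-- The (right) weak order on `B⁺`: `u ≤ w` if `w = u v` with `ℓ(u) + ℓ(v) = ℓ(w)`. -/
instance : PartialOrder (ArtinMonoid M) where
  le u w := ∃ v, u * v = w ∧ length u + length v = length w
  le_refl u := ⟨1, mul_one u, by rw [← length_mul, mul_one]⟩
  le_trans := by
    rintro u v w ⟨x, rfl, -⟩ ⟨y, rfl, -⟩
    exact ⟨x * y, (mul_assoc u x y).symm, by simp only [length_mul, add_assoc]⟩
  le_antisymm := by
    rintro u w ⟨x, rfl, -⟩ ⟨y, hy, hl⟩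
    rw [length_mul] at hl
    rw [eq_one_of_length_eq_zero (u := x) (by omega), mul_one]

end ArtinMonoid

/-! ### The fundamental element and the `m`-weak order -/

namespace CoxeterSystem

variable {B W : Type*} [Group W] {M : CoxeterMatrix B}

/-- The element of `B⁺` given by a reduced word of `w ∈ W`. -/
def toArtin (cs : CoxeterSystem M W) (w : W) : ArtinMonoid M :=
  ArtinMonoid.ofWord M (Classical.choose (cs.exists_isReduced w))

/-- An element of maximal length of a finite Coxeter group. -/
def longest [Finite W] (cs : CoxeterSystem M W) : W :=
  Classical.choose (Finite.exists_max cs.length)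

theorem length_le_length_longest [Finite W] (cs : CoxeterSystem M W) (w : W) :
    cs.length w ≤ cs.length cs.longest :=
  Classical.choose_spec (Finite.exists_max cs.length) w

/-- The set `W⁽ᵐ⁾`, the interval `[1, w₀ᵐ]` of the weak order on `B⁺`. Its coercion to a type
carries the induced order, the `m`-weak order. -/
def mWeak [Finite W] (cs : CoxeterSystem M W) (m : ℕ) : Set (ArtinMonoid M) :=
  Set.Icc 1 (cs.toArtin cs.longest ^ m)

end CoxeterSystem

/-! ### Sorting words and sortable elements -/

section Sortable

variable {B : Type*} {n : ℕ}

/-- A sequence of positions in `𝐜^∞` describing a subword for `w`. Here `𝐜 = c 0, c 1, …, c (n-1)`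
is an ordering of all the simple generators, that is, a reduced word for a Coxeter element, and
the position `(k, i)` is that of the `i`-th letter in the `k`-th copy of `𝐜`. -/
def IsSubwordFor (M : CoxeterMatrix B) (c : Fin n ≃ B) (w : ArtinMonoid M)
    (P : List (ℕ ×ₗ Fin n)) : Prop :=
  P.Pairwise (· < ·) ∧ ArtinMonoid.ofWord M (P.map fun p => c (ofLex p).2) = w

/-- `P` is the sequence of positions of the `c`-sorting word of `w`: the lexicographically first
subword of `𝐜^∞` that is a word for `w`. -/
def IsSortingWord (M : CoxeterMatrix B) (c : Fin n ≃ B) (w : ArtinMonoid M)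
    (P : List (ℕ ×ₗ Fin n)) : Prop :=
  IsLeast {P' | IsSubwordFor M c w P'} P

/-- `w` is `c`-sortable: the sets of positions in the successive copies of `𝐜` that are used by
its sorting word form a decreasing sequence. -/
def IsSortable {M : CoxeterMatrix B} (c : Fin n ≃ B) (w : ArtinMonoid M) : Prop :=
  ∃ P, IsSortingWord M c w P ∧
    ∀ k : ℕ, {i : Fin n | toLex (k + 1, i) ∈ P} ⊆ {i : Fin n | toLex (k, i) ∈ P}

/-- The set `Sort⁽ᵐ⁾(W, c)` of `m`-eralized `c`-sortable elements. -/
def mSort {W : Type*} [Group W] [Finite W] {M : CoxeterMatrix B} (cs : CoxeterSystem M W) (m : ℕ)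
    (c : Fin n ≃ B) : Set (cs.mWeak m) :=
  {w | IsSortable c (w : ArtinMonoid M)}

end Sortable

/-! ### Roots and colored inversion sets -/

section Roots

variable {B : Type*} [Fintype B]

/-- A generalized Cartan matrix for a Coxeter system with Coxeter matrix `M`. -/
structure IsGeneralizedCartanMatrix (M : CoxeterMatrix B) (a : Matrix B B ℝ) : Prop where
  diag : ∀ s, a s s = 2
  nonpos : ∀ s t, s ≠ t → a s t ≤ 0
  mul_eq : ∀ s t, s ≠ t → a s t * a t s = 4 * Real.cos (Real.pi / M s t) ^ 2
  zero_iff : ∀ s t, s ≠ t → (a s t = 0 ↔ a t s = 0)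

open Classical in
/-- The simple root `α_s`, in the real vector space with basis the simple roots. -/
def simpleRoot (s : B) : B → ℝ := Pi.single s 1

/-- The simple reflection `s`, the linear map with `s (α_t) = α_t - a_{st} α_s`. -/
def simpleRefl (a : Matrix B B ℝ) (s : B) (v : B → ℝ) : B → ℝ :=
  v - (a *ᵥ v) s • simpleRoot s

/-- The roots: the vectors `s₁ ⋯ s_k (α_s)`. -/
def roots (a : Matrix B B ℝ) : Set (B → ℝ) :=
  {β | ∃ (Q : List B) (s : B), β = Q.foldr (simpleRefl a) (simpleRoot s)}

/-- Each line spanned by a root contains precisely two roots, `β` and `-β`. -/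
def IsReducedRoots (a : Matrix B B ℝ) : Prop :=
  ∀ β ∈ roots a, ∀ r : ℝ, r • β ∈ roots a → r = 1 ∨ r = -1

open Classical in
/-- The action of `s` on colored positive roots `β⁽ᵏ⁾ = (β, k)`:
`s (β⁽ᵏ⁾) = (s β)⁽ᵏ⁾` if `β ≠ α_s`, and `s (α_s⁽ᵏ⁾) = α_s⁽ᵏ⁺¹⁾`. -/
def coloredRefl (a : Matrix B B ℝ) (s : B) (b : (B → ℝ) × ℕ) : (B → ℝ) × ℕ :=
  if b.1 = simpleRoot s then (simpleRoot s, b.2 + 1) else (simpleRefl a s b.1, b.2)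

/-- The colored inversion sequence of the word `s₁ ⋯ s_p`, whose `i`-th entry is
`s₁ ⋯ s_{i-1} (α_{s_i}⁽⁰⁾)`. -/
def coloredInvSeq (a : Matrix B B ℝ) : List B → List ((B → ℝ) × ℕ)
  | [] => []
  | s :: Q => (simpleRoot s, 0) :: (coloredInvSeq a Q).map (coloredRefl a s)

/-- The colored inversion set of `w ∈ B⁺`: the set of entries of the colored inversion sequence
of a word for `w`. (This set is the same for all words for `w`.) -/
def coloredInv {M : CoxeterMatrix B} (a : Matrix B B ℝ) (w : ArtinMonoid M) :
    Set ((B → ℝ) × ℕ) :=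
  {b | ∃ Q : List B, ArtinMonoid.ofWord M Q = w ∧ b ∈ coloredInvSeq a Q}

end Roots

end

/-!
Fix an invariant scalar product and let `ω_c` be the associated skew-symmetric form, whose value at
`(α_s, α_t)` is the scalar product if `s` precedes `t` in `c`. Reading a sorting word from the left
and rotating `c` along the way shows that an inversion of color `0` has `ω_c ≤ 0` with every earlier
inversion of color `0`, with equality only for orthogonal roots, and is orthogonal to every earlier
inversion of positive color. Hence the letters of color `0` can be moved in front of the others.

Suppose that the last letters of two sorting words create the same colored root `β`. Cancel the meet
of what comes before. If `β` were then not simple, it would be a positive combination of an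
inversion `ρ` of one remaining factor and an inversion `σ` of the other. The values `ω_c(ρ, β)` and
`ω_c(σ, β)`, both nonpositive, are positive multiples of `ω_c(ρ, σ)` and `ω_c(σ, ρ)`, so they
vanish and `β` is orthogonal to `ρ`, to `σ` and hence to itself, which is absurd. So `β` is simple,
the last letters slide past both factors down to the meet, and `β` is an inversion of the meet. By
induction the inversions of a meet are the common inversions, and comparing cardinalities turns an
inclusion of inversion sets into an inequality.
-/

noncomputable section

/-! ### The geometric representation -/

section SimpleRoot

variable {B : Type*}

theorem simpleRoot_apply_self (s : B) : simpleRoot s s = 1 := by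
  simp [simpleRoot]

theorem simpleRoot_apply_of_ne {s t : B} (h : t ≠ s) : simpleRoot s t = 0 := by
  simp [simpleRoot, h]

theorem simpleRoot_nonneg (s : B) : 0 ≤ simpleRoot s := by
  classical
  exact Pi.single_nonneg.2 zero_le_one

theorem simpleRoot_ne_zero (s : B) : simpleRoot s ≠ 0 := fun h => by
  simpa [simpleRoot_apply_self] using congrFun h s

variable [Fintype B] {a : Matrix B B ℝ}

theorem mulVec_simpleRoot (s t : B) : (a *ᵥ simpleRoot s) t = a t s := by
  classical
  simp [simpleRoot]

theorem simpleRefl_apply_self (s : B) (v : B → ℝ) : simpleRefl a s v s = v s - (a *ᵥ v) s := by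
  simp [simpleRefl, simpleRoot_apply_self]

theorem simpleRefl_apply_of_ne {s t : B} (h : t ≠ s) (v : B → ℝ) : simpleRefl a s v t = v t := by
  simp [simpleRefl, simpleRoot_apply_of_ne h]

/-- The simple coroot `α_s^∨`, the linear form with `α_s^∨ (α_t) = a_{st}`. -/
def simpleCoroot (a : Matrix B B ℝ) (s : B) : Module.Dual ℝ (B → ℝ) :=
  LinearMap.proj s ∘ₗ a.mulVecLin

theorem simpleCoroot_simpleRoot (s t : B) : simpleCoroot a s (simpleRoot t) = a s t :=
  mulVec_simpleRoot t s

end SimpleRoot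

/-! The products of two simple reflections are governed by the values `S_j (2 cos 2θ)` of Chebyshev
polynomials, where `θ = π / m`. The value `m = 0` encodes an infinite order, and `θ = π / 0 = 0` is
then the angle to take. -/

section Chebyshev

open Polynomial Polynomial.Chebyshev Real

theorem sin_mul_pi_div_nonneg {m k : ℕ} (hk : k ≤ m) : 0 ≤ sin (k * (π / m)) := by
  refine sin_nonneg_of_nonneg_of_le_pi (by positivity) ?_
  rw [← mul_div_assoc, mul_comm, mul_div_assoc]
  exact mul_le_of_le_one_right pi_pos.le (div_le_one_of_le₀ (by exact_mod_cast hk) (by positivity))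

theorem sin_two_mul_pi_div_pos {m : ℕ} (hm : 2 < m) : 0 < sin (2 * (π / m)) := by
  have hm' : (2 : ℝ) < m := by exact_mod_cast hm
  refine sin_pos_of_pos_of_lt_pi (by positivity) ?_
  rw [← mul_div_assoc, mul_comm, mul_div_assoc]
  exact mul_lt_of_lt_one_right pi_pos ((div_lt_one (by linarith)).2 hm')

theorem cos_pi_div_pos {m : ℕ} (hm : 2 < m) : 0 < cos (π / m) := by
  have hm' : (2 : ℝ) < m := by exact_mod_cast hm
  exact cos_pos_of_mem_Ioo ⟨by linarith [pi_pos, (by positivity : 0 < π / m)],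
    div_lt_div_of_pos_left pi_pos two_pos hm'⟩

theorem S_sub_one_two_mul_cos_mul_sin (j : ℕ) (θ : ℝ) :
    (S ℝ (j - 1)).eval (2 * cos (2 * θ)) * sin (2 * θ) = sin ((2 * j : ℕ) * θ) := by
  rw [S_two_mul_real_cos]
  congr 1
  push_cast
  ring

theorem S_add_S_sub_one_two_mul_cos_mul_sin (j : ℕ) (θ : ℝ) :
    ((S ℝ j).eval (2 * cos (2 * θ)) + (S ℝ (j - 1)).eval (2 * cos (2 * θ))) * sin (2 * θ) =
      2 * cos θ * sin ((2 * j + 1 : ℕ) * θ) := by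
  have hadd := sin_add ((2 * j + 1 : ℕ) * θ) θ
  have hsub := sin_sub ((2 * j + 1 : ℕ) * θ) θ
  rw [add_mul, S_sub_one_two_mul_cos_mul_sin, S_two_mul_real_cos,
    show ((j : ℤ) + 1 : ℝ) * (2 * θ) = (2 * j + 1 : ℕ) * θ + θ by push_cast; ring,
    show (2 * j : ℕ) * θ = (2 * j + 1 : ℕ) * θ - θ by push_cast; ring, hadd, hsub]
  ring

theorem S_sub_one_eval_nonneg {m j : ℕ} (hj : m = 0 ∨ 2 * j ≤ m) :
    0 ≤ (S ℝ (j - 1)).eval (2 * cos (2 * (π / m))) := by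
  rcases Nat.eq_zero_or_pos m with rfl | hm
  · simp
  rcases Nat.lt_or_ge 2 m with hm2 | hm2
  · refine nonneg_of_mul_nonneg_left ?_ (sin_two_mul_pi_div_pos hm2)
    rw [S_sub_one_two_mul_cos_mul_sin]
    exact sin_mul_pi_div_nonneg (by omega)
  · obtain rfl | rfl : j = 0 ∨ j = 1 := by omega
    all_goals simp

theorem S_add_S_sub_one_eval_nonneg {m j : ℕ} (hm : m ≠ 1) (hj : m = 0 ∨ 2 * j + 1 ≤ m) :
    0 ≤ (S ℝ j).eval (2 * cos (2 * (π / m))) + (S ℝ (j - 1)).eval (2 * cos (2 * (π / m))) := by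
  rcases Nat.eq_zero_or_pos m with rfl | hm0
  · simp only [Nat.cast_zero, div_zero, mul_zero, cos_zero, mul_one, S_eval_two]
    push_cast
    linarith [j.cast_nonneg (α := ℝ)]
  rcases Nat.lt_or_ge 2 m with hm2 | hm2
  · refine nonneg_of_mul_nonneg_left ?_ (sin_two_mul_pi_div_pos hm2)
    rw [S_add_S_sub_one_two_mul_cos_mul_sin]
    exact mul_nonneg (mul_nonneg zero_le_two (cos_pi_div_pos hm2).le)
      (sin_mul_pi_div_nonneg (by omega))
  · obtain rfl : j = 0 := by omega
    simp

theorem S_sub_one_eval_eq_zero {m k : ℕ} (hm : 2 < m) (hk : m = 2 * k) :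
    (S ℝ (k - 1)).eval (2 * cos (2 * (π / m))) = 0 := by
  refine (mul_eq_zero.1 ?_).resolve_right (sin_two_mul_pi_div_pos hm).ne'
  rw [S_sub_one_two_mul_cos_mul_sin, ← hk, mul_div_cancel₀ _ (by positivity), sin_pi]

theorem S_add_S_sub_one_eval_eq_zero {m k : ℕ} (hm : 2 < m) (hk : m = 2 * k + 1) :
    (S ℝ k).eval (2 * cos (2 * (π / m))) + (S ℝ (k - 1)).eval (2 * cos (2 * (π / m))) = 0 := by
  refine (mul_eq_zero.1 ?_).resolve_right (sin_two_mul_pi_div_pos hm).ne'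
  rw [S_add_S_sub_one_two_mul_cos_mul_sin, ← hk, mul_div_cancel₀ _ (by positivity), sin_pi,
    mul_zero]

end Chebyshev

namespace IsGeneralizedCartanMatrix

open Polynomial Polynomial.Chebyshev Real

variable {B : Type*} [Fintype B] {M : CoxeterMatrix B} {a : Matrix B B ℝ}
variable (ha : IsGeneralizedCartanMatrix M a)
include ha

theorem simpleCoroot_simpleRoot_self (s : B) : simpleCoroot a s (simpleRoot s) = 2 := by
  rw [simpleCoroot_simpleRoot, ha.diag]

/-- The simple reflection `s`, as a linear automorphism. -/
def reflection (s : B) : (B → ℝ) ≃ₗ[ℝ] (B → ℝ) :=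
  Module.reflection (ha.simpleCoroot_simpleRoot_self s)

theorem reflection_apply (s : B) (v : B → ℝ) : ha.reflection s v = simpleRefl a s v := rfl

theorem simpleRefl_simpleRoot_self (s : B) : simpleRefl a s (simpleRoot s) = -simpleRoot s :=
  Module.reflection_apply_self (ha.simpleCoroot_simpleRoot_self s)

theorem simpleRefl_simpleRefl (s : B) (v : B → ℝ) : simpleRefl a s (simpleRefl a s v) = v :=
  Module.involutive_reflection (ha.simpleCoroot_simpleRoot_self s) v

theorem reflection_mul_self (s : B) : ha.reflection s * ha.reflection s = 1 :=
  LinearEquiv.ext (ha.simpleRefl_simpleRefl s)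

omit [Fintype B] in
theorem mul_sub_two_eq {s t : B} (hst : s ≠ t) : a s t * a t s - 2 = 2 * cos (2 * (π / M s t)) := by
  rw [ha.mul_eq s t hst, cos_two_mul]
  ring

omit [Fintype B] in
theorem apply_eq_zero_of_two {s t : B} (h : M s t = 2) : a s t = 0 := by
  have hst : s ≠ t := by
    rintro rfl
    simp at h
  have hmul : a s t * a t s = 0 := by simp [ha.mul_eq s t hst, h]
  exact (mul_eq_zero.1 hmul).elim id (ha.zero_iff s t hst).2

theorem isLiftable_reflection : M.IsLiftable ha.reflection := by
  intro s t
  rcases eq_or_ne s t with rfl | hst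
  · rw [reflection_mul_self, one_pow]
  ext1 v
  have hpow := Module.reflection_mul_reflection_pow_apply (ha.simpleCoroot_simpleRoot_self s)
    (ha.simpleCoroot_simpleRoot_self t) (M s t) v
  have hM : M s t ≠ 1 := M.off_diagonal s t hst
  rw [simpleCoroot_simpleRoot, simpleCoroot_simpleRoot, ha.mul_sub_two_eq hst] at hpow
  refine hpow.trans ?_
  obtain h0 | h2 | h3 : M s t = 0 ∨ M s t = 2 ∨ 2 < M s t := by omega
  · simp [h0]
  · have hcos : cos (2 * (π / 2)) = -1 := by rw [mul_div_cancel₀ π two_ne_zero, cos_pi]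
    simp only [h2, ha.apply_eq_zero_of_two h2, ha.apply_eq_zero_of_two (M.symmetric t s ▸ h2)]
    norm_num [hcos]
    module
  obtain ⟨k, hk | hk⟩ := Nat.even_or_odd' (M s t)
  · rw [show ((M s t : ℤ) - 2) / 2 = k - 1 by omega, show ((M s t : ℤ) - 1) / 2 = k - 1 by omega,
      S_sub_one_eval_eq_zero h3 hk]
    simp
  · rw [show ((M s t : ℤ) - 1) / 2 = k by omega, show ((M s t : ℤ) - 3) / 2 = k - 1 by omega,
      show (M s t : ℤ) / 2 = k by omega, show ((M s t : ℤ) - 2) / 2 = k - 1 by omega,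
      S_add_S_sub_one_eval_eq_zero h3 hk]
    simp

section GeomRep

open CoxeterSystem

variable {W : Type*} [Group W] (cs : CoxeterSystem M W)

/-- The geometric representation of a Coxeter group on the span of the simple roots. -/
def geomRep : W →* (B → ℝ) ≃ₗ[ℝ] (B → ℝ) :=
  cs.lift ⟨ha.reflection, ha.isLiftable_reflection⟩

theorem geomRep_simple (s : B) : ha.geomRep cs (cs.simple s) = ha.reflection s :=
  cs.lift_apply_simple _ s

theorem geomRep_wordProd (Q : List B) (v : B → ℝ) :
    ha.geomRep cs (cs.wordProd Q) v = Q.foldr (simpleRefl a) v := by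
  induction Q with
  | nil => simp
  | cons s Q ih =>
    rw [wordProd_cons, map_mul, LinearEquiv.mul_apply, ih, geomRep_simple, reflection_apply,
      List.foldr_cons]

theorem geomRep_inv_apply (w : W) (v : B → ℝ) :
    ha.geomRep cs w⁻¹ (ha.geomRep cs w v) = v := by
  rw [← LinearEquiv.mul_apply, ← map_mul, inv_mul_cancel, map_one, LinearEquiv.coe_one, id]

theorem geomRep_apply_inv (w : W) (v : B → ℝ) :
    ha.geomRep cs w (ha.geomRep cs w⁻¹ v) = v := by
  rw [← LinearEquiv.mul_apply, ← map_mul, mul_inv_cancel, map_one, LinearEquiv.coe_one, id]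

theorem exists_geomRep_alternatingWord {s t : B} (hst : s ≠ t) {k : ℕ}
    (hk : M s t = 0 ∨ k < M s t) : ∃ x y : ℝ, 0 ≤ x ∧ 0 ≤ y ∧
      ha.geomRep cs (cs.wordProd (alternatingWord s t k)) (simpleRoot s) =
        x • simpleRoot s + y • simpleRoot t := by
  have hM : M s t ≠ 1 := M.off_diagonal s t hst
  have hneg : 0 ≤ -a t s := neg_nonneg.2 (ha.nonpos t s hst.symm)
  have hS (j : ℕ) (hj : M s t = 0 ∨ 2 * j ≤ M s t) := mul_nonneg (S_sub_one_eval_nonneg hj) hneg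
  rw [cs.prod_alternatingWord_eq_mul_pow, map_mul, map_pow, map_mul, geomRep_simple, geomRep_simple]
  obtain ⟨j, rfl | rfl⟩ := Nat.even_or_odd' k
  · rw [if_pos (even_two_mul j), map_one, one_mul, Nat.mul_div_cancel_left j two_pos]
    refine ⟨_, _, ?_, ?_, Module.reflection_mul_reflection_pow_apply_self
      (ha.simpleCoroot_simpleRoot_self s) (ha.simpleCoroot_simpleRoot_self t) j⟩ <;>
      rw [simpleCoroot_simpleRoot, simpleCoroot_simpleRoot, ha.mul_sub_two_eq hst]
    · exact S_add_S_sub_one_eval_nonneg hM (by omega)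
    · exact hS j (by omega)
  · rw [if_neg (by simp), geomRep_simple, show (2 * j + 1) / 2 = j by omega]
    refine ⟨_, _, ?_, ?_, Module.reflection_mul_reflection_mul_reflection_pow_apply_self
      (ha.simpleCoroot_simpleRoot_self s) (ha.simpleCoroot_simpleRoot_self t) j⟩ <;>
      rw [simpleCoroot_simpleRoot, simpleCoroot_simpleRoot, ha.mul_sub_two_eq hst]
    · exact S_add_S_sub_one_eval_nonneg hM (by omega)
    · simpa using hS (j + 1) (by omega)

theorem geomRep_mul_alternatingWord_nonneg {v : W} {s t : B} (hst : s ≠ t) {k : ℕ}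
    (hk : M s t = 0 ∨ k < M s t) (hs : 0 ≤ ha.geomRep cs v (simpleRoot s))
    (ht : 0 ≤ ha.geomRep cs v (simpleRoot t)) :
    0 ≤ ha.geomRep cs (v * cs.wordProd (alternatingWord s t k)) (simpleRoot s) := by
  obtain ⟨x, y, hx, hy, h⟩ := ha.exists_geomRep_alternatingWord cs hst hk
  rw [map_mul, LinearEquiv.mul_apply, h, map_add, map_smul, map_smul]
  exact add_nonneg (smul_nonneg hx hs) (smul_nonneg hy ht)

end GeomRep

end IsGeneralizedCartanMatrix

/-! ### Positive roots and dihedral parabolic subgroups -/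

section IsReduced

open CoxeterSystem

variable {B W : Type*} [Group W] {M : CoxeterMatrix B} (cs : CoxeterSystem M W)

theorem isReduced_cons {s : B} {Q : List B} :
    cs.IsReduced (s :: Q) ↔ cs.IsReduced Q ∧ ¬ cs.IsLeftDescent (cs.wordProd Q) s := by
  have hle := cs.length_wordProd_le Q
  have hs := cs.length_simple_mul (cs.wordProd Q) s
  rw [not_isLeftDescent_iff, CoxeterSystem.IsReduced, CoxeterSystem.IsReduced, wordProd_cons,
    List.length_cons]
  omega

theorem isReduced_concat {Q : List B} {x : B} :
    cs.IsReduced (Q ++ [x]) ↔ cs.IsReduced Q ∧ ¬ cs.IsRightDescent (cs.wordProd Q) x := by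
  rw [← isReduced_reverse_iff, List.reverse_append, List.reverse_singleton, List.singleton_append,
    isReduced_cons, isReduced_reverse_iff, wordProd_reverse, isLeftDescent_inv_iff]

end IsReduced

section AlternatingWord

open CoxeterSystem

variable {B W : Type*} [Group W] {M : CoxeterMatrix B} (cs : CoxeterSystem M W)

theorem reverse_alternatingWord (s t : B) (k : ℕ) :
    (alternatingWord s t k).reverse =
      if Even k then alternatingWord t s k else alternatingWord s t k := by
  induction k generalizing s t with
  | zero => simp [alternatingWord]
  | succ k ih =>
    nth_rewrite 1 [alternatingWord_succ]
    rw [List.concat_eq_append, List.reverse_append, ih]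
    by_cases h : Even k <;> simp [h, Nat.even_add_one, alternatingWord_succ']

theorem inv_wordProd_braidWord (s t : B) :
    (cs.wordProd (braidWord M s t))⁻¹ = cs.wordProd (braidWord M s t) := by
  rw [← wordProd_reverse, braidWord, reverse_alternatingWord]
  split_ifs
  · rw [← braidWord, wordProd_braidWord_eq, braidWord, M.symmetric]
  · rfl

theorem wordProd_alternatingWord_succ (s t : B) (k : ℕ) :
    cs.wordProd (alternatingWord s t (k + 1)) =
      cs.wordProd (alternatingWord t s k) * cs.simple t := by
  rw [alternatingWord_succ, wordProd_concat]

theorem length_mul_wordProd_alternatingWord_le (v : W) (s t : B) (k : ℕ) :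
    cs.length (v * cs.wordProd (alternatingWord s t k)) ≤ cs.length v + k :=
  (cs.length_mul_le _ _).trans <| Nat.add_le_add_left
    ((cs.length_wordProd_le _).trans (length_alternatingWord s t k).le) _

theorem isRightDescent_mul_alternatingWord {v : W} {s t : B} {k : ℕ} (hk : k ≠ 0)
    (hl : cs.length (v * cs.wordProd (alternatingWord s t k)) = cs.length v + k) :
    cs.IsRightDescent (v * cs.wordProd (alternatingWord s t k)) t := by
  obtain ⟨k, rfl⟩ := Nat.exists_eq_succ_of_ne_zero hk
  have hle := length_mul_wordProd_alternatingWord_le cs v t s k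
  rw [IsRightDescent, hl, wordProd_alternatingWord_succ, ← mul_assoc,
    cs.simple_mul_simple_cancel_right]
  omega

theorem le_of_length_mul_alternatingWord {v : W} {s t : B} {k : ℕ} (h0 : M s t ≠ 0)
    (hl : cs.length (v * cs.wordProd (alternatingWord s t k)) = cs.length v + k) :
    k ≤ M s t := by
  by_contra! hk
  refine cs.not_isReduced_alternatingWord s t h0 hk ?_
  have hle := cs.length_mul_le v (cs.wordProd (alternatingWord s t k))
  refine (cs.length_wordProd_le _).antisymm ?_
  rw [length_alternatingWord]
  omega

theorem lt_of_not_isRightDescent_mul_alternatingWord {v : W} {s t : B} {k : ℕ} (h0 : M s t ≠ 0)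
    (hl : cs.length (v * cs.wordProd (alternatingWord s t k)) = cs.length v + k)
    (hs : ¬ cs.IsRightDescent (v * cs.wordProd (alternatingWord s t k)) s) : k < M s t := by
  refine (le_of_length_mul_alternatingWord cs h0 hl).lt_of_ne ?_
  rintro rfl
  rw [← braidWord, wordProd_braidWord_eq, braidWord, M.symmetric] at hs hl
  exact hs (isRightDescent_mul_alternatingWord cs h0 hl)

theorem exists_eq_mul_alternatingWord (w : W) (s t : B) :
    ∃ v k, ¬ cs.IsRightDescent v s ∧ ¬ cs.IsRightDescent v t ∧ cs.length w = cs.length v + k ∧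
      (w = v * cs.wordProd (alternatingWord s t k) ∨
        w = v * cs.wordProd (alternatingWord t s k)) := by
  induction hn : cs.length w using Nat.strong_induction_on generalizing w s t with
  | _ n ih =>
    subst hn
    wlog hs : cs.IsRightDescent w s generalizing s t
    · by_cases ht : cs.IsRightDescent w t
      · obtain ⟨v, k, h⟩ := this t s ht
        exact ⟨v, k, h.2.1, h.1, h.2.2.1, h.2.2.2.symm⟩
      · exact ⟨w, 0, hs, ht, rfl, Or.inl (by simp [alternatingWord])⟩
    obtain ⟨v, k, hvs, hvt, hl, hw | hw⟩ := ih _ hs (w * cs.simple s) s t rfl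
    all_goals
      replace hw := eq_mul_inv_of_mul_eq hw
      rw [inv_simple, mul_assoc] at hw
      rw [isRightDescent_iff] at hs
    · exact ⟨v, k + 1, hvs, hvt, by omega, Or.inr (by rw [wordProd_alternatingWord_succ, hw])⟩
    · have h0 : k = 0 := by
        by_contra hk
        obtain ⟨k, rfl⟩ := Nat.exists_eq_succ_of_ne_zero hk
        rw [Nat.succ_eq_add_one, wordProd_alternatingWord_succ,
          cs.simple_mul_simple_cancel_right] at hw
        have := length_mul_wordProd_alternatingWord_le cs v s t k
        rw [← hw] at this
        omega
      subst h0
      refine ⟨v, 1, hvs, hvt, by omega, Or.inr ?_⟩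
      rw [hw, wordProd_alternatingWord_succ]
      rfl

end AlternatingWord

namespace IsGeneralizedCartanMatrix

open CoxeterSystem

variable {B W : Type*} [Fintype B] [Group W] {M : CoxeterMatrix B} {a : Matrix B B ℝ}
variable (ha : IsGeneralizedCartanMatrix M a) (cs : CoxeterSystem M W)
include ha

theorem geomRep_nonneg {w : W} {s : B} (h : ¬ cs.IsRightDescent w s) :
    0 ≤ ha.geomRep cs w (simpleRoot s) := by
  induction hn : cs.length w using Nat.strong_induction_on generalizing w s with
  | _ n ih =>
    subst hn
    rcases eq_or_ne w 1 with rfl | hw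
    · simpa using simpleRoot_nonneg s
    obtain ⟨t, ht⟩ := cs.exists_rightDescent_of_ne_one hw
    have hst : s ≠ t := by
      rintro rfl
      exact h ht
    obtain ⟨v, k, hvs, hvt, hl, hv⟩ := exists_eq_mul_alternatingWord cs w s t
    have hk : k ≠ 0 := by
      rintro rfl
      obtain rfl : w = v := by simpa [alternatingWord] using hv
      exact hvt ht
    obtain rfl : w = v * cs.wordProd (alternatingWord s t k) := by
      rcases hv with hv | rfl
      · exact hv
      · exact absurd (isRightDescent_mul_alternatingWord cs hk hl) h
    refine ha.geomRep_mul_alternatingWord_nonneg cs hst ?_ (ih _ (by omega) hvs rfl)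
      (ih _ (by omega) hvt rfl)
    by_contra! h0
    exact h0.2.not_gt (lt_of_not_isRightDescent_mul_alternatingWord cs h0.1 hl h)

theorem geomRep_mul_simple_simpleRoot (w : W) (s : B) :
    ha.geomRep cs (w * cs.simple s) (simpleRoot s) = -ha.geomRep cs w (simpleRoot s) := by
  rw [map_mul, LinearEquiv.mul_apply, geomRep_simple, reflection_apply,
    ha.simpleRefl_simpleRoot_self, map_neg]

theorem geomRep_nonpos {w : W} {s : B} (h : cs.IsRightDescent w s) :
    ha.geomRep cs w (simpleRoot s) ≤ 0 := by
  rw [← neg_nonneg, ← geomRep_mul_simple_simpleRoot]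
  exact ha.geomRep_nonneg cs (cs.isRightDescent_iff_not_isRightDescent_mul.1 h)

theorem geomRep_simpleRoot_ne_zero (w : W) (s : B) : ha.geomRep cs w (simpleRoot s) ≠ 0 :=
  (LinearEquiv.map_ne_zero_iff _).2 (simpleRoot_ne_zero s)

theorem geomRep_nonneg_iff {w : W} {s : B} :
    0 ≤ ha.geomRep cs w (simpleRoot s) ↔ ¬ cs.IsRightDescent w s :=
  ⟨fun h hd => ha.geomRep_simpleRoot_ne_zero cs w s (le_antisymm (ha.geomRep_nonpos cs hd) h),
    ha.geomRep_nonneg cs⟩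

theorem geomRep_injective : Function.Injective (ha.geomRep cs) := by
  rw [injective_iff_map_eq_one]
  intro w h
  by_contra hw
  obtain ⟨t, ht⟩ := cs.exists_rightDescent_of_ne_one hw
  refine (ha.geomRep_nonneg_iff cs).1 ?_ ht
  simpa [h] using simpleRoot_nonneg t

end IsGeneralizedCartanMatrix

namespace IsGeneralizedCartanMatrix

open CoxeterSystem

variable {B W : Type*} [Finite B] [Group W] {M : CoxeterMatrix B} {a : Matrix B B ℝ}
variable (ha : IsGeneralizedCartanMatrix M a) (cs : CoxeterSystem M W)
include ha

theorem length_mul_alternatingWord {v : W} {s t : B} (hst : s ≠ t)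
    (hs : ¬ cs.IsRightDescent v s) (ht : ¬ cs.IsRightDescent v t) {k : ℕ}
    (hk : M s t = 0 ∨ k ≤ M s t) :
    cs.length (v * cs.wordProd (alternatingWord s t k)) = cs.length v + k := by
  cases nonempty_fintype B
  induction k generalizing s t with
  | zero => simp [alternatingWord]
  | succ k ih =>
    have hk' : M t s = 0 ∨ k < M t s := by
      rw [M.symmetric t s]
      omega
    rw [wordProd_alternatingWord_succ, ← mul_assoc, cs.not_isRightDescent_iff.1,
      ih hst.symm ht hs (by omega), add_assoc]
    exact (ha.geomRep_nonneg_iff cs).1 <| ha.geomRep_mul_alternatingWord_nonneg cs hst.symm hk'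
      (ha.geomRep_nonneg cs ht) (ha.geomRep_nonneg cs hs)

theorem length_alternatingWord {s t : B} (hst : s ≠ t) {k : ℕ} (hk : M s t = 0 ∨ k ≤ M s t) :
    cs.length (cs.wordProd (alternatingWord s t k)) = k := by
  simpa using ha.length_mul_alternatingWord cs hst (cs.not_isRightDescent_one s)
    (cs.not_isRightDescent_one t) hk

include cs in
theorem coxeterMatrix_ne_zero [Finite W] (s t : B) : M s t ≠ 0 := by
  intro h0
  have hst : s ≠ t := by
    rintro rfl
    simp at h0
  have hle := cs.length_le_length_longest
    (cs.wordProd (alternatingWord s t (cs.length cs.longest + 1)))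
  rw [ha.length_alternatingWord cs hst (Or.inl h0)] at hle
  omega

theorem isReduced_braidWord {s t : B} (hst : s ≠ t) : cs.IsReduced (braidWord M s t) :=
  (ha.length_alternatingWord cs hst (Or.inr le_rfl)).trans
    (CoxeterSystem.length_alternatingWord s t _).symm

theorem exists_eq_mul_braidWord {w : W} {s t : B} (hst : s ≠ t)
    (hs : cs.IsRightDescent w s) (ht : cs.IsRightDescent w t) :
    ∃ v, w = v * cs.wordProd (braidWord M s t) ∧ cs.length w = cs.length v + M s t := by
  cases nonempty_fintype B
  obtain ⟨v, k, hvs, hvt, hl, hv⟩ := exists_eq_mul_alternatingWord cs w s t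
  wlog hv' : w = v * cs.wordProd (alternatingWord s t k) generalizing s t
  · obtain ⟨u, hu, hlu⟩ := this hst.symm ht hs hvt hvs hv.symm (hv.resolve_left hv')
    exact ⟨u, by rw [hu, wordProd_braidWord_eq], by rw [hlu, M.symmetric]⟩
  subst hv'
  have hge : ¬ (M s t = 0 ∨ k < M s t) := fun h =>
    (ha.geomRep_nonneg_iff cs).1 (ha.geomRep_mul_alternatingWord_nonneg cs hst h
      (ha.geomRep_nonneg cs hvs) (ha.geomRep_nonneg cs hvt)) hs
  push Not at hge
  obtain rfl : k = M s t := (le_of_length_mul_alternatingWord cs hge.1 hl).antisymm hge.2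
  exact ⟨v, rfl, hl⟩

theorem exists_eq_braidWord_mul {w : W} {s t : B} (hst : s ≠ t)
    (hs : cs.IsLeftDescent w s) (ht : cs.IsLeftDescent w t) :
    ∃ v, w = cs.wordProd (braidWord M s t) * v ∧ cs.length w = M s t + cs.length v := by
  rw [← isRightDescent_inv_iff] at hs ht
  obtain ⟨v, hv, hl⟩ := ha.exists_eq_mul_braidWord cs hst hs ht
  refine ⟨v⁻¹, ?_, ?_⟩
  · rw [← inv_inv w, hv, mul_inv_rev, inv_wordProd_braidWord]
  · rw [length_inv] at hl ⊢
    omega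

end IsGeneralizedCartanMatrix

/-! ### Matsumoto's theorem -/

namespace ArtinMonoid

open CoxeterSystem

section

variable {B : Type*} {M : CoxeterMatrix B}

/-- The generator of `B⁺` given by a simple reflection. -/
def gen (M : CoxeterMatrix B) (s : B) : ArtinMonoid M := ofWord M [s]

theorem ofWord_cons (s : B) (Q : List B) : ofWord M (s :: Q) = gen M s * ofWord M Q :=
  ofWord_append [s] Q

theorem ofWord_concat (Q : List B) (s : B) : ofWord M (Q ++ [s]) = ofWord M Q * gen M s :=
  ofWord_append Q [s]

theorem length_gen (s : B) : length (gen M s) = 1 := length_ofWord [s]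

theorem length_one : length (1 : ArtinMonoid M) = 0 := length_ofWord []

@[elab_as_elim]
theorem induction_gen_mul {p : ArtinMonoid M → Prop} (b : ArtinMonoid M) (one : p 1)
    (gen_mul : ∀ s b, p b → p (gen M s * b)) : p b := by
  obtain ⟨Q, rfl⟩ := ofWord_surjective b
  induction Q with
  | nil => exact one
  | cons s Q ih => exact ofWord_cons (M := M) s Q ▸ gen_mul s _ ih

theorem exists_eq_gen_mul {b : ArtinMonoid M} (h : b ≠ 1) : ∃ s x, b = gen M s * x := by
  induction b using induction_gen_mul with
  | one => exact absurd rfl h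
  | gen_mul s x => exact ⟨s, x, rfl⟩

theorem le_iff {u w : ArtinMonoid M} : u ≤ w ↔ ∃ v, u * v = w :=
  ⟨fun ⟨v, hv, _⟩ => ⟨v, hv⟩, fun ⟨v, hv⟩ => ⟨v, hv, by rw [← length_mul, hv]⟩⟩

theorem le_mul_right (u v : ArtinMonoid M) : u ≤ u * v := le_iff.2 ⟨v, rfl⟩

theorem one_le (u : ArtinMonoid M) : 1 ≤ u := le_iff.2 ⟨u, one_mul u⟩

theorem mul_le_mul_left {u v : ArtinMonoid M} (h : u ≤ v) (x : ArtinMonoid M) :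
    x * u ≤ x * v := by
  obtain ⟨y, rfl⟩ := le_iff.1 h
  rw [← mul_assoc]
  exact le_mul_right _ _

theorem length_le_of_le {u v : ArtinMonoid M} (h : u ≤ v) : length u ≤ length v := by
  obtain ⟨y, rfl⟩ := le_iff.1 h
  rw [length_mul]
  exact Nat.le_add_right _ _

theorem ofWord_braidWord (s t : B) : ofWord M (braidWord M s t) = ofWord M (braidWord M t s) :=
  PresentedMonoid.mk_eq_mk_of_rel ⟨s, t, rfl, rfl⟩

theorem gen_le_ofWord_braidWord {s t : B} (h0 : M s t ≠ 0) :
    gen M s ≤ ofWord M (braidWord M s t) := by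
  obtain ⟨k, hk⟩ := Nat.exists_eq_succ_of_ne_zero h0
  by_cases he : Even k
  · rw [ofWord_braidWord, braidWord, M.symmetric, hk, Nat.succ_eq_add_one, alternatingWord_succ',
      if_pos he, ofWord_cons]
    exact le_mul_right _ _
  · rw [braidWord, hk, Nat.succ_eq_add_one, alternatingWord_succ', if_neg he, ofWord_cons]
    exact le_mul_right _ _

end

variable {B W : Type*} [Group W] {M : CoxeterMatrix B} (cs : CoxeterSystem M W)

/-- The projection of the positive Artin monoid onto the Coxeter group. -/
def toCoxeter : ArtinMonoid M →* W :=
  PresentedMonoid.lift cs.simple (by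
    rintro _ _ ⟨s, t, rfl, rfl⟩
    simpa [FreeMonoid.lift_apply, wordProd] using cs.wordProd_braidWord_eq s t)

theorem toCoxeter_ofWord (Q : List B) : toCoxeter cs (ofWord M Q) = cs.wordProd Q := by
  change FreeMonoid.lift cs.simple (FreeMonoid.ofList Q) = _
  simp [FreeMonoid.lift_apply, wordProd]

theorem toCoxeter_gen (s : B) : toCoxeter cs (gen M s) = cs.simple s := by
  rw [gen, toCoxeter_ofWord, wordProd_singleton]

theorem length_toCoxeter_le (b : ArtinMonoid M) : cs.length (toCoxeter cs b) ≤ length b := by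
  obtain ⟨Q, rfl⟩ := ofWord_surjective b
  rw [toCoxeter_ofWord, length_ofWord]
  exact cs.length_wordProd_le Q

/-- An element of `B⁺` is reduced if its words are reduced words of the Coxeter group. -/
def IsReduced (b : ArtinMonoid M) : Prop := cs.length (toCoxeter cs b) = length b

theorem isReduced_ofWord {Q : List B} : IsReduced cs (ofWord M Q) ↔ cs.IsReduced Q := by
  rw [IsReduced, toCoxeter_ofWord, length_ofWord, CoxeterSystem.IsReduced]

theorem isReduced_mul {x y : ArtinMonoid M} : IsReduced cs (x * y) ↔
    IsReduced cs x ∧ IsReduced cs y ∧ cs.length (toCoxeter cs x * toCoxeter cs y) =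
      cs.length (toCoxeter cs x) + cs.length (toCoxeter cs y) := by
  have hmul := cs.length_mul_le (toCoxeter cs x) (toCoxeter cs y)
  have hx := length_toCoxeter_le cs x
  have hy := length_toCoxeter_le cs y
  simp only [IsReduced, length_mul, map_mul]
  omega

theorem isReduced_toArtin (w : W) : IsReduced cs (cs.toArtin w) :=
  (isReduced_ofWord cs).2 (Classical.choose_spec (cs.exists_isReduced w)).1

theorem toCoxeter_toArtin (w : W) : toCoxeter cs (cs.toArtin w) = w := by
  rw [toArtin, toCoxeter_ofWord]
  exact (Classical.choose_spec (cs.exists_isReduced w)).2.symm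

variable {cs}

theorem IsReduced.isLeftDescent {s : B} {x : ArtinMonoid M} (h : IsReduced cs (gen M s * x)) :
    cs.IsLeftDescent (toCoxeter cs (gen M s * x)) s := by
  have hl := ((isReduced_mul cs).1 h).2.2
  rw [toCoxeter_gen, length_simple] at hl
  rw [IsLeftDescent, map_mul, toCoxeter_gen, simple_mul_simple_cancel_left]
  omega

variable (cs) {a : Matrix B B ℝ} (ha : IsGeneralizedCartanMatrix M a) [Finite B] [Finite W]
include ha

theorem exists_isReduced_of_isLeftDescent {w : W} {s t : B} (hs : cs.IsLeftDescent w s)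
    (ht : cs.IsLeftDescent w t) : ∃ x y : ArtinMonoid M, gen M s * x = gen M t * y ∧
      IsReduced cs (gen M s * x) ∧ toCoxeter cs (gen M s * x) = w := by
  rcases eq_or_ne s t with rfl | hst
  · obtain ⟨Q, hQ, hQw⟩ := cs.exists_isReduced (cs.simple s * w)
    refine ⟨ofWord M Q, _, rfl, ?_, ?_⟩
    · rw [IsReduced, map_mul, toCoxeter_gen, toCoxeter_ofWord, ← hQw,
        simple_mul_simple_cancel_left, length_mul, length_gen, length_ofWord, ← hQ.eq, ← hQw,
        add_comm, cs.isLeftDescent_iff.1 hs]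
    · rw [map_mul, toCoxeter_gen, toCoxeter_ofWord, ← hQw, simple_mul_simple_cancel_left]
  · obtain ⟨v, hv, hl⟩ := ha.exists_eq_braidWord_mul cs hst hs ht
    obtain ⟨Q, hQ, rfl⟩ := cs.exists_isReduced v
    obtain ⟨x, hx⟩ := le_iff.1 (gen_le_ofWord_braidWord (ha.coxeterMatrix_ne_zero cs s t))
    obtain ⟨y, hy⟩ := le_iff.1 (gen_le_ofWord_braidWord (ha.coxeterMatrix_ne_zero cs t s))
    refine ⟨x * ofWord M Q, y * ofWord M Q, ?_, ?_, ?_⟩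
    · rw [← mul_assoc, hx, ofWord_braidWord, ← hy, mul_assoc]
    all_goals rw [← mul_assoc, hx]
    · rw [IsReduced, map_mul, toCoxeter_ofWord, toCoxeter_ofWord, ← hv, hl, length_mul,
        length_ofWord, length_ofWord, length_alternatingWord, hQ.eq]
    · rw [map_mul, toCoxeter_ofWord, toCoxeter_ofWord, hv]

variable {cs} in
theorem IsReduced.eq_of_toCoxeter_eq {b b' : ArtinMonoid M} (hb : IsReduced cs b)
    (hb' : IsReduced cs b') (h : toCoxeter cs b = toCoxeter cs b') : b = b' := by
  induction hn : length b using Nat.strong_induction_on generalizing b b' with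
  | _ n ih =>
    have hlen : length b = length b' := by rw [← hb, ← hb', h]
    have cancel {s : B} {x y : ArtinMonoid M} (hx : IsReduced cs (gen M s * x))
        (hy : IsReduced cs (gen M s * y)) (hlt : length x < n)
        (h : toCoxeter cs (gen M s * x) = toCoxeter cs (gen M s * y)) :
        gen M s * x = gen M s * y := by
      rw [map_mul, map_mul, mul_right_inj] at h
      rw [ih _ hlt ((isReduced_mul cs).1 hx).2.1 ((isReduced_mul cs).1 hy).2.1 h rfl]
    by_cases hb1 : b = 1
    · rw [hb1, length_one] at hlen
      rw [hb1, eq_one_of_length_eq_zero hlen.symm]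
    have hb1' : b' ≠ 1 := by
      rintro rfl
      exact hb1 (eq_one_of_length_eq_zero (hlen.trans length_one))
    obtain ⟨s, x, rfl⟩ := exists_eq_gen_mul hb1
    obtain ⟨t, y, rfl⟩ := exists_eq_gen_mul hb1'
    obtain ⟨x', y', hxy, hred, hx'⟩ := exists_isReduced_of_isLeftDescent cs ha
      hb.isLeftDescent (h ▸ hb'.isLeftDescent)
    rw [length_mul, length_gen] at hlen hn
    rw [length_mul, length_gen] at hlen
    rw [cancel hb hred (by omega) hx'.symm, hxy,
      cancel hb' (hxy ▸ hred) (by omega) (by rw [← h, ← hx', hxy])]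

variable {cs} in
theorem IsReduced.toArtin_toCoxeter {b : ArtinMonoid M} (hb : IsReduced cs b) :
    cs.toArtin (toCoxeter cs b) = b :=
  (isReduced_toArtin cs _).eq_of_toCoxeter_eq ha hb (toCoxeter_toArtin cs _)

theorem toArtin_mul {x y : W} (h : cs.length (x * y) = cs.length x + cs.length y) :
    cs.toArtin (x * y) = cs.toArtin x * cs.toArtin y := by
  have hred : IsReduced cs (cs.toArtin x * cs.toArtin y) := by
    rw [isReduced_mul, toCoxeter_toArtin, toCoxeter_toArtin]
    exact ⟨isReduced_toArtin cs x, isReduced_toArtin cs y, h⟩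
  rw [← hred.toArtin_toCoxeter ha, map_mul, toCoxeter_toArtin, toCoxeter_toArtin]

theorem toArtin_one : cs.toArtin 1 = 1 := by
  have hred : IsReduced cs 1 := by rw [IsReduced, map_one, CoxeterSystem.length_one, length_one]
  rw [← hred.toArtin_toCoxeter ha, map_one]

theorem toArtin_simple (s : B) : cs.toArtin (cs.simple s) = gen M s := by
  have hred : IsReduced cs (gen M s) := by
    rw [IsReduced, toCoxeter_gen, length_simple, length_gen]
  rw [← hred.toArtin_toCoxeter ha, toCoxeter_gen]

end ArtinMonoid

/-! ### Meets in positive Artin monoids -/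

theorem exists_covBy_le_of_mem {X : Type*} [PartialOrder X] {S : Set X} (hfin : S.Finite)
    (hconn : S.OrdConnected) {z y : X} (hz : z ∈ S) (hy : y ∈ S) (hzy : z < y) :
    ∃ x ∈ S, z ⋖ x ∧ x ≤ y := by
  obtain ⟨x, hx⟩ := (hfin.subset (Set.sep_subset S fun x => z < x ∧ x ≤ y)).exists_minimal
    ⟨y, hy, hzy, le_rfl⟩
  refine ⟨x, hx.prop.1, ⟨hx.prop.2.1, fun v hzv hvx => ?_⟩, hx.prop.2.2⟩
  exact hvx.not_ge (hx.le_of_le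
    ⟨hconn.out hz hx.prop.1 ⟨hzv.le, hvx.le⟩, hzv, hvx.le.trans hx.prop.2.2⟩ hvx.le)

/-- A form of Newman's lemma. -/
theorem exists_isGreatest_of_covBy {X : Type*} [PartialOrder X] {S : Set X} (hfin : S.Finite)
    (hconn : S.OrdConnected) {b : X} (hb : IsLeast S b)
    (hconf : ∀ z ∈ S, ∀ x ∈ S, ∀ y ∈ S, z ⋖ x → z ⋖ y → ∃ u ∈ S, x ≤ u ∧ y ≤ u) :
    ∃ m, IsGreatest S m := by
  suffices h : ∀ z ∈ S, ∃ m ∈ S, ∀ y ∈ S, z ≤ y → y ≤ m by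
    obtain ⟨m, hm, hmax⟩ := h b hb.1
    exact ⟨m, hm, fun y hy => hmax y hy (hb.2 hy)⟩
  intro z hz
  refine (hfin.wellFoundedOn (r := (· > ·))).induction hz
    (P := fun z => ∃ m ∈ S, ∀ y ∈ S, z ≤ y → y ≤ m) fun z hz ih => ?_
  by_cases hex : ∃ x ∈ S, z < x
  · obtain ⟨x₀, hx₀, hzx₀⟩ := hex
    obtain ⟨x, hx, hzx, -⟩ := exists_covBy_le_of_mem hfin hconn hz hx₀ hzx₀
    obtain ⟨m, hm, hmax⟩ := ih x hx hzx.lt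
    refine ⟨m, hm, fun y hy hzy => ?_⟩
    rcases hzy.eq_or_lt with rfl | hzy
    · exact hzx.le.trans (hmax x hx le_rfl)
    obtain ⟨x', hx', hzx', hx'y⟩ := exists_covBy_le_of_mem hfin hconn hz hy hzy
    obtain ⟨m', hm', hmax'⟩ := ih x' hx' hzx'.lt
    obtain ⟨u, hu, hxu, hx'u⟩ := hconf z hz x hx x' hx' hzx hzx'
    exact (hmax' y hy hx'y).trans (hmax m' hm' (hxu.trans (hmax' u hu hx'u)))
  · exact ⟨z, hz, fun y hy hzy => (hzy.eq_or_lt.resolve_right fun h => hex ⟨y, hy, h⟩).ge⟩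

/-- The (right) weak order on a Coxeter group: `z` is a prefix of a reduced word of `w`. -/
def WeakLE {B W : Type*} [Group W] {M : CoxeterMatrix B} (cs : CoxeterSystem M W) (z w : W) :
    Prop :=
  cs.length z + cs.length (z⁻¹ * w) = cs.length w

namespace WeakLE

open CoxeterSystem

variable {B W : Type*} [Group W] {M : CoxeterMatrix B} {cs : CoxeterSystem M W}

protected theorem refl (w : W) : WeakLE cs w w := by simp [WeakLE]

theorem one_left (w : W) : WeakLE cs 1 w := by simp [WeakLE]

theorem self_mul_iff {x y : W} :
    WeakLE cs x (x * y) ↔ cs.length (x * y) = cs.length x + cs.length y := by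
  rw [WeakLE, inv_mul_cancel_left, eq_comm]

theorem length_inv_mul {x y z : W} (hxy : WeakLE cs x y) (hyz : WeakLE cs y z) :
    cs.length (x⁻¹ * z) = cs.length (x⁻¹ * y) + cs.length (y⁻¹ * z) := by
  have hxz := cs.length_mul_le x (x⁻¹ * z)
  have hmul := cs.length_mul_le (x⁻¹ * y) (y⁻¹ * z)
  rw [mul_inv_cancel_left] at hxz
  rw [mul_assoc, mul_inv_cancel_left] at hmul
  simp only [WeakLE] at hxy hyz
  omega

protected theorem trans {x y z : W} (hxy : WeakLE cs x y) (hyz : WeakLE cs y z) :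
    WeakLE cs x z := by
  have := length_inv_mul hxy hyz
  simp only [WeakLE] at hxy hyz ⊢
  omega

protected theorem antisymm {x y : W} (hxy : WeakLE cs x y) (hyx : WeakLE cs y x) : x = y := by
  simp only [WeakLE] at hxy hyx
  exact inv_mul_eq_one.1 (cs.length_eq_zero_iff.1 (by omega))

/-- The weak order, as a partial order to be activated locally. -/
abbrev partialOrder (cs : CoxeterSystem M W) : PartialOrder W where
  le := WeakLE cs
  le_refl := WeakLE.refl
  le_trans _ _ _ := WeakLE.trans
  le_antisymm _ _ := WeakLE.antisymm

theorem length_mul_of_le {x z y : W} (hzy : WeakLE cs z y)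
    (hy : cs.length (x * y) = cs.length x + cs.length y) :
    cs.length (x * z) = cs.length x + cs.length z := by
  have hle := cs.length_mul_le x z
  have hmul := cs.length_mul_le (x * z) (z⁻¹ * y)
  rw [mul_assoc, mul_inv_cancel_left] at hmul
  simp only [WeakLE] at hzy
  omega

theorem mul_left_iff {x y z : W} (hy : cs.length (x * y) = cs.length x + cs.length y)
    (hz : cs.length (x * z) = cs.length x + cs.length z) :
    WeakLE cs (x * y) (x * z) ↔ WeakLE cs y z := by
  rw [WeakLE, WeakLE, show (x * y)⁻¹ * (x * z) = y⁻¹ * z by group]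
  omega

theorem isLeftDescent {s : B} {z w : W} (hzw : WeakLE cs z w)
    (hs : cs.length (z * cs.simple s) = cs.length z + 1) (hzs : WeakLE cs (z * cs.simple s) w) :
    cs.IsLeftDescent (z⁻¹ * w) s := by
  rw [WeakLE, mul_inv_rev, inv_simple, mul_assoc] at hzs
  rw [WeakLE] at hzw
  rw [isLeftDescent_iff]
  omega

theorem exists_mul_simple {z w : W} (hzw : WeakLE cs z w) (hne : z ≠ w) :
    ∃ s, cs.length (z * cs.simple s) = cs.length z + 1 ∧ WeakLE cs (z * cs.simple s) w := by
  obtain ⟨s, hs⟩ := cs.exists_leftDescent_of_ne_one fun h => hne (inv_mul_eq_one.1 h)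
  rw [isLeftDescent_iff] at hs
  have hzs := cs.length_mul_le z (cs.simple s)
  have hw := cs.length_mul_le (z * cs.simple s) (cs.simple s * (z⁻¹ * w))
  rw [mul_assoc, simple_mul_simple_cancel_left, mul_inv_cancel_left] at hw
  rw [length_simple] at hzs
  rw [WeakLE] at hzw
  refine ⟨s, by omega, ?_⟩
  rw [WeakLE, mul_inv_rev, inv_simple, mul_assoc]
  omega

theorem exists_eq_mul_simple_of_covBy {z w : W} (h : @CovBy W (partialOrder cs).toLT z w) :
    ∃ s, w = z * cs.simple s ∧ cs.length (z * cs.simple s) = cs.length z + 1 := by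
  let _ := partialOrder cs
  obtain ⟨s, hs, hle⟩ := exists_mul_simple (cs := cs) h.le h.ne
  refine ⟨s, ((h.eq_or_eq (c := z * cs.simple s) ?_ hle).resolve_left fun heq => ?_).symm, hs⟩
  · exact self_mul_iff.2 (by rw [hs, length_simple])
  · rw [heq] at hs
    omega

end WeakLE

namespace ArtinMonoid

open CoxeterSystem

theorem exists_eq_mul_gen_of_covBy {B : Type*} {M : CoxeterMatrix B} {z x : ArtinMonoid M}
    (h : z ⋖ x) : ∃ s, x = z * gen M s := by
  obtain ⟨v, rfl⟩ := le_iff.1 h.le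
  obtain ⟨s, v, rfl⟩ := exists_eq_gen_mul (b := v) fun hv => h.ne (by rw [hv, mul_one])
  refine ⟨s, ((h.eq_or_eq (le_mul_right z _)
    (mul_le_mul_left (le_mul_right _ v) z)).resolve_left fun heq => ?_).symm⟩
  have hlen := congrArg length heq
  rw [length_mul, length_gen] at hlen
  omega

theorem finite_Iic {B : Type*} [Finite B] {M : CoxeterMatrix B} (b : ArtinMonoid M) :
    (Set.Iic b).Finite := by
  refine ((List.finite_length_le B (length b)).image (ofWord M)).subset fun z hz => ?_
  obtain ⟨Q, rfl⟩ := ofWord_surjective z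
  exact ⟨Q, (length_ofWord Q).symm.trans_le (length_le_of_le hz), rfl⟩

variable {B W : Type*} [Finite B] [Group W] [Finite W] {M : CoxeterMatrix B}
variable (cs : CoxeterSystem M W) {a : Matrix B B ℝ} (ha : IsGeneralizedCartanMatrix M a)

include ha in
theorem weakLE_mul_braidWord {z : W} {s t : B} (hst : s ≠ t)
    (hs : cs.length (z * cs.simple s) = cs.length z + 1)
    (ht : cs.length (z * cs.simple t) = cs.length z + 1) :
    WeakLE cs (z * cs.simple s) (z * cs.wordProd (braidWord M s t)) := by
  have hz := ha.length_mul_alternatingWord cs hst (cs.not_isRightDescent_iff.2 hs)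
    (cs.not_isRightDescent_iff.2 ht) (k := M s t) (Or.inr le_rfl)
  have hbraid : cs.length (cs.wordProd (braidWord M s t)) = M s t :=
    ha.length_alternatingWord cs hst (Or.inr le_rfl)
  obtain ⟨x, hx⟩ := le_iff.1 (gen_le_ofWord_braidWord (ha.coxeterMatrix_ne_zero cs s t))
  have hred : IsReduced cs (gen M s * x) := by
    rw [hx, isReduced_ofWord]
    exact ha.isReduced_braidWord cs hst
  have hle : WeakLE cs (cs.simple s) (cs.wordProd (braidWord M s t)) := by
    rw [← toCoxeter_ofWord, ← hx, map_mul, toCoxeter_gen, WeakLE.self_mul_iff,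
      ← toCoxeter_gen]
    exact ((isReduced_mul cs).1 hred).2.2
  rw [WeakLE.mul_left_iff (by rw [hs, length_simple]) (by rw [hbraid]; exact hz)]
  exact hle

include ha in
theorem exists_garsideMax (x w : W) :
    ∃ v, @IsGreatest W (WeakLE.partialOrder cs).toLE
      {v | WeakLE cs v w ∧ cs.length (x * v) = cs.length x + cs.length v} v := by
  let _ := WeakLE.partialOrder cs
  refine exists_isGreatest_of_covBy (Set.toFinite _) ?_ (b := 1)
    ⟨⟨WeakLE.one_left w, by simp⟩, fun v _ => WeakLE.one_left v⟩ ?_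
  · exact IsLowerSet.ordConnected fun y z (hzy : WeakLE cs z y) hy =>
      ⟨hzy.trans hy.1, hzy.length_mul_of_le hy.2⟩
  rintro z ⟨hzw, hxz⟩ _ ⟨hsw, hxs⟩ _ ⟨htw, hxt⟩ hzs hzt
  obtain ⟨s, rfl, hs⟩ := WeakLE.exists_eq_mul_simple_of_covBy hzs
  obtain ⟨t, rfl, ht⟩ := WeakLE.exists_eq_mul_simple_of_covBy hzt
  rcases eq_or_ne s t with rfl | hst
  · exact ⟨_, ⟨hsw, hxs⟩, le_rfl, le_rfl⟩
  obtain ⟨v, hv, hl⟩ :=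
    ha.exists_eq_braidWord_mul cs hst (hzw.isLeftDescent hs hsw) (hzw.isLeftDescent ht htw)
  have hlen (y : W) (hs : cs.length (y * cs.simple s) = cs.length y + 1)
      (ht : cs.length (y * cs.simple t) = cs.length y + 1) :
      cs.length (y * cs.wordProd (braidWord M s t)) = cs.length y + M s t :=
    ha.length_mul_alternatingWord cs hst (cs.not_isRightDescent_iff.2 hs)
      (cs.not_isRightDescent_iff.2 ht) (Or.inr le_rfl)
  have hz := hlen z hs ht
  refine ⟨z * cs.wordProd (braidWord M s t), ⟨?_, ?_⟩, weakLE_mul_braidWord cs ha hst hs ht, ?_⟩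
  · rw [WeakLE] at hzw ⊢
    rw [mul_inv_rev, mul_assoc, hv, inv_mul_cancel_left, hz]
    omega
  · have := hlen (x * z) (by rw [mul_assoc]; omega) (by rw [mul_assoc]; omega)
    rw [← mul_assoc]
    omega
  · rw [wordProd_braidWord_eq]
    exact weakLE_mul_braidWord cs ha hst.symm ht hs

/-- The longest `v` below `w` in the weak order for which `x * v` is length-additive. -/
def garsideMax (x w : W) : W := Classical.choose (exists_garsideMax cs ha x w)

theorem garsideMax_le (x w : W) : WeakLE cs (garsideMax cs ha x w) w :=
  (Classical.choose_spec (exists_garsideMax cs ha x w)).1.1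

theorem length_mul_garsideMax (x w : W) : cs.length (x * garsideMax cs ha x w) =
    cs.length x + cs.length (garsideMax cs ha x w) :=
  (Classical.choose_spec (exists_garsideMax cs ha x w)).1.2

theorem le_garsideMax {x w y : W} (hyw : WeakLE cs y w)
    (hxy : cs.length (x * y) = cs.length x + cs.length y) : WeakLE cs y (garsideMax cs ha x w) :=
  (Classical.choose_spec (exists_garsideMax cs ha x w)).2 ⟨hyw, hxy⟩

theorem garsideMax_one (w : W) : garsideMax cs ha 1 w = w :=
  (garsideMax_le cs ha 1 w).antisymm (le_garsideMax cs ha (WeakLE.refl w) (by simp))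

theorem garsideMax_mul_le_garsideMax {x y : W} (w : W)
    (h : cs.length (x * y) = cs.length x + cs.length y) :
    WeakLE cs (garsideMax cs ha (x * y) w) (garsideMax cs ha y w) := by
  refine le_garsideMax cs ha (garsideMax_le cs ha _ w) ?_
  have hy := cs.length_mul_le y (garsideMax cs ha (x * y) w)
  have hx := cs.length_mul_le x (y * garsideMax cs ha (x * y) w)
  have hxy := length_mul_garsideMax cs ha (x * y) w
  rw [← mul_assoc] at hx
  omega

theorem garsideMax_mul {x y : W} (w : W) (h : cs.length (x * y) = cs.length x + cs.length y) :
    garsideMax cs ha x (y * garsideMax cs ha y w) = y * garsideMax cs ha (x * y) w := by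
  have huv := garsideMax_mul_le_garsideMax cs ha w h
  have hyv := length_mul_garsideMax cs ha y w
  have hxyu := length_mul_garsideMax cs ha (x * y) w
  set v := garsideMax cs ha y w
  set u := garsideMax cs ha (x * y) w
  have hyu : cs.length (y * u) = cs.length y + cs.length u := huv.length_mul_of_le hyv
  obtain ⟨z, hz⟩ : ∃ z, y * z = garsideMax cs ha x (y * v) := ⟨y⁻¹ * _, mul_inv_cancel_left _ _⟩
  have hyz : cs.length (y * z) = cs.length y + cs.length z := by
    rw [← WeakLE.self_mul_iff, hz]
    exact le_garsideMax cs ha (WeakLE.self_mul_iff.2 hyv) h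
  have hzv : WeakLE cs z v := by
    rw [← WeakLE.mul_left_iff hyz hyv, hz]
    exact garsideMax_le cs ha _ _
  have hxyz := length_mul_garsideMax cs ha x (y * v)
  rw [← hz, ← mul_assoc] at hxyz
  apply WeakLE.antisymm (cs := cs)
  · rw [← hz, WeakLE.mul_left_iff hyz hyu]
    exact le_garsideMax cs ha (hzv.trans (garsideMax_le cs ha _ w)) (by omega)
  · exact le_garsideMax cs ha ((WeakLE.mul_left_iff hyu hyv).2 huv) (by rw [← mul_assoc]; omega)

include ha in
theorem toArtin_mul_toArtin_inv_mul {v w : W} (h : WeakLE cs v w) :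
    cs.toArtin v * cs.toArtin (v⁻¹ * w) = cs.toArtin w := by
  rw [← toArtin_mul cs ha (by rw [mul_inv_cancel_left]; exact h.symm), mul_inv_cancel_left]

/-- Left multiplication by the lift of `x`, on elements of `B⁺` split as the product of the lift
of an element of `W` and a remainder; the first factor is enlarged as far as possible. -/
def garsideAct (x : W) : Function.End (W × ArtinMonoid M) := fun p =>
  (x * garsideMax cs ha x p.1, cs.toArtin ((garsideMax cs ha x p.1)⁻¹ * p.1) * p.2)

theorem garsideAct_one : garsideAct cs ha 1 = 1 :=
  funext fun p => by
    rw [garsideAct, garsideMax_one, one_mul, inv_mul_cancel, toArtin_one cs ha, one_mul]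
    rfl

theorem garsideAct_mul {x y : W} (h : cs.length (x * y) = cs.length x + cs.length y) :
    garsideAct cs ha (x * y) = garsideAct cs ha x * garsideAct cs ha y := by
  refine funext fun ⟨w, r⟩ => ?_
  change garsideAct cs ha (x * y) (w, r) = garsideAct cs ha x (garsideAct cs ha y (w, r))
  have hle := garsideMax_mul_le_garsideMax cs ha w h
  have hlen := hle.length_inv_mul (garsideMax_le cs ha y w)
  simp only [garsideAct, garsideMax_mul cs ha _ h, mul_assoc, mul_inv_rev, inv_mul_cancel_left]
  rw [← mul_assoc (cs.toArtin _), ← toArtin_mul cs ha, mul_assoc, mul_inv_cancel_left]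
  rw [← hlen, mul_assoc, mul_inv_cancel_left]

theorem prod_garsideAct {Q : List B} (hQ : cs.IsReduced Q) :
    (Q.map fun s => garsideAct cs ha (cs.simple s)).prod = garsideAct cs ha (cs.wordProd Q) := by
  induction Q with
  | nil => rw [wordProd_nil, List.map_nil, List.prod_nil, garsideAct_one]
  | cons s Q ih =>
    rw [← isReduced_ofWord, ofWord_cons, isReduced_mul, isReduced_ofWord, toCoxeter_gen,
      toCoxeter_ofWord] at hQ
    rw [List.map_cons, List.prod_cons, ih hQ.2.1, wordProd_cons, garsideAct_mul cs ha hQ.2.2]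

/-- The action of `B⁺` on pairs of an element of `W` and a remainder. -/
def garsideHom : ArtinMonoid M →* Function.End (W × ArtinMonoid M) :=
  PresentedMonoid.lift (fun s => garsideAct cs ha (cs.simple s)) (by
    rintro _ _ ⟨s, t, rfl, rfl⟩
    rcases eq_or_ne s t with rfl | hst
    · rfl
    simp only [FreeMonoid.lift_apply, FreeMonoid.toList_ofList]
    rw [prod_garsideAct cs ha (ha.isReduced_braidWord cs hst),
      prod_garsideAct cs ha (ha.isReduced_braidWord cs hst.symm), wordProd_braidWord_eq])

/-- The Garside splitting of `b ∈ B⁺`: the largest element of `W` whose lift is a prefix of `b`,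
and the remainder. -/
def garsideSplit (b : ArtinMonoid M) : W × ArtinMonoid M := garsideHom cs ha b (1, 1)

theorem garsideSplit_gen_mul (s : B) (b : ArtinMonoid M) :
    garsideSplit cs ha (gen M s * b) = garsideAct cs ha (cs.simple s) (garsideSplit cs ha b) := by
  rw [garsideSplit, map_mul]
  rfl

theorem garsideSplit_mul (b : ArtinMonoid M) :
    cs.toArtin (garsideSplit cs ha b).1 * (garsideSplit cs ha b).2 = b := by
  induction b using induction_gen_mul with
  | one =>
    rw [garsideSplit, map_one, Function.End.one_def, id, toArtin_one cs ha, one_mul]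
  | gen_mul s b ih =>
    rw [garsideSplit_gen_mul, garsideAct, toArtin_mul cs ha (length_mul_garsideMax cs ha _ _),
      toArtin_simple cs ha, mul_assoc, ← mul_assoc (cs.toArtin _) (cs.toArtin _),
      toArtin_mul_toArtin_inv_mul cs ha (garsideMax_le cs ha _ _), ih]

include cs ha

theorem gen_mul_left_cancel {s : B} {b b' : ArtinMonoid M} (h : gen M s * b = gen M s * b') :
    b = b' := by
  have hsplit := congrArg (garsideSplit cs ha) h
  rw [garsideSplit_gen_mul, garsideSplit_gen_mul] at hsplit
  simp only [garsideAct, Prod.mk.injEq, mul_right_inj] at hsplit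
  have hb (b : ArtinMonoid M) :
      cs.toArtin (garsideMax cs ha (cs.simple s) (garsideSplit cs ha b).1) *
        (cs.toArtin ((garsideMax cs ha (cs.simple s) (garsideSplit cs ha b).1)⁻¹ *
          (garsideSplit cs ha b).1) * (garsideSplit cs ha b).2) = b := by
    rw [← mul_assoc, toArtin_mul_toArtin_inv_mul cs ha (garsideMax_le cs ha _ _),
      garsideSplit_mul]
  rw [← hb b, ← hb b', hsplit.2, hsplit.1]

theorem mul_left_cancel {x b b' : ArtinMonoid M} (h : x * b = x * b') : b = b' := by
  induction x using induction_gen_mul with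
  | one => rwa [one_mul, one_mul] at h
  | gen_mul s x ih =>
    rw [mul_assoc, mul_assoc] at h
    exact ih (gen_mul_left_cancel cs ha h)

theorem le_of_mul_le_mul_left {x b b' : ArtinMonoid M} (h : x * b ≤ x * b') : b ≤ b' := by
  obtain ⟨y, hy⟩ := le_iff.1 h
  rw [mul_assoc] at hy
  exact le_iff.2 ⟨y, mul_left_cancel cs ha hy⟩

theorem isLeftDescent_garsideSplit {s : B} {b : ArtinMonoid M} (h : gen M s ≤ b) :
    cs.IsLeftDescent (garsideSplit cs ha b).1 s := by
  obtain ⟨b, rfl⟩ := le_iff.1 h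
  rw [garsideSplit_gen_mul, garsideAct, IsLeftDescent, cs.simple_mul_simple_cancel_left,
    length_mul_garsideMax, length_simple]
  omega

theorem ofWord_braidWord_le {s t : B} {b : ArtinMonoid M} (hst : s ≠ t) (hs : gen M s ≤ b)
    (ht : gen M t ≤ b) : ofWord M (braidWord M s t) ≤ b := by
  obtain ⟨v, hv, hl⟩ := ha.exists_eq_braidWord_mul cs hst (isLeftDescent_garsideSplit cs ha hs)
    (isLeftDescent_garsideSplit cs ha ht)
  have hred := (isReduced_ofWord cs).2 (ha.isReduced_braidWord cs hst)
  rw [← garsideSplit_mul cs ha b, hv, toArtin_mul cs ha, ← toCoxeter_ofWord,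
    hred.toArtin_toCoxeter ha, mul_assoc]
  · exact le_mul_right _ _
  · rw [← hv, hl, ha.length_alternatingWord cs hst (Or.inr le_rfl)]

theorem mul_ofWord_braidWord_le {z b : ArtinMonoid M} {s t : B} (hst : s ≠ t)
    (hs : z * gen M s ≤ b) (ht : z * gen M t ≤ b) : z * ofWord M (braidWord M s t) ≤ b := by
  obtain ⟨v, rfl⟩ := le_iff.1 ((le_mul_right z _).trans hs)
  exact mul_le_mul_left (ofWord_braidWord_le cs ha hst (le_of_mul_le_mul_left cs ha hs)
    (le_of_mul_le_mul_left cs ha ht)) z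

theorem exists_isGLB (x y : ArtinMonoid M) : ∃ g, IsGLB {x, y} g := by
  obtain ⟨g, hg⟩ : ∃ g, IsGreatest (Set.Iic x ∩ Set.Iic y) g := by
    refine exists_isGreatest_of_covBy ((finite_Iic x).inter_of_left _)
      ((isLowerSet_Iic x).inter (isLowerSet_Iic y)).ordConnected
      ⟨⟨one_le x, one_le y⟩, fun z _ => one_le z⟩ ?_
    rintro z - _ ⟨hsx, hsy⟩ _ ⟨htx, hty⟩ hzs hzt
    obtain ⟨s, rfl⟩ := exists_eq_mul_gen_of_covBy hzs
    obtain ⟨t, rfl⟩ := exists_eq_mul_gen_of_covBy hzt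
    rcases eq_or_ne s t with rfl | hst
    · exact ⟨_, ⟨hsx, hsy⟩, le_rfl, le_rfl⟩
    refine ⟨z * ofWord M (braidWord M s t), ⟨mul_ofWord_braidWord_le cs ha hst hsx htx,
      mul_ofWord_braidWord_le cs ha hst hsy hty⟩, ?_, ?_⟩
    · exact mul_le_mul_left (gen_le_ofWord_braidWord (ha.coxeterMatrix_ne_zero cs s t)) z
    · rw [ofWord_braidWord]
      exact mul_le_mul_left (gen_le_ofWord_braidWord (ha.coxeterMatrix_ne_zero cs t s)) z
  refine ⟨g, ?_⟩
  rwa [IsGLB, lowerBounds_insert, lowerBounds_singleton]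

end ArtinMonoid

/-! ### Colored positive roots -/

section ColoredAct

open CoxeterSystem

variable {B : Type*} [Fintype B] {a : Matrix B B ℝ}

/-- The action of a word on colored roots. -/
def coloredAct (a : Matrix B B ℝ) (Q : List B) (b : (B → ℝ) × ℕ) : (B → ℝ) × ℕ :=
  Q.foldr (coloredRefl a) b

theorem coloredAct_nil (b : (B → ℝ) × ℕ) : coloredAct a [] b = b := rfl

theorem coloredAct_cons (s : B) (Q : List B) (b : (B → ℝ) × ℕ) :
    coloredAct a (s :: Q) b = coloredRefl a s (coloredAct a Q b) := rfl

theorem coloredAct_append (Q R : List B) (b : (B → ℝ) × ℕ) :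
    coloredAct a (Q ++ R) b = coloredAct a Q (coloredAct a R b) :=
  List.foldr_append

theorem coloredRefl_simpleRoot (s : B) (k : ℕ) :
    coloredRefl a s (simpleRoot s, k) = (simpleRoot s, k + 1) :=
  if_pos rfl

theorem coloredRefl_of_ne {s : B} {b : (B → ℝ) × ℕ} (h : b.1 ≠ simpleRoot s) :
    coloredRefl a s b = (simpleRefl a s b.1, b.2) :=
  if_neg h

theorem coloredRefl_add_color (s : B) (b : (B → ℝ) × ℕ) (j : ℕ) :
    coloredRefl a s (b.1, b.2 + j) = ((coloredRefl a s b).1, (coloredRefl a s b).2 + j) := by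
  obtain ⟨β, k⟩ := b
  by_cases hs : β = simpleRoot s
  · subst hs
    rw [coloredRefl_simpleRoot, coloredRefl_simpleRoot, add_right_comm]
  · rw [coloredRefl_of_ne (b := (β, k)) hs, coloredRefl_of_ne (by exact hs)]

theorem coloredAct_add_color (Q : List B) (b : (B → ℝ) × ℕ) (j : ℕ) :
    coloredAct a Q (b.1, b.2 + j) = ((coloredAct a Q b).1, (coloredAct a Q b).2 + j) := by
  induction Q with
  | nil => rfl
  | cons s Q ih => rw [coloredAct_cons, ih, coloredRefl_add_color, coloredAct_cons]

theorem color_le_coloredRefl (s : B) (b : (B → ℝ) × ℕ) : b.2 ≤ (coloredRefl a s b).2 := by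
  rw [coloredRefl]
  split_ifs
  · exact Nat.le_succ b.2
  · exact le_rfl

theorem color_le_coloredAct (Q : List B) (b : (B → ℝ) × ℕ) : b.2 ≤ (coloredAct a Q b).2 := by
  induction Q with
  | nil => exact le_rfl
  | cons s Q ih => exact ih.trans (color_le_coloredRefl s _)

theorem coloredAct_fst_of_color_eq {Q : List B} {b : (B → ℝ) × ℕ}
    (h : (coloredAct a Q b).2 = b.2) : (coloredAct a Q b).1 = Q.foldr (simpleRefl a) b.1 := by
  induction Q with
  | nil => rfl
  | cons s Q ih =>
    rw [coloredAct_cons] at h ⊢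
    have hle := color_le_coloredAct (a := a) Q b
    by_cases hs : (coloredAct a Q b).1 = simpleRoot s
    · rw [coloredRefl, if_pos hs] at h
      omega
    · rw [coloredRefl_of_ne hs] at h ⊢
      rw [List.foldr_cons, ih h]

theorem coloredInvSeq_append (Q R : List B) : coloredInvSeq a (Q ++ R) =
    coloredInvSeq a Q ++ (coloredInvSeq a R).map (coloredAct a Q) := by
  induction Q with
  | nil => exact (List.map_id _).symm
  | cons s Q ih =>
    rw [List.cons_append, coloredInvSeq, ih, coloredInvSeq, List.map_append, List.map_map,
      List.cons_append]
    rfl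

theorem mem_coloredInvSeq_append {Q R : List B} {b : (B → ℝ) × ℕ} :
    b ∈ coloredInvSeq a (Q ++ R) ↔
      b ∈ coloredInvSeq a Q ∨ ∃ b' ∈ coloredInvSeq a R, coloredAct a Q b' = b := by
  rw [coloredInvSeq_append, List.mem_append, List.mem_map]

theorem mem_coloredInvSeq_cons {s : B} {Q : List B} {b : (B → ℝ) × ℕ} :
    b ∈ coloredInvSeq a (s :: Q) ↔
      b = (simpleRoot s, 0) ∨ ∃ b' ∈ coloredInvSeq a Q, coloredRefl a s b' = b := by
  rw [coloredInvSeq, List.mem_cons, List.mem_map]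

theorem mem_coloredInvSeq_concat {Q : List B} {x : B} {b : (B → ℝ) × ℕ} :
    b ∈ coloredInvSeq a (Q ++ [x]) ↔
      b ∈ coloredInvSeq a Q ∨ b = coloredAct a Q (simpleRoot x, 0) := by
  simp [mem_coloredInvSeq_append, coloredInvSeq, eq_comm]

theorem length_coloredInvSeq (Q : List B) : (coloredInvSeq a Q).length = Q.length := by
  induction Q with
  | nil => rfl
  | cons s Q ih => rw [coloredInvSeq, List.length_cons, List.length_map, ih, List.length_cons]

theorem mem_coloredInvSeq_of_color_succ {Q : List B} {x : B} {β : B → ℝ} {k : ℕ}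
    (h : coloredAct a Q (simpleRoot x, 0) = (β, k + 1)) : (β, k) ∈ coloredInvSeq a Q := by
  induction Q generalizing β k with
  | nil => exact absurd (congrArg Prod.snd h) (Nat.succ_ne_zero k).symm
  | cons s Q ih =>
    rw [coloredAct_cons] at h
    rw [mem_coloredInvSeq_cons]
    rcases hb : coloredAct a Q (simpleRoot x, 0) with ⟨β', k'⟩
    rw [hb] at h
    by_cases hs : β' = simpleRoot s
    · subst hs
      rw [coloredRefl_simpleRoot, Prod.mk.injEq, Nat.add_right_cancel_iff] at h
      obtain ⟨rfl, rfl⟩ := h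
      rcases k' with _ | k
      · exact Or.inl rfl
      · exact Or.inr ⟨_, ih hb, coloredRefl_simpleRoot s k⟩
    · rw [coloredRefl_of_ne hs, Prod.mk.injEq] at h
      obtain ⟨rfl, rfl⟩ := h
      exact Or.inr ⟨_, ih hb, coloredRefl_of_ne hs⟩

theorem coloredInv_mono {M : CoxeterMatrix B} {u v : ArtinMonoid M} (h : u ≤ v) :
    coloredInv a u ⊆ coloredInv a v := by
  obtain ⟨x, rfl⟩ := ArtinMonoid.le_iff.1 h
  rintro b ⟨Q, rfl, hb⟩
  obtain ⟨R, rfl⟩ := ArtinMonoid.ofWord_surjective x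
  exact ⟨Q ++ R, ArtinMonoid.ofWord_append Q R, mem_coloredInvSeq_append.2 (Or.inl hb)⟩

end ColoredAct

section PosRoot

open CoxeterSystem

variable {B : Type*} [Fintype B] {M : CoxeterMatrix B} {a : Matrix B B ℝ}

/-- The positive roots: the roots with nonnegative coordinates in the basis of simple roots. -/
def IsPosRoot (a : Matrix B B ℝ) (β : B → ℝ) : Prop := β ∈ roots a ∧ 0 ≤ β

theorem isPosRoot_simpleRoot (s : B) : IsPosRoot a (simpleRoot s) :=
  ⟨⟨[], s, rfl⟩, simpleRoot_nonneg s⟩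

theorem eq_simpleRoot_of_forall_ne (hr : IsReducedRoots a) {β : B → ℝ} (h : IsPosRoot a β) {s : B}
    (h0 : ∀ t, t ≠ s → β t = 0) : β = simpleRoot s := by
  have hβ : β = β s • simpleRoot s := by
    ext t
    rcases eq_or_ne t s with rfl | ht
    · simp [simpleRoot_apply_self]
    · simp [simpleRoot_apply_of_ne ht, h0 t ht]
  have hnonneg : 0 ≤ β s := h.2 s
  rcases hr _ (isPosRoot_simpleRoot s).1 (β s) (hβ ▸ h.1) with h1 | h1
  · rw [hβ, h1, one_smul]
  · linarith

theorem IsPosRoot.simpleRefl_ne_simpleRoot (ha : IsGeneralizedCartanMatrix M a) {β : B → ℝ}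
    (h : IsPosRoot a β) (s : B) : simpleRefl a s β ≠ simpleRoot s := by
  intro e
  have hβ : β = -simpleRoot s := by
    rw [← ha.simpleRefl_simpleRefl s β, e, ha.simpleRefl_simpleRoot_self]
  have hnonneg : 0 ≤ β s := h.2 s
  rw [hβ, Pi.neg_apply, simpleRoot_apply_self] at hnonneg
  linarith

theorem coloredRefl_ne_simpleRoot_zero (ha : IsGeneralizedCartanMatrix M a) {b : (B → ℝ) × ℕ}
    (h : IsPosRoot a b.1) (s : B) : coloredRefl a s b ≠ (simpleRoot s, 0) := by
  rw [coloredRefl]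
  split_ifs
  · exact fun e => Nat.succ_ne_zero b.2 (congrArg Prod.snd e)
  · exact fun e => h.simpleRefl_ne_simpleRoot ha s (congrArg Prod.fst e)

theorem coloredRefl_injOn (ha : IsGeneralizedCartanMatrix M a) (s : B) :
    Set.InjOn (coloredRefl a s) {b | IsPosRoot a b.1} := by
  rintro ⟨β, k⟩ (hβ : IsPosRoot a β) ⟨β', k'⟩ (hβ' : IsPosRoot a β') e
  rw [coloredRefl, coloredRefl] at e
  split_ifs at e with hs hs' hs' <;>
    simp only [Prod.mk.injEq, true_and, Nat.add_right_cancel_iff] at hs hs' e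
  · rw [hs, hs', e]
  · exact absurd e.1.symm (hβ'.simpleRefl_ne_simpleRoot ha s)
  · exact absurd e.1 (hβ.simpleRefl_ne_simpleRoot ha s)
  · rw [← ha.simpleRefl_simpleRefl s β, e.1, ha.simpleRefl_simpleRefl, e.2]

variable {W : Type*} [Group W] (cs : CoxeterSystem M W) (ha : IsGeneralizedCartanMatrix M a)

theorem mem_roots_iff {β : B → ℝ} : β ∈ roots a ↔ ∃ w s, β = ha.geomRep cs w (simpleRoot s) := by
  constructor
  · rintro ⟨Q, s, rfl⟩
    exact ⟨cs.wordProd Q, s, (ha.geomRep_wordProd cs Q _).symm⟩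
  · rintro ⟨w, s, rfl⟩
    obtain ⟨Q, rfl⟩ := cs.wordProd_surjective w
    exact ⟨Q, s, ha.geomRep_wordProd cs Q _⟩

theorem geomRep_mem_roots {β : B → ℝ} (h : β ∈ roots a) (w : W) : ha.geomRep cs w β ∈ roots a := by
  obtain ⟨u, s, rfl⟩ := (mem_roots_iff cs ha).1 h
  exact (mem_roots_iff cs ha).2 ⟨w * u, s, by rw [map_mul, LinearEquiv.mul_apply]⟩

include cs ha

theorem ne_zero_of_mem_roots {β : B → ℝ} (h : β ∈ roots a) : β ≠ 0 := by
  obtain ⟨w, s, rfl⟩ := (mem_roots_iff cs ha).1 h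
  exact ha.geomRep_simpleRoot_ne_zero cs w s

theorem neg_mem_roots {β : B → ℝ} (h : β ∈ roots a) : -β ∈ roots a := by
  obtain ⟨w, s, rfl⟩ := (mem_roots_iff cs ha).1 h
  exact (mem_roots_iff cs ha).2 ⟨_, s, (ha.geomRep_mul_simple_simpleRoot cs w s).symm⟩

theorem isPosRoot_or_isPosRoot_neg {β : B → ℝ} (h : β ∈ roots a) :
    IsPosRoot a β ∨ IsPosRoot a (-β) := by
  obtain ⟨w, s, rfl⟩ := (mem_roots_iff cs ha).1 h
  by_cases hd : cs.IsRightDescent w s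
  · exact Or.inr ⟨neg_mem_roots cs ha h, neg_nonneg.2 (ha.geomRep_nonpos cs hd)⟩
  · exact Or.inl ⟨h, ha.geomRep_nonneg cs hd⟩

theorem IsPosRoot.not_neg {β : B → ℝ} (h : IsPosRoot a β) : ¬ IsPosRoot a (-β) := fun h' =>
  ne_zero_of_mem_roots cs ha h.1 (le_antisymm (neg_nonneg.1 h'.2) h.2)

variable (hr : IsReducedRoots a)
include hr

theorem IsPosRoot.simpleRefl {β : B → ℝ} (h : IsPosRoot a β) {s : B} (hs : β ≠ simpleRoot s) :
    IsPosRoot a (simpleRefl a s β) := by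
  have hmem : _root_.simpleRefl a s β ∈ roots a := by
    rw [← ha.reflection_apply, ← ha.geomRep_simple cs]
    exact geomRep_mem_roots cs ha h.1 _
  refine (isPosRoot_or_isPosRoot_neg cs ha hmem).resolve_right fun hneg => hs ?_
  refine eq_simpleRoot_of_forall_ne hr h fun t ht => le_antisymm ?_ (h.2 t)
  rw [← simpleRefl_apply_of_ne (a := a) ht β]
  exact neg_nonneg.1 (hneg.2 t)

theorem IsPosRoot.coloredRefl {b : (B → ℝ) × ℕ} (h : IsPosRoot a b.1) (s : B) :
    IsPosRoot a (coloredRefl a s b).1 := by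
  rw [_root_.coloredRefl]
  split_ifs with hs
  · exact isPosRoot_simpleRoot s
  · exact h.simpleRefl cs ha hr hs

theorem IsPosRoot.coloredAct {b : (B → ℝ) × ℕ} (h : IsPosRoot a b.1) (Q : List B) :
    IsPosRoot a (coloredAct a Q b).1 := by
  induction Q with
  | nil => exact h
  | cons s Q ih => exact ih.coloredRefl cs ha hr s

theorem exists_coloredRefl_eq {b : (B → ℝ) × ℕ} (h : IsPosRoot a b.1) {s : B}
    (hb : b ≠ (simpleRoot s, 0)) : ∃ b', IsPosRoot a b'.1 ∧ _root_.coloredRefl a s b' = b := by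
  obtain ⟨β, k⟩ := b
  by_cases hs : β = simpleRoot s
  · subst hs
    rcases k with _ | k
    · exact absurd rfl hb
    · exact ⟨(simpleRoot s, k), isPosRoot_simpleRoot s, coloredRefl_simpleRoot s k⟩
  · refine ⟨(_root_.simpleRefl a s β, k), h.simpleRefl cs ha hr hs, ?_⟩
    rw [coloredRefl_of_ne (h.simpleRefl_ne_simpleRoot ha s), ha.simpleRefl_simpleRefl]

theorem coloredAct_injOn (Q : List B) : Set.InjOn (coloredAct a Q) {b | IsPosRoot a b.1} := by
  induction Q with
  | nil => exact Set.injOn_id _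
  | cons s Q ih => exact (coloredRefl_injOn ha s).comp ih fun b hb => hb.coloredAct cs ha hr Q

theorem isPosRoot_of_mem_coloredInvSeq {Q : List B} {b : (B → ℝ) × ℕ}
    (h : b ∈ coloredInvSeq a Q) : IsPosRoot a b.1 := by
  induction Q generalizing b with
  | nil => exact absurd h List.not_mem_nil
  | cons s Q ih =>
    rcases mem_coloredInvSeq_cons.1 h with rfl | ⟨b', hb', rfl⟩
    · exact isPosRoot_simpleRoot s
    · exact (ih hb').coloredRefl cs ha hr s

theorem nodup_coloredInvSeq (Q : List B) : (coloredInvSeq a Q).Nodup := by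
  induction Q with
  | nil => exact List.nodup_nil
  | cons s Q ih =>
    have hpos {b} (h : b ∈ coloredInvSeq a Q) := isPosRoot_of_mem_coloredInvSeq cs ha hr h
    rw [coloredInvSeq, List.nodup_cons, List.mem_map]
    refine ⟨?_, ih.map_on fun b hb b' hb' => coloredRefl_injOn ha s (hpos hb) (hpos hb')⟩
    rintro ⟨b, hb, e⟩
    exact coloredRefl_ne_simpleRoot_zero ha (hpos hb) s e

theorem mem_coloredInvSeq_iff {Q : List B} {b : (B → ℝ) × ℕ} (hb : IsPosRoot a b.1) :
    b ∈ coloredInvSeq a Q ↔ b ∉ coloredAct a Q '' {b | IsPosRoot a b.1} := by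
  induction Q generalizing b with
  | nil => exact iff_of_false List.not_mem_nil fun h => h ⟨b, hb, rfl⟩
  | cons s Q ih =>
    rw [mem_coloredInvSeq_cons]
    constructor
    · rintro (rfl | ⟨b', hb', rfl⟩) ⟨d, hd, e⟩
      · exact coloredRefl_ne_simpleRoot_zero ha (hd.coloredAct cs ha hr Q) s e
      · have hpos := isPosRoot_of_mem_coloredInvSeq cs ha hr hb'
        exact (ih hpos).1 hb' ⟨d, hd, coloredRefl_injOn ha s (hd.coloredAct cs ha hr Q) hpos e⟩
    · intro h
      by_contra! hcon
      obtain ⟨b', hb', rfl⟩ := exists_coloredRefl_eq cs ha hr hb hcon.1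
      obtain ⟨d, hd, rfl⟩ := not_not.1 fun h' => hcon.2 b' ((ih hb').2 h') rfl
      exact h ⟨d, hd, rfl⟩

theorem coloredAct_notMem_coloredInvSeq {Q : List B} {b : (B → ℝ) × ℕ} (hb : IsPosRoot a b.1) :
    coloredAct a Q b ∉ coloredInvSeq a Q := fun h =>
  (mem_coloredInvSeq_iff cs ha hr (hb.coloredAct cs ha hr Q)).1 h ⟨b, hb, rfl⟩

end PosRoot

section ColoredRep

open CoxeterSystem

variable {B : Type*} [Fintype B] {M : CoxeterMatrix B} {a : Matrix B B ℝ} {W : Type*} [Group W]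
  (cs : CoxeterSystem M W) (ha : IsGeneralizedCartanMatrix M a) (hr : IsReducedRoots a)

open Classical in
/-- The action of `w ∈ W` on a colored positive root `β⁽ᵏ⁾`, that is, the colored action of a
reduced word for `w`: it is `(w β)⁽ᵏ⁾` if `w β` is positive and `(-w β)⁽ᵏ⁺¹⁾` if `w β` is
negative. -/
def coloredRep (w : W) (b : (B → ℝ) × ℕ) : (B → ℝ) × ℕ :=
  if 0 ≤ ha.geomRep cs w b.1 then (ha.geomRep cs w b.1, b.2) else (-ha.geomRep cs w b.1, b.2 + 1)

theorem coloredRep_of_isPosRoot {w : W} {b : (B → ℝ) × ℕ}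
    (h : IsPosRoot a (ha.geomRep cs w b.1)) : coloredRep cs ha w b = (ha.geomRep cs w b.1, b.2) :=
  if_pos h.2

theorem coloredRep_of_isPosRoot_neg {w : W} {b : (B → ℝ) × ℕ}
    (h : IsPosRoot a (-ha.geomRep cs w b.1)) :
    coloredRep cs ha w b = (-ha.geomRep cs w b.1, b.2 + 1) :=
  if_neg fun h' => h.not_neg cs ha ⟨by simpa using neg_mem_roots cs ha h.1, by simpa using h'⟩

theorem neg_geomRep_ne_simpleRoot {w : W} {s : B} (hs : ¬ cs.IsLeftDescent w s) {β : B → ℝ}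
    (hβ : IsPosRoot a β) : -ha.geomRep cs w β ≠ simpleRoot s := by
  intro e
  rw [← cs.isRightDescent_inv_iff] at hs
  have hnonneg := ha.geomRep_nonneg cs hs
  rw [← e, map_neg, ha.geomRep_inv_apply] at hnonneg
  exact ne_zero_of_mem_roots cs ha hβ.1 (le_antisymm (neg_nonneg.1 hnonneg) hβ.2)

include hr

theorem coloredRefl_coloredRep {w : W} {s : B} (hs : ¬ cs.IsLeftDescent w s) {b : (B → ℝ) × ℕ}
    (hb : IsPosRoot a b.1) :
    coloredRefl a s (coloredRep cs ha w b) = coloredRep cs ha (cs.simple s * w) b := by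
  have hmul : ha.geomRep cs (cs.simple s * w) b.1 = ha.reflection s (ha.geomRep cs w b.1) := by
    rw [map_mul, LinearEquiv.mul_apply, ha.geomRep_simple]
  rcases isPosRoot_or_isPosRoot_neg cs ha (geomRep_mem_roots cs ha hb.1 w) with hpos | hneg
  · rw [coloredRep_of_isPosRoot cs ha hpos]
    by_cases he : ha.geomRep cs w b.1 = simpleRoot s
    · have hs' : ha.geomRep cs (cs.simple s * w) b.1 = -simpleRoot s := by
        rw [hmul, he, ha.reflection_apply, ha.simpleRefl_simpleRoot_self]
      rw [coloredRep_of_isPosRoot_neg cs ha (by rw [hs', neg_neg]; exact isPosRoot_simpleRoot s),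
        he, coloredRefl_simpleRoot, hs', neg_neg]
    · have hs' := hpos.simpleRefl cs ha hr he
      rw [← ha.reflection_apply, ← hmul] at hs'
      rw [coloredRefl_of_ne he, coloredRep_of_isPosRoot cs ha hs', hmul, ha.reflection_apply]
  · have he := neg_geomRep_ne_simpleRoot cs ha hs hb
    have hs' := hneg.simpleRefl cs ha hr he
    rw [← ha.reflection_apply, map_neg, ← hmul] at hs'
    rw [coloredRep_of_isPosRoot_neg cs ha hneg, coloredRefl_of_ne he,
      coloredRep_of_isPosRoot_neg cs ha hs', hmul, ← ha.reflection_apply, map_neg]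

theorem coloredAct_of_isReduced {Q : List B} (hQ : cs.IsReduced Q) {b : (B → ℝ) × ℕ}
    (hb : IsPosRoot a b.1) : coloredAct a Q b = coloredRep cs ha (cs.wordProd Q) b := by
  induction Q with
  | nil => simp [coloredRep, coloredAct_nil, hb.2]
  | cons s Q ih =>
    obtain ⟨hred, hs⟩ := (isReduced_cons cs).1 hQ
    rw [coloredAct_cons, ih hred, coloredRefl_coloredRep cs ha hr hs hb, wordProd_cons]

theorem mem_coloredInvSeq_of_isReduced {Q : List B} (hQ : cs.IsReduced Q) {β : B → ℝ}
    (hβ : IsPosRoot a β) :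
    (β, 0) ∈ coloredInvSeq a Q ↔ IsPosRoot a (-ha.geomRep cs (cs.wordProd Q)⁻¹ β) := by
  set w := cs.wordProd Q
  rw [mem_coloredInvSeq_iff cs ha hr hβ]
  have hmem := geomRep_mem_roots cs ha hβ.1 w⁻¹
  refine ⟨fun h => (isPosRoot_or_isPosRoot_neg cs ha hmem).resolve_left fun hpos => h ?_, ?_⟩
  · refine ⟨(ha.geomRep cs w⁻¹ β, 0), hpos, ?_⟩
    rw [coloredAct_of_isReduced cs ha hr hQ hpos, coloredRep_of_isPosRoot] <;>
      rw [ha.geomRep_apply_inv]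
    exact hβ
  · rintro hneg ⟨b, hb, e⟩
    rw [coloredAct_of_isReduced cs ha hr hQ hb, coloredRep] at e
    split_ifs at e <;> rw [Prod.mk.injEq] at e
    · rw [← e.1, ha.geomRep_inv_apply] at hneg
      exact hb.not_neg cs ha hneg
    · exact Nat.succ_ne_zero _ e.2

include ha in
theorem isReduced_of_color_eq_zero {Q : List B} (h : ∀ b ∈ coloredInvSeq a Q, b.2 = 0) :
    cs.IsReduced Q := by
  induction Q using List.reverseRecOn with
  | nil => simp [CoxeterSystem.IsReduced]
  | append_singleton Q x ih =>
    have hQ := ih fun b hb => h b (mem_coloredInvSeq_concat.2 (Or.inl hb))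
    have hx := h _ (mem_coloredInvSeq_concat.2 (Or.inr rfl))
    refine (isReduced_concat cs).2 ⟨hQ, (ha.geomRep_nonneg_iff cs).1 ?_⟩
    by_contra hneg
    rw [coloredAct_of_isReduced cs ha hr hQ (isPosRoot_simpleRoot x), coloredRep, if_neg hneg] at hx
    exact Nat.succ_ne_zero _ hx

include cs ha

theorem coloredAct_eq_of_ofWord_eq {Q R : List B}
    (h : ArtinMonoid.ofWord M Q = ArtinMonoid.ofWord M R) {b : (B → ℝ) × ℕ}
    (hb : IsPosRoot a b.1) : coloredAct a Q b = coloredAct a R b := by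
  have hcon : ConGen.Rel (braidRel M) (FreeMonoid.ofList Q) (FreeMonoid.ofList R) :=
    PresentedMonoid.mk_eq_mk_iff.1 h
  rw [← FreeMonoid.toList_ofList Q, ← FreeMonoid.toList_ofList R]
  generalize FreeMonoid.ofList Q = x, FreeMonoid.ofList R = y at hcon
  induction hcon generalizing b with
  | of _ _ hxy =>
    obtain ⟨s, t, rfl, rfl⟩ := hxy
    rcases eq_or_ne s t with rfl | hst
    · rfl
    rw [FreeMonoid.toList_ofList, FreeMonoid.toList_ofList,
      coloredAct_of_isReduced cs ha hr (ha.isReduced_braidWord cs hst) hb,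
      coloredAct_of_isReduced cs ha hr (ha.isReduced_braidWord cs hst.symm) hb,
      wordProd_braidWord_eq]
  | refl => rfl
  | symm _ ih => exact (ih hb).symm
  | trans _ _ ih ih' => exact (ih hb).trans (ih' hb)
  | mul _ _ ih ih' =>
    rw [FreeMonoid.toList_mul, FreeMonoid.toList_mul, coloredAct_append, coloredAct_append, ih' hb,
      ih (hb.coloredAct cs ha hr _)]

theorem mem_coloredInvSeq_iff_of_ofWord_eq {Q R : List B}
    (h : ArtinMonoid.ofWord M Q = ArtinMonoid.ofWord M R) (b : (B → ℝ) × ℕ) :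
    b ∈ coloredInvSeq a Q ↔ b ∈ coloredInvSeq a R := by
  have himage : coloredAct a Q '' {b | IsPosRoot a b.1} = coloredAct a R '' {b | IsPosRoot a b.1} :=
    Set.image_congr fun b hb => coloredAct_eq_of_ofWord_eq cs ha hr h hb
  by_cases hb : IsPosRoot a b.1
  · rw [mem_coloredInvSeq_iff cs ha hr hb, himage, ← mem_coloredInvSeq_iff cs ha hr hb]
  · exact iff_of_false (mt (isPosRoot_of_mem_coloredInvSeq cs ha hr) hb)
      (mt (isPosRoot_of_mem_coloredInvSeq cs ha hr) hb)

theorem coloredInv_ofWord (Q : List B) :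
    coloredInv a (ArtinMonoid.ofWord M Q) = {b | b ∈ coloredInvSeq a Q} := by
  ext b
  constructor
  · rintro ⟨R, hR, hb⟩
    exact (mem_coloredInvSeq_iff_of_ofWord_eq cs ha hr hR b).1 hb
  · exact fun hb => ⟨Q, rfl, hb⟩

theorem ncard_coloredInv (u : ArtinMonoid M) : (coloredInv a u).ncard = ArtinMonoid.length u := by
  classical
  obtain ⟨Q, rfl⟩ := ArtinMonoid.ofWord_surjective u
  rw [coloredInv_ofWord cs ha hr, ArtinMonoid.length_ofWord, ← length_coloredInvSeq (a := a) Q,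
    ← List.toFinset_card_of_nodup (nodup_coloredInvSeq cs ha hr Q), ← Set.ncard_coe_finset,
    List.coe_toFinset]

end ColoredRep

/-! ### Invariant forms -/

section InvariantForm

open CoxeterSystem
open LinearMap (BilinForm)

variable {B : Type*} [Fintype B] {M : CoxeterMatrix B} {a : Matrix B B ℝ}

/-- A symmetric positive definite bilinear form that is invariant under the simple reflections. -/
structure IsInvariantForm (a : Matrix B B ℝ) (F : BilinForm ℝ (B → ℝ)) : Prop where
  symm : ∀ x y, F x y = F y x
  pos : ∀ x, x ≠ 0 → 0 < F x x
  simpleRefl : ∀ s x y, F (simpleRefl a s x) (simpleRefl a s y) = F x y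

theorem exists_isInvariantForm {W : Type*} [Group W] [Finite W] (cs : CoxeterSystem M W)
    (ha : IsGeneralizedCartanMatrix M a) : ∃ F, IsInvariantForm a F := by
  cases nonempty_fintype W
  -- The standard scalar product, averaged over the group.
  let F : BilinForm ℝ (B → ℝ) := ∑ w, (dotProductBilin ℝ ℝ).compl₁₂
    (ha.geomRep cs w : (B → ℝ) →ₗ[ℝ] B → ℝ) (ha.geomRep cs w : (B → ℝ) →ₗ[ℝ] B → ℝ)
  have hF (x y : B → ℝ) : F x y = ∑ w, ha.geomRep cs w x ⬝ᵥ ha.geomRep cs w y := by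
    simp [F, LinearMap.sum_apply]
  refine ⟨F, fun x y => ?_, fun x hx => ?_, fun s x y => ?_⟩ <;> simp only [hF]
  · exact Finset.sum_congr rfl fun w _ => dotProduct_comm _ _
  · refine Finset.sum_pos (fun w _ => ?_) Finset.univ_nonempty
    exact Matrix.dotProduct_self_star_pos_iff.2 ((ha.geomRep cs w).map_ne_zero_iff.2 hx)
  · refine Fintype.sum_equiv (Equiv.mulRight (cs.simple s)) _ _ fun w => ?_
    simp only [Equiv.coe_mulRight, map_mul, LinearEquiv.mul_apply, ha.geomRep_simple,
      ha.reflection_apply]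

namespace IsInvariantForm

variable {F : BilinForm ℝ (B → ℝ)} (hF : IsInvariantForm a F)
include hF

theorem simpleRoot_pos (s : B) : 0 < F (simpleRoot s) (simpleRoot s) :=
  hF.pos _ (simpleRoot_ne_zero s)

variable (ha : IsGeneralizedCartanMatrix M a)
include ha

theorem geomRep {W : Type*} [Group W] (cs : CoxeterSystem M W) (w : W) (x y : B → ℝ) :
    F (ha.geomRep cs w x) (ha.geomRep cs w y) = F x y := by
  induction w using cs.simple_induction_left generalizing x y with
  | one => simp
  | mul_simple_left w s ih =>
    rw [map_mul, LinearEquiv.mul_apply, LinearEquiv.mul_apply, ha.geomRep_simple,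
      ha.reflection_apply, ha.reflection_apply, hF.simpleRefl, ih]

theorem two_mul_simpleRoot (s : B) (v : B → ℝ) :
    2 * F (simpleRoot s) v = F (simpleRoot s) (simpleRoot s) * (a *ᵥ v) s := by
  have h := hF.simpleRefl s (simpleRoot s) v
  rw [ha.simpleRefl_simpleRoot_self, _root_.simpleRefl, map_neg, LinearMap.neg_apply, map_sub,
    map_smul, smul_eq_mul] at h
  linarith

theorem simpleRoot_eq_zero_iff (s : B) (v : B → ℝ) : F (simpleRoot s) v = 0 ↔ (a *ᵥ v) s = 0 := by
  rw [← mul_eq_zero_iff_left (two_ne_zero' ℝ), hF.two_mul_simpleRoot ha,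
    mul_eq_zero_iff_left (hF.simpleRoot_pos s).ne']

theorem simpleRoot_simpleRefl (s : B) (v : B → ℝ) :
    F (simpleRoot s) (_root_.simpleRefl a s v) = -F (simpleRoot s) v := by
  rw [← hF.simpleRefl s, ha.simpleRefl_simpleRefl, ha.simpleRefl_simpleRoot_self, map_neg,
    LinearMap.neg_apply]

theorem simpleRoot_nonpos {s t : B} (h : s ≠ t) : F (simpleRoot s) (simpleRoot t) ≤ 0 := by
  have h2 := hF.two_mul_simpleRoot ha s (simpleRoot t)
  rw [mulVec_simpleRoot] at h2
  linarith [mul_nonpos_of_nonneg_of_nonpos (hF.simpleRoot_pos s).le (ha.nonpos s t h)]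

theorem simpleRefl_eq (s : B) (v : B → ℝ) : _root_.simpleRefl a s v =
    v - (2 * F (simpleRoot s) v / F (simpleRoot s) (simpleRoot s)) • simpleRoot s := by
  rw [hF.two_mul_simpleRoot ha, mul_div_cancel_left₀ _ (hF.simpleRoot_pos s).ne',
    _root_.simpleRefl]

theorem mul_simple_eq {W : Type*} [Group W] (cs : CoxeterSystem M W) {w : W} {s t : B}
    (h : ha.geomRep cs w (simpleRoot s) = simpleRoot t) :
    w * cs.simple s = cs.simple t * w := by
  refine ha.geomRep_injective cs (LinearEquiv.ext fun v => ?_)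
  simp only [map_mul, LinearEquiv.mul_apply, ha.geomRep_simple, ha.reflection_apply]
  rw [hF.simpleRefl_eq ha, hF.simpleRefl_eq ha, map_sub, map_smul, h, ← h, hF.geomRep ha cs,
    hF.geomRep ha cs]

end IsInvariantForm

end InvariantForm

/-! ### The skew-symmetric form of a Coxeter element -/

section Skew

open LinearMap (BilinForm)

variable {B : Type*} (F : BilinForm ℝ (B → ℝ))

/-- The pairing of `α_s` with the part of a vector supported on `l`. -/
def partialForm (l : List B) (s : B) : Module.Dual ℝ (B → ℝ) :=
  (l.map fun t => F (simpleRoot s) (simpleRoot t) • LinearMap.proj t).sum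

theorem partialForm_nil (s : B) : partialForm F [] s = 0 := rfl

theorem partialForm_cons_apply (t : B) (l : List B) (s : B) (y : B → ℝ) :
    partialForm F (t :: l) s y = F (simpleRoot s) (simpleRoot t) * y t + partialForm F l s y := by
  simp [partialForm]

theorem partialForm_append (l l' : List B) (s : B) :
    partialForm F (l ++ l') s = partialForm F l s + partialForm F l' s := by
  simp [partialForm]

theorem partialForm_congr {l : List B} (s : B) {y y' : B → ℝ} (h : ∀ t ∈ l, y t = y' t) :
    partialForm F l s y = partialForm F l s y' := by
  induction l with
  | nil => rfl
  | cons t l ih =>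
    rw [List.forall_mem_cons] at h
    rw [partialForm_cons_apply, partialForm_cons_apply, h.1, ih h.2]

/-- The skew-symmetric form `ω_c` attached to a word `c` in the simple reflections: for `t` after
`s` in `c`, its value at `(α_s, α_t)` is `F α_s α_t`. -/
def skewForm : List B → BilinForm ℝ (B → ℝ)
  | [] => 0
  | s :: l => .linMulLin (.proj s) (partialForm F l s) - .linMulLin (partialForm F l s) (.proj s)
      + skewForm l

theorem skewForm_nil : skewForm F [] = 0 := rfl

theorem skewForm_cons_apply (s : B) (l : List B) (x y : B → ℝ) : skewForm F (s :: l) x y =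
    x s * partialForm F l s y - partialForm F l s x * y s + skewForm F l x y := rfl

theorem isAlt_skewForm (l : List B) : (skewForm F l).IsAlt := by
  intro x
  induction l with
  | nil => rfl
  | cons s l ih => rw [skewForm_cons_apply, ih, mul_comm, sub_self, add_zero]

theorem skewForm_congr {l : List B} {x x' y y' : B → ℝ} (hx : ∀ t ∈ l, x t = x' t)
    (hy : ∀ t ∈ l, y t = y' t) : skewForm F l x y = skewForm F l x' y' := by
  induction l with
  | nil => rfl
  | cons s l ih =>
    rw [List.forall_mem_cons] at hx hy
    rw [skewForm_cons_apply, skewForm_cons_apply, ih hx.2 hy.2, partialForm_congr F s hx.2,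
      partialForm_congr F s hy.2, hx.1, hy.1]

theorem skewForm_cons_of_eq_zero {s : B} (l : List B) {x y : B → ℝ} (hx : x s = 0) (hy : y s = 0) :
    skewForm F (s :: l) x y = skewForm F l x y := by
  rw [skewForm_cons_apply, hx, hy, zero_mul, mul_zero, sub_zero, zero_add]

theorem skewForm_cons_simpleRoot {s : B} {l : List B} (hs : s ∉ l) :
    skewForm F (s :: l) (simpleRoot s) = partialForm F l s := by
  ext1 y
  have h : ∀ t ∈ l, simpleRoot s t = (0 : B → ℝ) t := fun t ht =>
    simpleRoot_apply_of_ne (ne_of_mem_of_not_mem ht hs)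
  rw [skewForm_cons_apply, partialForm_congr F s h, skewForm_congr F h fun _ _ => rfl,
    map_zero, map_zero, LinearMap.zero_apply, simpleRoot_apply_self, one_mul, zero_mul, sub_zero,
    add_zero]

theorem skewForm_concat_apply (hF : ∀ x y, F x y = F y x) (l : List B) (s : B) (x y : B → ℝ) :
    skewForm F (l ++ [s]) x y =
      skewForm F l x y + partialForm F l s x * y s - x s * partialForm F l s y := by
  induction l with
  | nil => simp [skewForm_cons_apply, skewForm_nil, partialForm_nil]
  | cons t l ih =>
    simp only [List.cons_append, skewForm_cons_apply, ih, partialForm_append, LinearMap.add_apply,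
      partialForm_cons_apply, partialForm_nil, LinearMap.zero_apply,
      hF (simpleRoot t) (simpleRoot s)]
    ring

theorem skewForm_concat_simpleRoot (hF : ∀ x y, F x y = F y x) {s : B} {l : List B} (hs : s ∉ l) :
    skewForm F (l ++ [s]) (simpleRoot s) = -partialForm F l s := by
  ext1 y
  have h : ∀ t ∈ l, simpleRoot s t = (0 : B → ℝ) t := fun t ht =>
    simpleRoot_apply_of_ne (ne_of_mem_of_not_mem ht hs)
  rw [skewForm_concat_apply F hF, partialForm_congr F s h, skewForm_congr F h fun _ _ => rfl,
    map_zero, map_zero, LinearMap.zero_apply, simpleRoot_apply_self, one_mul, zero_mul, zero_add,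
    zero_sub, LinearMap.neg_apply]

/-- A vector all of whose coordinates outside `l` vanish. -/
def SupportedIn (l : List B) (x : B → ℝ) : Prop := ∀ t, t ∉ l → x t = 0

theorem supportedIn_simpleRoot {l : List B} {s : B} (h : s ∈ l) : SupportedIn l (simpleRoot s) :=
  fun _ ht => simpleRoot_apply_of_ne (ne_of_mem_of_not_mem h ht).symm

theorem sum_smul_simpleRoot [Fintype B] (x : B → ℝ) : ∑ t, x t • simpleRoot t = x := by
  classical
  simpa [simpleRoot, ← Pi.single_smul] using Finset.univ_sum_single x

variable {F}

theorem form_simpleRoot_eq [Finite B] {s : B} {l : List B} (hl : (s :: l).Nodup) {x : B → ℝ}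
    (hx : SupportedIn (s :: l) x) :
    F (simpleRoot s) x = F (simpleRoot s) (simpleRoot s) * x s + partialForm F l s x := by
  classical
  cases nonempty_fintype B
  have hsum : partialForm F (s :: l) s =
      ∑ t ∈ (s :: l).toFinset, F (simpleRoot s) (simpleRoot t) • LinearMap.proj t :=
    (List.sum_toFinset _ hl).symm
  rw [← partialForm_cons_apply, hsum, LinearMap.sum_apply]
  conv_lhs => rw [← sum_smul_simpleRoot x, map_sum]
  rw [eq_comm]
  refine Finset.sum_subset_zero_on_sdiff (Finset.subset_univ _) (fun t ht => ?_) fun t _ => ?_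
  · rw [hx t (by simpa using ht), zero_smul, map_zero]
  · rw [map_smul, smul_eq_mul, mul_comm]
    rfl

variable [Fintype B] {M : CoxeterMatrix B} {a : Matrix B B ℝ}

theorem SupportedIn.simpleRefl {l : List B} {x : B → ℝ} (hx : SupportedIn l x) {s : B}
    (h : s ∈ l) : SupportedIn l (simpleRefl a s x) := fun t ht => by
  rw [simpleRefl_apply_of_ne (ne_of_mem_of_not_mem h ht).symm, hx t ht]

theorem simpleRefl_apply_of_mem {s : B} {l : List B} (hs : s ∉ l) (x : B → ℝ) :
    ∀ t ∈ l, simpleRefl a s x t = x t := fun _ ht =>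
  simpleRefl_apply_of_ne (ne_of_mem_of_not_mem ht hs) x

variable (ha : IsGeneralizedCartanMatrix M a) (hF : IsInvariantForm a F)
include ha hF

theorem form_mul_simpleRefl_apply_self {s : B} {l : List B} (hl : (s :: l).Nodup) {x : B → ℝ}
    (hx : SupportedIn (s :: l) x) :
    F (simpleRoot s) (simpleRoot s) * simpleRefl a s x s =
      -(F (simpleRoot s) (simpleRoot s) * x s) - 2 * partialForm F l s x := by
  have hform := form_simpleRoot_eq (F := F) hl hx
  have htwo := hF.two_mul_simpleRoot ha s x
  rw [simpleRefl_apply_self]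
  linarith

theorem partialForm_nonpos {s : B} {l : List B} (hs : s ∉ l) {y : B → ℝ} (hy : 0 ≤ y) :
    partialForm F l s y ≤ 0 := by
  induction l with
  | nil => rfl
  | cons t l ih =>
    rw [List.mem_cons, not_or] at hs
    rw [partialForm_cons_apply]
    exact add_nonpos (mul_nonpos_of_nonpos_of_nonneg (hF.simpleRoot_nonpos ha hs.1) (hy t))
      (ih hs.2)

theorem skewForm_simpleRefl {s : B} {l : List B} (hl : (s :: l).Nodup) {x y : B → ℝ}
    (hx : SupportedIn (s :: l) x) (hy : SupportedIn (s :: l) y) :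
    skewForm F (l ++ [s]) (simpleRefl a s x) (simpleRefl a s y) = skewForm F (s :: l) x y := by
  have hfix := simpleRefl_apply_of_mem (a := a) (List.nodup_cons.1 hl).1
  rw [skewForm_concat_apply F hF.symm, skewForm_congr F (hfix x) (hfix y),
    partialForm_congr F s (hfix x), partialForm_congr F s (hfix y), skewForm_cons_apply]
  refine mul_left_cancel₀ (hF.simpleRoot_pos s).ne' ?_
  linear_combination partialForm F l s x * form_mul_simpleRefl_apply_self ha hF hl hy -
    partialForm F l s y * form_mul_simpleRefl_apply_self ha hF hl hx

end Skew

/-! ### Sorting sequences -/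

section Sorting

variable {B : Type*}

/-- `IsSortingSeq c Q`: the word `Q` is obtained by reading the word `c` cyclically and, at each
step, either using the current letter and keeping it for the next round, or discarding it for good.
-/
inductive IsSortingSeq : List B → List B → Prop
  | nil : IsSortingSeq [] []
  | use {s : B} {d Q : List B} : IsSortingSeq (d ++ [s]) Q → IsSortingSeq (s :: d) (s :: Q)
  | skip {s : B} {d Q : List B} : IsSortingSeq d Q → IsSortingSeq (s :: d) Q

namespace IsSortingSeq

theorem empty (c : List B) : IsSortingSeq c [] := by
  induction c with
  | nil => exact nil
  | cons s c ih => exact skip ih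

theorem subset {c Q : List B} (h : IsSortingSeq c Q) : Q ⊆ c := by
  induction h with
  | nil => exact List.Subset.refl _
  | @use s d Q _ ih =>
    refine List.cons_subset.2 ⟨List.mem_cons_self, fun t ht => ?_⟩
    exact (List.perm_append_singleton s d).subset (ih ht)
  | skip _ ih => exact List.subset_cons_of_subset _ ih

theorem left {c Q R : List B} (h : IsSortingSeq c (Q ++ R)) : IsSortingSeq c Q := by
  generalize hS : Q ++ R = S at h
  induction h generalizing Q with
  | nil =>
    rw [(List.append_eq_nil_iff.1 hS).1]
    exact nil
  | use _ ih =>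
    rcases Q with _ | ⟨t, Q⟩
    · exact empty _
    · obtain ⟨rfl, hQ⟩ := List.cons_eq_cons.1 hS
      exact use (ih hQ)
  | skip _ ih => exact skip (ih hS)

theorem right {c Q R : List B} (h : IsSortingSeq c (Q ++ R)) (hc : c.Nodup) :
    ∃ d, d.Nodup ∧ IsSortingSeq d R := by
  generalize hS : Q ++ R = S at h
  induction h generalizing Q with
  | nil =>
    rw [(List.append_eq_nil_iff.1 hS).2]
    exact ⟨[], hc, nil⟩
  | @use s d S h ih =>
    rcases Q with _ | ⟨t, Q⟩
    · obtain rfl : R = s :: S := hS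
      exact ⟨s :: d, hc, use h⟩
    · exact ih ((List.perm_append_singleton s d).nodup_iff.2 hc) (List.cons_eq_cons.1 hS).2
  | skip _ ih => exact ih hc.of_cons hS

end IsSortingSeq

variable [Fintype B] {M : CoxeterMatrix B} {a : Matrix B B ℝ}

theorem SupportedIn.coloredRefl {c : List B} {b : (B → ℝ) × ℕ} (hb : SupportedIn c b.1) {s : B}
    (hs : s ∈ c) : SupportedIn c (coloredRefl a s b).1 := by
  rw [_root_.coloredRefl]
  split_ifs
  · exact supportedIn_simpleRoot hs
  · exact hb.simpleRefl hs

theorem supportedIn_of_mem_coloredInvSeq {c Q : List B} (hQ : Q ⊆ c) {b : (B → ℝ) × ℕ}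
    (hb : b ∈ coloredInvSeq a Q) : SupportedIn c b.1 := by
  induction Q generalizing b with
  | nil => exact absurd hb List.not_mem_nil
  | cons s Q ih =>
    obtain ⟨hs, hQ⟩ := List.cons_subset.1 hQ
    rcases mem_coloredInvSeq_cons.1 hb with rfl | ⟨b', hb', rfl⟩
    · exact supportedIn_simpleRoot hs
    · exact (ih hQ hb').coloredRefl hs

end Sorting

section Aligned

open LinearMap (BilinForm)

variable {B : Type*}

/-- The relation between a colored inversion and a later one in a sorting word for `c`: if the
later one has color `0`, then `ω_c` is nonpositive on the pair when the earlier one has color `0`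
too, and the two roots are orthogonal when this value is zero or the earlier color is positive. -/
def IsAlignedPair (F : BilinForm ℝ (B → ℝ)) (c : List B) (b b' : (B → ℝ) × ℕ) : Prop :=
  b'.2 = 0 → (b.2 = 0 → skewForm F c b.1 b'.1 ≤ 0 ∧ (skewForm F c b.1 b'.1 = 0 → F b.1 b'.1 = 0)) ∧
    (b.2 ≠ 0 → F b.1 b'.1 = 0)

variable [Fintype B] {M : CoxeterMatrix B} {a : Matrix B B ℝ}

/-- The colored inversions of the word `Q`, in the order of its letters, are pairwise aligned. -/
def IsAligned (a : Matrix B B ℝ) (F : BilinForm ℝ (B → ℝ)) (c Q : List B) : Prop :=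
  (coloredInvSeq a Q).Pairwise (IsAlignedPair F c)

variable {F : BilinForm ℝ (B → ℝ)} {s : B} {d : List B}

section Form

variable (ha : IsGeneralizedCartanMatrix M a) (hF : IsInvariantForm a F) (hd : (s :: d).Nodup)
include ha hF hd

theorem form_simpleRoot_eq_zero {x : B → ℝ} (hx : SupportedIn (s :: d) x) (hpos : 0 ≤ x)
    (hpos' : 0 ≤ simpleRefl a s x) (h : partialForm F d s x = 0) : F (simpleRoot s) x = 0 := by
  have hrefl := form_mul_simpleRefl_apply_self ha hF hd hx
  have hs := (hF.simpleRoot_pos s).le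
  rw [form_simpleRoot_eq hd hx]
  linarith [mul_nonneg hs (hpos s), mul_nonneg hs (hpos' s)]

theorem isAlignedPair_simpleRoot {x : B → ℝ} (hx : SupportedIn (s :: d) x) (hpos : 0 ≤ x)
    (hpos' : 0 ≤ simpleRefl a s x) (k : ℕ) :
    IsAlignedPair F (s :: d) (simpleRoot s, 0) (x, k) := by
  have hs := (List.nodup_cons.1 hd).1
  refine fun _ => ⟨fun _ => ?_, fun h => absurd rfl h⟩
  rw [skewForm_cons_simpleRoot F hs]
  exact ⟨partialForm_nonpos ha hF hs hpos, form_simpleRoot_eq_zero ha hF hd hx hpos hpos'⟩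

theorem IsAlignedPair.form_simpleRoot_eq_zero {x : B → ℝ} {k : ℕ}
    (h : IsAlignedPair F (d ++ [s]) (simpleRoot s, k) (x, 0)) (hx : SupportedIn (s :: d) x)
    (hpos : 0 ≤ x) (hpos' : 0 ≤ simpleRefl a s x) : F (simpleRoot s) x = 0 := by
  obtain ⟨hzero, hsucc⟩ := h rfl
  rcases eq_or_ne k 0 with rfl | hk
  · have hs := (List.nodup_cons.1 hd).1
    have hle := (hzero rfl).1
    rw [skewForm_concat_simpleRoot F hF.symm hs, LinearMap.neg_apply, neg_nonpos] at hle
    exact _root_.form_simpleRoot_eq_zero ha hF hd hx hpos hpos'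
      ((partialForm_nonpos ha hF hs hpos).antisymm hle)
  · exact hsucc hk

end Form

variable {W : Type*} [Group W] (cs : CoxeterSystem M W) (ha : IsGeneralizedCartanMatrix M a)
  (hr : IsReducedRoots a) (hF : IsInvariantForm a F)
include cs ha hr hF

theorem IsAlignedPair.coloredRefl (hd : (s :: d).Nodup) {b b' : (B → ℝ) × ℕ}
    (h : IsAlignedPair F (d ++ [s]) b b') (hb : SupportedIn (s :: d) b.1)
    (hb' : SupportedIn (s :: d) b'.1) (hpos : IsPosRoot a b'.1) :
    IsAlignedPair F (s :: d) (coloredRefl a s b) (coloredRefl a s b') := by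
  obtain ⟨β, k⟩ := b
  obtain ⟨β', k'⟩ := b'
  by_cases hs' : β' = simpleRoot s
  · subst hs'
    rw [coloredRefl_simpleRoot]
    exact fun h0 => absurd h0 k'.succ_ne_zero
  rw [coloredRefl_of_ne (b := (β', k')) hs']
  by_cases hs : β = simpleRoot s
  · subst hs
    rw [coloredRefl_simpleRoot]
    rintro (rfl : k' = 0)
    refine ⟨fun h0 => absurd h0 k.succ_ne_zero, fun _ => ?_⟩
    rw [hF.simpleRoot_simpleRefl ha, neg_eq_zero]
    exact h.form_simpleRoot_eq_zero ha hF hd hb' hpos.2 (hpos.simpleRefl cs ha hr hs').2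
  · have hskew := skewForm_simpleRefl ha hF hd (hb.simpleRefl (a := a) List.mem_cons_self)
      (hb'.simpleRefl (a := a) List.mem_cons_self)
    rw [ha.simpleRefl_simpleRefl, ha.simpleRefl_simpleRefl] at hskew
    rw [coloredRefl_of_ne (b := (β, k)) hs]
    rw [IsAlignedPair] at h ⊢
    rwa [← hskew, hF.simpleRefl]

theorem IsSortingSeq.isAligned {c Q : List B} (h : IsSortingSeq c Q) (hc : c.Nodup) :
    IsAligned a F c Q := by
  induction h with
  | nil => exact List.Pairwise.nil
  | @skip s d Q h ih =>
    refine (ih hc.of_cons).imp_of_mem fun {b b'} hb hb' hal => ?_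
    have hzero {b} (hb : b ∈ coloredInvSeq a Q) : b.1 s = 0 :=
      supportedIn_of_mem_coloredInvSeq h.subset hb s (List.nodup_cons.1 hc).1
    rwa [IsAlignedPair, skewForm_cons_of_eq_zero F d (hzero hb) (hzero hb')]
  | @use s d Q h ih =>
    have hperm := List.perm_append_singleton s d
    have hsupp {b} (hb : b ∈ coloredInvSeq a Q) : SupportedIn (s :: d) b.1 :=
      supportedIn_of_mem_coloredInvSeq (fun t ht => hperm.subset (h.subset ht)) hb
    have hpos {b} (hb : b ∈ coloredInvSeq a Q) := isPosRoot_of_mem_coloredInvSeq cs ha hr hb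
    refine List.pairwise_cons.2 ⟨fun b hb => ?_, List.pairwise_map.2 ?_⟩
    · obtain ⟨⟨β, k⟩, hmem, rfl⟩ := List.mem_map.1 hb
      by_cases hs : β = simpleRoot s
      · subst hs
        rw [coloredRefl_simpleRoot]
        exact fun h0 => absurd h0 k.succ_ne_zero
      · rw [coloredRefl_of_ne (b := (β, k)) hs]
        refine isAlignedPair_simpleRoot ha hF hc ((hsupp hmem).simpleRefl List.mem_cons_self)
          ((hpos hmem).simpleRefl cs ha hr hs).2 ?_ k
        rw [ha.simpleRefl_simpleRefl]
        exact (hpos hmem).2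
    · exact (ih (hperm.nodup_iff.2 hc)).imp_of_mem fun hb hb' hal =>
        hal.coloredRefl cs ha hr hF hc (hsupp hb) (hsupp hb') (hpos hb')

end Aligned

/-! ### Separating the colors -/

section Commute

variable {B : Type*} [Finite B] {M : CoxeterMatrix B} {a : Matrix B B ℝ} {W : Type*} [Group W]
  [Finite W]

theorem IsGeneralizedCartanMatrix.coxeterMatrix_eq_two (ha : IsGeneralizedCartanMatrix M a)
    (cs : CoxeterSystem M W) {s t : B} (h : a s t = 0) : M s t = 2 := by
  have hne : s ≠ t := by
    rintro rfl
    exact two_ne_zero ((ha.diag s).symm.trans h)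
  have hcos := ha.mul_eq s t hne
  rw [h, zero_mul, eq_comm, mul_eq_zero, or_iff_right four_ne_zero, sq_eq_zero_iff] at hcos
  have hzero := ha.coxeterMatrix_ne_zero cs s t
  have hone := M.off_diagonal s t hne
  by_contra htwo
  exact (cos_pi_div_pos (by omega)).ne' hcos

theorem ArtinMonoid.commute_gen (cs : CoxeterSystem M W) (ha : IsGeneralizedCartanMatrix M a)
    {s t : B} (h : a s t = 0) : Commute (gen M s) (gen M t) := by
  have hbraid := ofWord_braidWord (M := M) s t
  rw [CoxeterSystem.braidWord, CoxeterSystem.braidWord, M.symmetric t s,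
    ha.coxeterMatrix_eq_two cs h] at hbraid
  simpa [CoxeterSystem.alternatingWord, ofWord_cons, ofWord_nil, Commute, SemiconjBy] using hbraid

theorem ArtinMonoid.commute_ofWord_gen (cs : CoxeterSystem M W)
    (ha : IsGeneralizedCartanMatrix M a) {U : List B} {x : B} (h : ∀ r ∈ U, a r x = 0) :
    Commute (ofWord M U) (gen M x) := by
  induction U with
  | nil => exact Commute.one_left _
  | cons r U ih =>
    obtain ⟨hr, hU⟩ := List.forall_mem_cons.1 h
    rw [ofWord_cons]
    exact (commute_gen cs ha hr).mul_left (ih hU)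

end Commute

section Orthogonal

variable {B : Type*} [Fintype B] {M : CoxeterMatrix B} {a : Matrix B B ℝ}
  (ha : IsGeneralizedCartanMatrix M a)
include ha

theorem coloredRefl_simpleRoot_of_eq_zero {r x : B} (h : a r x = 0) (k : ℕ) :
    coloredRefl a r (simpleRoot x, k) = (simpleRoot x, k) := by
  have hne : simpleRoot x ≠ simpleRoot r := fun e => by
    have htwo := ha.diag r
    rw [← mulVec_simpleRoot (a := a) r r, ← e, mulVec_simpleRoot, h] at htwo
    exact two_ne_zero htwo.symm
  rw [coloredRefl_of_ne hne, simpleRefl, mulVec_simpleRoot, h, zero_smul, sub_zero]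

variable {F : LinearMap.BilinForm ℝ (B → ℝ)} (hF : IsInvariantForm a F)
include hF

theorem form_coloredRefl_eq_zero_iff (s : B) (b b' : (B → ℝ) × ℕ) :
    F (coloredRefl a s b).1 (coloredRefl a s b').1 = 0 ↔ F b.1 b'.1 = 0 := by
  have hsign (b : (B → ℝ) × ℕ) :
      (coloredRefl a s b).1 = simpleRefl a s b.1 ∨ (coloredRefl a s b).1 = -simpleRefl a s b.1 := by
    rw [coloredRefl]
    split_ifs with h
    · exact Or.inr (by rw [h, ha.simpleRefl_simpleRoot_self, neg_neg])
    · exact Or.inl rfl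
  rcases hsign b with e | e <;> rcases hsign b' with e' | e' <;>
    simp only [e, e', map_neg, LinearMap.neg_apply, neg_eq_zero, hF.simpleRefl]

theorem form_coloredAct_eq_zero_iff (Q : List B) (b b' : (B → ℝ) × ℕ) :
    F (coloredAct a Q b).1 (coloredAct a Q b').1 = 0 ↔ F b.1 b'.1 = 0 := by
  induction Q with
  | nil => rfl
  | cons s Q ih => rw [coloredAct_cons, coloredAct_cons, form_coloredRefl_eq_zero_iff ha hF, ih]

theorem eq_zero_of_form_eq_zero {r x : B} (h : F (simpleRoot r) (simpleRoot x) = 0) :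
    a r x = 0 := by
  rwa [hF.simpleRoot_eq_zero_iff ha, mulVec_simpleRoot] at h

variable {W : Type*} [Group W] (cs : CoxeterSystem M W) (hr : IsReducedRoots a)
include cs hr

theorem coloredAct_eq_of_forall_form_eq_zero {V U : List B} {x : B} {γ : B → ℝ}
    (hγ : coloredAct a (V ++ U) (simpleRoot x, 0) = (γ, 0))
    (horth : ∀ b ∈ coloredInvSeq a (V ++ U), b ∉ coloredInvSeq a V → F b.1 γ = 0) :
    (∀ r ∈ U, a r x = 0) ∧ coloredAct a V (simpleRoot x, 0) = (γ, 0) := by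
  induction U using List.reverseRecOn with
  | nil => exact ⟨by simp, by rwa [List.append_nil] at hγ⟩
  | append_singleton U r ih =>
    rw [← List.append_assoc] at hγ horth
    have hrx : a r x = 0 := by
      have hform := horth _ (mem_coloredInvSeq_concat.2 (Or.inr rfl)) fun hmem => by
        rw [coloredAct_append] at hmem
        exact coloredAct_notMem_coloredInvSeq cs ha hr
          ((isPosRoot_simpleRoot r).coloredAct (b := (simpleRoot r, 0)) cs ha hr U) hmem
      rw [← show _ = γ from congrArg Prod.fst hγ, coloredAct_append _ [r],
        form_coloredAct_eq_zero_iff ha hF] at hform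
      have hne : simpleRoot x ≠ simpleRoot r := fun e => by
        rw [coloredAct_append, coloredAct_cons, coloredAct_nil, e, coloredRefl_simpleRoot] at hγ
        have hle := color_le_coloredAct (a := a) (V ++ U) (simpleRoot r, 0 + 1)
        simp [hγ] at hle
      rw [coloredAct_cons, coloredAct_nil, coloredRefl_of_ne hne, hF.simpleRoot_simpleRefl ha,
        neg_eq_zero] at hform
      exact eq_zero_of_form_eq_zero ha hF hform
    rw [coloredAct_append, coloredAct_cons, coloredAct_nil,
      coloredRefl_simpleRoot_of_eq_zero ha hrx] at hγ
    obtain ⟨hU, hV⟩ := ih hγ fun b hb => horth b (mem_coloredInvSeq_append.2 (Or.inl hb))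
    exact ⟨List.forall_mem_append.2 ⟨hU, List.forall_mem_singleton.2 hrx⟩, hV⟩

end Orthogonal

section ColorSplit

open ArtinMonoid

variable {B : Type*} [Fintype B] {M : CoxeterMatrix B} {a : Matrix B B ℝ}
  {F : LinearMap.BilinForm ℝ (B → ℝ)} {c : List B}

theorem isAligned_concat {V : List B} {x : B} :
    IsAligned a F c (V ++ [x]) ↔ IsAligned a F c V ∧
      ∀ b ∈ coloredInvSeq a V, IsAlignedPair F c b (coloredAct a V (simpleRoot x, 0)) := by
  rw [IsAligned, coloredInvSeq_append, List.pairwise_append]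
  simp [IsAligned, coloredInvSeq]

/-- The words `V₀` and `U` separate the colors of `V`: their product is that of `V` in the Artin
monoid, and the letters of `V₀` create the colored inversions of `V` that have color `0`. -/
structure IsColorSplit (M : CoxeterMatrix B) (a : Matrix B B ℝ) (V V₀ U : List B) : Prop where
  ofWord_eq : ofWord M V = ofWord M V₀ * ofWord M U
  coloredInvSeq_eq : coloredInvSeq a V₀ = (coloredInvSeq a V).filter fun b => b.2 = 0

namespace IsColorSplit

variable {V V₀ U : List B} {x : B}

theorem color_eq_zero (h : IsColorSplit M a V V₀ U) : ∀ b ∈ coloredInvSeq a V₀, b.2 = 0 := by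
  simp [h.coloredInvSeq_eq]

theorem isAligned (h : IsColorSplit M a V V₀ U) (hV : IsAligned a F c V) : IsAligned a F c V₀ := by
  rw [IsAligned, h.coloredInvSeq_eq]
  exact hV.filter _

theorem concat_of_color_ne_zero (h : IsColorSplit M a V V₀ U)
    (hx : (coloredAct a V (simpleRoot x, 0)).2 ≠ 0) :
    IsColorSplit M a (V ++ [x]) V₀ (U ++ [x]) where
  ofWord_eq := by rw [ofWord_append, h.ofWord_eq, mul_assoc, ofWord_append]
  coloredInvSeq_eq := by
    rw [h.coloredInvSeq_eq, coloredInvSeq_append, List.filter_append]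
    simp [coloredInvSeq, hx]

theorem concat_of_commute (h : IsColorSplit M a V V₀ U) (hU : Commute (ofWord M U) (gen M x))
    {γ : B → ℝ} (hγ : coloredAct a V (simpleRoot x, 0) = (γ, 0))
    (hγ₀ : coloredAct a V₀ (simpleRoot x, 0) = (γ, 0)) :
    IsColorSplit M a (V ++ [x]) (V₀ ++ [x]) U where
  ofWord_eq := by rw [ofWord_concat, h.ofWord_eq, mul_assoc, hU.eq, ofWord_concat, mul_assoc]
  coloredInvSeq_eq := by
    rw [coloredInvSeq_append, coloredInvSeq_append, List.filter_append, h.coloredInvSeq_eq]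
    simp [coloredInvSeq, hγ, hγ₀]

variable {W : Type*} [Group W] (cs : CoxeterSystem M W) (ha : IsGeneralizedCartanMatrix M a)
  (hr : IsReducedRoots a) (hF : IsInvariantForm a F)
include cs ha hr hF

theorem coloredAct_eq_of_isAligned (h : IsColorSplit M a V V₀ U) (hV : IsAligned a F c (V ++ [x]))
    {γ : B → ℝ} (hγ : coloredAct a V (simpleRoot x, 0) = (γ, 0)) :
    (∀ r ∈ U, a r x = 0) ∧ coloredAct a V₀ (simpleRoot x, 0) = (γ, 0) := by
  have hword : ofWord M V = ofWord M (V₀ ++ U) := by rw [h.ofWord_eq, ofWord_append]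
  refine coloredAct_eq_of_forall_form_eq_zero ha hF cs hr ?_ fun b hb hb₀ => ?_
  · rw [← coloredAct_eq_of_ofWord_eq cs ha hr hword (isPosRoot_simpleRoot x), hγ]
  · rw [← mem_coloredInvSeq_iff_of_ofWord_eq cs ha hr hword] at hb
    have hcolor : b.2 ≠ 0 := fun h0 => hb₀ (by simp [h.coloredInvSeq_eq, hb, h0])
    have hpair := (isAligned_concat.1 hV).2 b hb
    rw [hγ] at hpair
    exact (hpair rfl).2 hcolor

end IsColorSplit

variable {W : Type*} [Group W] [Finite W] (cs : CoxeterSystem M W)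
  (ha : IsGeneralizedCartanMatrix M a) (hr : IsReducedRoots a) (hF : IsInvariantForm a F)
include cs ha hr hF

theorem IsAligned.exists_isColorSplit {V : List B} (hV : IsAligned a F c V) :
    ∃ V₀ U, IsColorSplit M a V V₀ U := by
  induction V using List.reverseRecOn with
  | nil => exact ⟨[], [], ⟨(mul_one _).symm, rfl⟩⟩
  | append_singleton V x ih =>
    obtain ⟨V₀, U, hsplit⟩ := ih (isAligned_concat.1 hV).1
    rcases hγ : coloredAct a V (simpleRoot x, 0) with ⟨γ, _ | k⟩
    · obtain ⟨hU, hγ₀⟩ := hsplit.coloredAct_eq_of_isAligned cs ha hr hF hV hγ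
      exact ⟨_, _, hsplit.concat_of_commute (commute_ofWord_gen cs ha hU) hγ hγ₀⟩
    · exact ⟨_, _, hsplit.concat_of_color_ne_zero (x := x) (by simp [hγ])⟩

theorem IsAligned.exists_isColorSplit_concat {V : List B} {x : B}
    (hV : IsAligned a F c (V ++ [x])) {γ : B → ℝ}
    (hγ : coloredAct a V (simpleRoot x, 0) = (γ, 0)) :
    ∃ V₀ U, ofWord M V = ofWord M V₀ * ofWord M U ∧ Commute (ofWord M U) (gen M x) ∧
      coloredAct a V₀ (simpleRoot x, 0) = (γ, 0) ∧ IsColorSplit M a (V ++ [x]) (V₀ ++ [x]) U := by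
  obtain ⟨V₀, U, hsplit⟩ := (isAligned_concat.1 hV).1.exists_isColorSplit cs ha hr hF
  obtain ⟨hU, hγ₀⟩ := hsplit.coloredAct_eq_of_isAligned cs ha hr hF hV hγ
  have hcomm := commute_ofWord_gen cs ha hU
  exact ⟨V₀, U, hsplit.ofWord_eq, hcomm, hγ₀, hsplit.concat_of_commute hcomm hγ hγ₀⟩

end ColorSplit

section Chain

open ArtinMonoid

variable {B : Type*} [Fintype B] {M : CoxeterMatrix B} {a : Matrix B B ℝ}

theorem exists_append_of_mem_coloredInvSeq {Q : List B} {b : (B → ℝ) × ℕ}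
    (h : b ∈ coloredInvSeq a Q) :
    ∃ V x R, Q = V ++ x :: R ∧ coloredAct a V (simpleRoot x, 0) = b := by
  induction Q using List.reverseRecOn with
  | nil => exact absurd h List.not_mem_nil
  | append_singleton Q x ih =>
    rcases mem_coloredInvSeq_concat.1 h with h | rfl
    · obtain ⟨V, y, R, rfl, e⟩ := ih h
      exact ⟨V, y, R ++ [x], by rw [List.append_assoc, List.cons_append], e⟩
    · exact ⟨Q, x, [], rfl, rfl⟩

variable {W : Type*} [Group W] (cs : CoxeterSystem M W) (ha : IsGeneralizedCartanMatrix M a)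
include ha

theorem coloredAct_of_color_eq_zero {Q : List B} {b : (B → ℝ) × ℕ} (h : (coloredAct a Q b).2 = 0) :
    coloredAct a Q b = (ha.geomRep cs (cs.wordProd Q) b.1, 0) := by
  have hb : b.2 = 0 := Nat.eq_zero_of_le_zero (h ▸ color_le_coloredAct Q b)
  rw [ha.geomRep_wordProd, ← coloredAct_fst_of_color_eq (h.trans hb.symm), ← h]

variable (hr : IsReducedRoots a)
include hr cs

theorem coloredAct_eq_simpleRoot {V R : List B} {x y : B} {β : B → ℝ} {k : ℕ}
    (hy : coloredAct a V (simpleRoot y, 0) = (β, k))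
    (hx : coloredAct a (V ++ y :: R) (simpleRoot x, 0) = (β, k + 1)) :
    coloredAct a R (simpleRoot x, 0) = (simpleRoot y, 0) := by
  have hpos (Q : List B) : IsPosRoot a (coloredAct a Q (simpleRoot x, 0)).1 :=
    (isPosRoot_simpleRoot x).coloredAct (b := (simpleRoot x, 0)) cs ha hr Q
  have hsucc := coloredAct_add_color (a := a) V (simpleRoot y, 0) 1
  rw [hy, ← hx, coloredAct_append] at hsucc
  have hrefl := coloredAct_injOn cs ha hr V (isPosRoot_simpleRoot y) (hpos _) hsucc
  rw [← coloredRefl_simpleRoot (a := a), coloredAct_cons] at hrefl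
  exact (coloredRefl_injOn ha y (isPosRoot_simpleRoot y) (hpos _) hrefl).symm

variable [Finite W] {F : LinearMap.BilinForm ℝ (B → ℝ)} (hF : IsInvariantForm a F)
include hF

omit hr in
theorem ArtinMonoid.semiconjBy_of_geomRep_eq {P : List B} {x e : B} (hP : cs.IsReduced (P ++ [x]))
    (h : ha.geomRep cs (cs.wordProd P) (simpleRoot x) = simpleRoot e) :
    SemiconjBy (ofWord M P) (gen M x) (gen M e) := by
  have hprod : cs.wordProd (P ++ [x]) = cs.wordProd (e :: P) := by
    rw [cs.wordProd_append, cs.wordProd_singleton, hF.mul_simple_eq ha cs h, cs.wordProd_cons]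
  have hred : cs.IsReduced (e :: P) := by
    rw [CoxeterSystem.IsReduced, ← hprod, hP.eq]
    simp
  have heq := ((isReduced_ofWord cs).2 hP).eq_of_toCoxeter_eq ha ((isReduced_ofWord cs).2 hred)
    (by rw [toCoxeter_ofWord, toCoxeter_ofWord, hprod])
  rwa [ofWord_concat, ofWord_cons] at heq

theorem IsAligned.semiconjBy {d R : List B} {x y : B} (h : IsAligned a F d (R ++ [x]))
    (hR : coloredAct a R (simpleRoot x, 0) = (simpleRoot y, 0)) :
    SemiconjBy (ofWord M R) (gen M x) (gen M y) := by
  obtain ⟨R₀, U, hword, hU, hR₀, hsplit⟩ := h.exists_isColorSplit_concat cs ha hr hF hR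
  have hred := isReduced_of_color_eq_zero cs ha hr hsplit.color_eq_zero
  have hgeom := coloredAct_of_color_eq_zero cs ha (congrArg Prod.snd hR₀)
  rw [hR₀] at hgeom
  rw [hword]
  exact (semiconjBy_of_geomRep_eq cs ha hF hred (congrArg Prod.fst hgeom).symm).mul_left hU

theorem IsSortingSeq.exists_semiconjBy {c V : List B} {x : B} {β : B → ℝ} {k : ℕ}
    (h : IsSortingSeq c (V ++ [x])) (hc : c.Nodup)
    (hβ : coloredAct a V (simpleRoot x, 0) = (β, k)) :
    ∃ V₀ x₀ P, IsSortingSeq c (V₀ ++ [x₀]) ∧ coloredAct a V₀ (simpleRoot x₀, 0) = (β, 0) ∧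
      ofWord M V = ofWord M V₀ * P ∧ SemiconjBy P (gen M x) (gen M x₀) := by
  induction k generalizing V x with
  | zero => exact ⟨V, x, 1, h, hβ, (mul_one _).symm, SemiconjBy.one_left _⟩
  | succ k ih =>
    obtain ⟨V₁, y, R, rfl, hy⟩ :=
      exists_append_of_mem_coloredInvSeq (mem_coloredInvSeq_of_color_succ hβ)
    rw [List.append_assoc, List.cons_append, ← List.singleton_append, ← List.append_assoc] at h
    obtain ⟨V₀, x₀, P, hV₀, hβ₀, hword, hP⟩ := ih h.left hy
    obtain ⟨d, hd, hR⟩ := h.right hc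
    have hyx := (hR.isAligned cs ha hr hF hd).semiconjBy cs ha hr hF
      (coloredAct_eq_simpleRoot cs ha hr hy hβ)
    refine ⟨V₀, x₀, P * (gen M y * ofWord M R), hV₀, hβ₀, ?_, ?_⟩
    · rw [ofWord_append, hword, ofWord_cons, mul_assoc]
    · exact hP.mul_left (((Commute.refl (gen M y)).semiconjBy.mul_left hyx))

end Chain

/-! ### Colored inversions of meets -/

section GLB

theorem le_iff_of_isGLB_pair {X : Type*} [Preorder X] {u v g z : X} (hg : IsGLB {u, v} g) :
    z ≤ g ↔ z ≤ u ∧ z ≤ v := by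
  simp [le_isGLB_iff hg, lowerBounds]

namespace ArtinMonoid

variable {B : Type*} {M : CoxeterMatrix B}

theorem exists_eq_gen_of_length_eq_one {z : ArtinMonoid M} (h : length z = 1) :
    ∃ e, z = gen M e := by
  obtain ⟨Q, rfl⟩ := ofWord_surjective z
  rw [length_ofWord, List.length_eq_one_iff] at h
  obtain ⟨e, rfl⟩ := h
  exact ⟨e, rfl⟩

theorem isGLB_mul_left [Finite B] {a : Matrix B B ℝ} {W : Type*} [Group W] [Finite W]
    (cs : CoxeterSystem M W) (ha : IsGeneralizedCartanMatrix M a) {u v g : ArtinMonoid M}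
    (hg : IsGLB {u, v} g) (h : ArtinMonoid M) : IsGLB {h * u, h * v} (h * g) := by
  obtain ⟨hgu, hgv⟩ := (le_iff_of_isGLB_pair hg).1 le_rfl
  refine ⟨by simp [lowerBounds, mul_le_mul_left hgu h, mul_le_mul_left hgv h], fun z hz => ?_⟩
  obtain ⟨g', hg'⟩ := exists_isGLB cs ha (h * u) (h * v)
  obtain ⟨m, rfl⟩ :=
    le_iff.1 ((le_iff_of_isGLB_pair hg').2 ⟨le_mul_right h u, le_mul_right h v⟩)
  obtain ⟨hmu, hmv⟩ := (le_iff_of_isGLB_pair hg').1 le_rfl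
  have hmg : m ≤ g := (le_iff_of_isGLB_pair hg).2
    ⟨le_of_mul_le_mul_left cs ha hmu, le_of_mul_le_mul_left cs ha hmv⟩
  exact (hg'.2 hz).trans (mul_le_mul_left hmg h)

end ArtinMonoid

end GLB

section Meet

open ArtinMonoid

variable {B : Type*} {M : CoxeterMatrix B}

/-- The elements `u x` and `v y` have a common left factor `h` such that the remaining factors of
`u` and `v` conjugate `x` and `y` to one simple generator. -/
def HaveCommonBase (u v : ArtinMonoid M) (x y : B) : Prop :=
  ∃ h p q e, u = h * p ∧ v = h * q ∧
    SemiconjBy p (gen M x) (gen M e) ∧ SemiconjBy q (gen M y) (gen M e)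

theorem HaveCommonBase.exists_mul_gen_le [Finite B] {a : Matrix B B ℝ} {W : Type*} [Group W]
    [Finite W] (cs : CoxeterSystem M W) (ha : IsGeneralizedCartanMatrix M a)
    {u v g : ArtinMonoid M} {x y : B} (h : HaveCommonBase u v x y) (hg : IsGLB {u, v} g) :
    ∃ e, g * gen M e ≤ u * gen M x ∧ g * gen M e ≤ v * gen M y := by
  obtain ⟨h, p, q, e, rfl, rfl, hp, hq⟩ := h
  obtain ⟨g₀, hg₀⟩ := exists_isGLB cs ha p q
  obtain rfl := hg.unique (isGLB_mul_left cs ha hg₀ h)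
  obtain ⟨hgp, hgq⟩ := (le_iff_of_isGLB_pair hg₀).1 le_rfl
  have hle : g₀ ≤ gen M e * g₀ := by
    rw [le_iff_of_isGLB_pair (isGLB_mul_left cs ha hg₀ (gen M e)), ← hp.eq, ← hq.eq]
    exact ⟨hgp.trans (le_mul_right _ _), hgq.trans (le_mul_right _ _)⟩
  obtain ⟨z, hz⟩ := le_iff.1 hle
  have hlength := congrArg length hz
  rw [length_mul, length_mul, length_gen, add_comm, Nat.add_right_cancel_iff] at hlength
  obtain ⟨e', rfl⟩ := exists_eq_gen_of_length_eq_one hlength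
  refine ⟨e', ?_, ?_⟩
  · rw [mul_assoc, hz, mul_assoc, hp.eq]
    exact mul_le_mul_left (mul_le_mul_left hgp _) _
  · rw [mul_assoc, hz, mul_assoc, hq.eq]
    exact mul_le_mul_left (mul_le_mul_left hgq _) _

variable [Fintype B] {a : Matrix B B ℝ}

/-- Every common colored inversion of `u` and `v` is a colored inversion of a common lower bound,
hence of the meet of `u` and `v`. -/
def IsMeetCompatible (a : Matrix B B ℝ) (u v : ArtinMonoid M) : Prop :=
  ∀ b ∈ coloredInv a u ∩ coloredInv a v, ∃ z, z ≤ u ∧ z ≤ v ∧ b ∈ coloredInv a z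

theorem IsMeetCompatible.coloredInv_eq {u v g : ArtinMonoid M} (h : IsMeetCompatible a u v)
    (hg : IsGLB {u, v} g) : coloredInv a g = coloredInv a u ∩ coloredInv a v := by
  obtain ⟨hgu, hgv⟩ := (le_iff_of_isGLB_pair hg).1 le_rfl
  refine (Set.subset_inter (coloredInv_mono hgu) (coloredInv_mono hgv)).antisymm fun b hb => ?_
  obtain ⟨z, hzu, hzv, hz⟩ := h b hb
  exact coloredInv_mono ((le_iff_of_isGLB_pair hg).2 ⟨hzu, hzv⟩) hz

variable {W : Type*} [Group W] (cs : CoxeterSystem M W) (ha : IsGeneralizedCartanMatrix M a)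
  (hr : IsReducedRoots a)
include cs ha hr

theorem mem_coloredInv_ofWord {Q : List B} {b : (B → ℝ) × ℕ} :
    b ∈ coloredInv a (ofWord M Q) ↔ b ∈ coloredInvSeq a Q := by
  rw [coloredInv_ofWord cs ha hr, Set.mem_ofPred_eq]

theorem mem_coloredInv_mul_gen {Q : List B} {x : B} {b : (B → ℝ) × ℕ} :
    b ∈ coloredInv a (ofWord M Q * gen M x) ↔
      b ∈ coloredInv a (ofWord M Q) ∨ b = coloredAct a Q (simpleRoot x, 0) := by
  rw [← ofWord_concat, mem_coloredInv_ofWord cs ha hr, mem_coloredInv_ofWord cs ha hr,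
    mem_coloredInvSeq_concat]

variable [Finite W]

theorem HaveCommonBase.exists_mem_coloredInv {V₁ V₂ : List B} {x₁ x₂ : B} {b : (B → ℝ) × ℕ}
    (h : HaveCommonBase (ofWord M V₁) (ofWord M V₂) x₁ x₂)
    (hV : IsMeetCompatible a (ofWord M V₁) (ofWord M V₂))
    (hb₁ : b = coloredAct a V₁ (simpleRoot x₁, 0)) (hb₂ : b = coloredAct a V₂ (simpleRoot x₂, 0)) :
    ∃ z, z ≤ ofWord M V₁ * gen M x₁ ∧ z ≤ ofWord M V₂ * gen M x₂ ∧ b ∈ coloredInv a z := by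
  obtain ⟨g, hg⟩ := exists_isGLB cs ha (ofWord M V₁) (ofWord M V₂)
  obtain ⟨e, he₁, he₂⟩ := h.exists_mul_gen_le cs ha hg
  obtain ⟨G, rfl⟩ := ofWord_surjective g
  have hlast : coloredAct a G (simpleRoot e, 0) ∈ coloredInv a (ofWord M G * gen M e) :=
    (mem_coloredInv_mul_gen cs ha hr).2 (Or.inr rfl)
  have hnew : coloredAct a G (simpleRoot e, 0) ∉ coloredInv a (ofWord M G) := fun hmem =>
    coloredAct_notMem_coloredInvSeq cs ha hr (isPosRoot_simpleRoot e)
      ((mem_coloredInv_ofWord cs ha hr).1 hmem)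
  rw [hV.coloredInv_eq hg] at hnew
  have h₁ := (mem_coloredInv_mul_gen cs ha hr).1 (coloredInv_mono he₁ hlast)
  have h₂ := (mem_coloredInv_mul_gen cs ha hr).1 (coloredInv_mono he₂ hlast)
  rw [← hb₁] at h₁
  rw [← hb₂] at h₂
  have hb : coloredAct a G (simpleRoot e, 0) = b := by
    rcases h₁ with h₁ | h₁
    · exact h₂.resolve_left fun h₂ => hnew ⟨h₁, h₂⟩
    · exact h₁
  exact ⟨_, he₁, he₂, hb ▸ hlast⟩

theorem isMeetCompatible_ofWord {Q₁ Q₂ : List B}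
    (h : ∀ V₁ x₁ V₂ x₂, V₁ ++ [x₁] <+: Q₁ → V₂ ++ [x₂] <+: Q₂ →
      coloredAct a V₁ (simpleRoot x₁, 0) = coloredAct a V₂ (simpleRoot x₂, 0) →
      IsMeetCompatible a (ofWord M V₁) (ofWord M V₂) →
      HaveCommonBase (ofWord M V₁) (ofWord M V₂) x₁ x₂) :
    IsMeetCompatible a (ofWord M Q₁) (ofWord M Q₂) := by
  induction Q₁ using List.reverseRecOn generalizing Q₂ with
  | nil =>
    exact fun b hb => absurd ((mem_coloredInv_ofWord cs ha hr).1 hb.1) List.not_mem_nil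
  | append_singleton V₁ x₁ ih₁ =>
    induction Q₂ using List.reverseRecOn with
    | nil =>
      exact fun b hb => absurd ((mem_coloredInv_ofWord cs ha hr).1 hb.2) List.not_mem_nil
    | append_singleton V₂ x₂ ih₂ =>
      have hV₁ {Q} (hQ : Q <+: V₁) : Q <+: V₁ ++ [x₁] := hQ.trans (List.prefix_append V₁ [x₁])
      have hV₂ {Q} (hQ : Q <+: V₂) : Q <+: V₂ ++ [x₂] := hQ.trans (List.prefix_append V₂ [x₂])
      have hleft := ih₁ fun W₁ y₁ W₂ y₂ hW₁ hW₂ => h W₁ y₁ W₂ y₂ (hV₁ hW₁) hW₂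
      have hright := ih₂ fun W₁ y₁ W₂ y₂ hW₁ hW₂ => h W₁ y₁ W₂ y₂ hW₁ (hV₂ hW₂)
      have hboth := ih₁ fun W₁ y₁ W₂ y₂ hW₁ hW₂ => h W₁ y₁ W₂ y₂ (hV₁ hW₁) (hV₂ hW₂)
      rw [ofWord_concat] at hleft hright ⊢
      rw [ofWord_concat]
      rintro b ⟨hb₁, hb₂⟩
      rcases (mem_coloredInv_mul_gen cs ha hr).1 hb₁ with hb₁' | hb₁'
      · obtain ⟨z, hz₁, hz₂, hz⟩ := hleft b ⟨hb₁', hb₂⟩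
        exact ⟨z, hz₁.trans (le_mul_right _ _), hz₂, hz⟩
      rcases (mem_coloredInv_mul_gen cs ha hr).1 hb₂ with hb₂' | hb₂'
      · obtain ⟨z, hz₁, hz₂, hz⟩ := hright b ⟨hb₁, hb₂'⟩
        exact ⟨z, hz₁, hz₂.trans (le_mul_right _ _), hz⟩
      · exact (h V₁ x₁ V₂ x₂ (List.prefix_refl _) (List.prefix_refl _) (hb₁'.symm.trans hb₂')
          hboth).exists_mem_coloredInv cs ha hr hboth hb₁' hb₂'

end Meet

section Base

open ArtinMonoid

variable {B : Type*} [Fintype B] {M : CoxeterMatrix B} {a : Matrix B B ℝ}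
  {F : LinearMap.BilinForm ℝ (B → ℝ)} {c : List B}

theorem exists_mulVec_pos (ha : IsGeneralizedCartanMatrix M a) (hF : IsInvariantForm a F)
    {γ : B → ℝ} (hγ : 0 ≤ γ) (hne : γ ≠ 0) : ∃ r, 0 < (a *ᵥ γ) r := by
  by_contra! hcon
  have hform (t : B) : F γ (simpleRoot t) ≤ 0 := by
    have htwo := hF.two_mul_simpleRoot ha t γ
    rw [hF.symm]
    linarith [mul_nonpos_of_nonneg_of_nonpos (hF.simpleRoot_pos t).le (hcon t)]
  refine (hF.pos γ hne).not_ge ?_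
  calc F γ γ = F γ (∑ t, γ t • simpleRoot t) := by rw [sum_smul_simpleRoot]
    _ = ∑ t, γ t * F γ (simpleRoot t) := by simp only [map_sum, map_smul, smul_eq_mul]
    _ ≤ 0 := Finset.sum_nonpos fun t _ => mul_nonpos_of_nonneg_of_nonpos (hγ t) (hform t)

theorem not_isAlignedPair_of_eq_add (hF : IsInvariantForm a F) {β ρ σ : B → ℝ} {p q : ℝ}
    (hβ : β ≠ 0) (e : β = p • ρ + q • σ) (hp : 0 < p) (hq : 0 < q)
    (hρ : IsAlignedPair F c (ρ, 0) (β, 0)) : ¬ IsAlignedPair F c (σ, 0) (β, 0) := by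
  intro hσ
  obtain ⟨hρ_le, hρ_form⟩ := (hρ rfl).1 rfl
  obtain ⟨hσ_le, hσ_form⟩ := (hσ rfl).1 rfl
  have halt := isAlt_skewForm F c
  have hωρ : skewForm F c ρ β = q * skewForm F c ρ σ := by
    simp [e, halt.self_eq_zero]
  have hωσ : skewForm F c σ β = -(p * skewForm F c ρ σ) := by
    simp [e, halt.self_eq_zero, ← halt.neg_eq ρ σ]
  dsimp only at hρ_le hρ_form hσ_le hσ_form
  rw [hωρ] at hρ_le hρ_form
  rw [hωσ] at hσ_le hσ_form
  have hω : skewForm F c ρ σ = 0 := le_antisymm (by nlinarith) (by nlinarith)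
  have hform : F β β = p * F ρ β + q * F σ β := by
    calc F β β = F (p • ρ + q • σ) β := by rw [← e]
      _ = p * F ρ β + q * F σ β := by
        simp only [map_add, map_smul, LinearMap.add_apply, LinearMap.smul_apply, smul_eq_mul]
  rw [hρ_form (by rw [hω, mul_zero]), hσ_form (by rw [hω, mul_zero, neg_zero])] at hform
  exact (hF.pos β hβ).ne' (by simpa using hform)

variable {W : Type*} [Group W] (cs : CoxeterSystem M W) (ha : IsGeneralizedCartanMatrix M a)
  (hr : IsReducedRoots a)
include cs ha hr

theorem isPosRoot_neg_iff_of_simpleRoot_eq_add {x : B} {σ τ : B → ℝ} {p q : ℝ}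
    (hσ : σ ∈ roots a) (hτ : τ ∈ roots a) (hne : σ ≠ τ) (hp : 0 < p) (hq : 0 < q)
    (e : simpleRoot x = p • σ + q • τ) : IsPosRoot a (-σ) ↔ ¬ IsPosRoot a (-τ) := by
  have hcoord (t : B) : simpleRoot x t = p * σ t + q * τ t := congrFun e t
  constructor
  · intro hσ' hτ'
    have hx := hcoord x
    rw [simpleRoot_apply_self] at hx
    linarith [mul_nonpos_of_nonneg_of_nonpos hp.le (neg_nonneg.1 (hσ'.2 x)),
      mul_nonpos_of_nonneg_of_nonpos hq.le (neg_nonneg.1 (hτ'.2 x))]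
  · intro hτ'
    have hτpos := (isPosRoot_or_isPosRoot_neg cs ha hτ).resolve_right hτ'
    refine (isPosRoot_or_isPosRoot_neg cs ha hσ).resolve_left fun hσpos => hne ?_
    have hzero (t : B) (ht : t ≠ x) : p * σ t = 0 ∧ q * τ t = 0 := by
      rw [← add_eq_zero_iff_of_nonneg (mul_nonneg hp.le (hσpos.2 t)) (mul_nonneg hq.le (hτpos.2 t)),
        ← hcoord, simpleRoot_apply_of_ne ht]
    rw [eq_simpleRoot_of_forall_ne hr hσpos
        fun t ht => (mul_eq_zero.1 (hzero t ht).1).resolve_left hp.ne',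
      eq_simpleRoot_of_forall_ne hr hτpos
        fun t ht => (mul_eq_zero.1 (hzero t ht).2).resolve_left hq.ne']

theorem mem_coloredInvSeq_iff_of_eq_add {P : List B} {x : B} {σ τ : B → ℝ} {p q : ℝ}
    (hP : cs.IsReduced P) (hσ : IsPosRoot a σ) (hτ : IsPosRoot a τ) (hne : σ ≠ τ) (hp : 0 < p)
    (hq : 0 < q) (e : ha.geomRep cs (cs.wordProd P) (simpleRoot x) = p • σ + q • τ) :
    (σ, 0) ∈ coloredInvSeq a P ↔ (τ, 0) ∉ coloredInvSeq a P := by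
  rw [mem_coloredInvSeq_of_isReduced cs ha hr hP hσ, mem_coloredInvSeq_of_isReduced cs ha hr hP hτ]
  refine isPosRoot_neg_iff_of_simpleRoot_eq_add cs ha hr (geomRep_mem_roots cs ha hσ.1 _)
    (geomRep_mem_roots cs ha hτ.1 _) ((ha.geomRep cs _).injective.ne hne) hp hq (x := x) ?_
  rw [← map_smul, ← map_smul, ← map_add, ← e, ha.geomRep_inv_apply]

theorem exists_eq_simpleRoot_of_disjoint (hF : IsInvariantForm a F) {P₁ P₂ : List B} {x y : B}
    {γ : B → ℝ}
    (h₁ : cs.IsReduced P₁) (h₂ : cs.IsReduced P₂)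
    (hγ₁ : ha.geomRep cs (cs.wordProd P₁) (simpleRoot x) = γ)
    (hγ₂ : ha.geomRep cs (cs.wordProd P₂) (simpleRoot y) = γ) (hγ : IsPosRoot a γ)
    (hdisj : (coloredInvSeq a P₁).Disjoint (coloredInvSeq a P₂)) (f : (B → ℝ) ≃ₗ[ℝ] (B → ℝ))
    (hal : ∀ ρ, (ρ, 0) ∈ coloredInvSeq a P₁ ∨ (ρ, 0) ∈ coloredInvSeq a P₂ →
      IsAlignedPair F c (f ρ, 0) (f γ, 0)) : ∃ e, γ = simpleRoot e := by
  have hne := ne_zero_of_mem_roots cs ha hγ.1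
  obtain ⟨r, hpos⟩ := exists_mulVec_pos ha hF hγ.2 hne
  refine ⟨r, by_contra fun hr' => ?_⟩
  have hsum : γ = (a *ᵥ γ) r • simpleRoot r + (1 : ℝ) • simpleRefl a r γ := by
    rw [simpleRefl]
    module
  have hiff {P z} (hP : cs.IsReduced P)
      (hz : ha.geomRep cs (cs.wordProd P) (simpleRoot z) = γ) :=
    mem_coloredInvSeq_iff_of_eq_add cs ha hr hP (isPosRoot_simpleRoot r)
      (hγ.simpleRefl cs ha hr hr') (hγ.simpleRefl_ne_simpleRoot ha r).symm hpos one_pos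
      (hz.trans hsum)
  have hmem := @hdisj (simpleRoot r, 0)
  have hmem' := @hdisj (simpleRefl a r γ, 0)
  have hsum' := congrArg f hsum
  rw [map_add, map_smul, map_smul] at hsum'
  refine not_isAlignedPair_of_eq_add hF (f.map_ne_zero_iff.2 hne) hsum' hpos one_pos
    (hal _ ?_) (hal _ ?_) <;> have := hiff h₁ hγ₁ <;> have := hiff h₂ hγ₂ <;> tauto

end Base

section AlignedLetter

open ArtinMonoid

variable {B : Type*} [Fintype B] {M : CoxeterMatrix B} {a : Matrix B B ℝ}
  {F : LinearMap.BilinForm ℝ (B → ℝ)} {c V H P : List B} {x : B}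

/-- The colored inversions of `V x` have color `0`, and those of `V` are aligned with the one that
the letter `x` creates. -/
structure IsAlignedLetter (a : Matrix B B ℝ) (F : LinearMap.BilinForm ℝ (B → ℝ)) (c V : List B)
    (x : B) : Prop where
  color_eq_zero : ∀ b ∈ coloredInvSeq a (V ++ [x]), b.2 = 0
  isAlignedPair : ∀ b ∈ coloredInvSeq a V, IsAlignedPair F c b (coloredAct a V (simpleRoot x, 0))

theorem color_eq_zero_of_append {Q : List B} (h : ∀ b ∈ coloredInvSeq a (H ++ Q), b.2 = 0) :
    ∀ b ∈ coloredInvSeq a Q, b.2 = 0 := fun b hb =>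
  Nat.eq_zero_of_le_zero ((color_le_coloredAct H b).trans_eq
    (h _ (mem_coloredInvSeq_append.2 (Or.inr ⟨b, hb, rfl⟩))))

namespace IsAlignedLetter

theorem color_eq_zero_right (h : IsAlignedLetter a F c (H ++ P) x) :
    ∀ b ∈ coloredInvSeq a (P ++ [x]), b.2 = 0 :=
  color_eq_zero_of_append (H := H) (by simpa only [List.append_assoc] using h.color_eq_zero)

variable {W : Type*} [Group W] (cs : CoxeterSystem M W) (ha : IsGeneralizedCartanMatrix M a)
include cs ha

theorem isAlignedPair_geomRep (h : IsAlignedLetter a F c (H ++ P) x) {γ ρ : B → ℝ}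
    (hγ : coloredAct a P (simpleRoot x, 0) = (γ, 0)) (hρ : (ρ, 0) ∈ coloredInvSeq a P) :
    IsAlignedPair F c (ha.geomRep cs (cs.wordProd H) ρ, 0)
      (ha.geomRep cs (cs.wordProd H) γ, 0) := by
  have hmem : coloredAct a H (ρ, 0) ∈ coloredInvSeq a (H ++ P) :=
    mem_coloredInvSeq_append.2 (Or.inr ⟨_, hρ, rfl⟩)
  have hpair := h.isAlignedPair _ hmem
  have hcolor := h.color_eq_zero _ (mem_coloredInvSeq_concat.2 (Or.inl hmem))
  have hcolor' := h.color_eq_zero _ (mem_coloredInvSeq_concat.2 (Or.inr rfl))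
  rw [coloredAct_append, hγ] at hpair hcolor'
  rwa [coloredAct_of_color_eq_zero cs ha hcolor, coloredAct_of_color_eq_zero cs ha hcolor']
    at hpair

variable (hr : IsReducedRoots a)
include hr

theorem congr {V' : List B} (h : IsAlignedLetter a F c V x) (e : ofWord M V = ofWord M V') :
    IsAlignedLetter a F c V' x where
  color_eq_zero b hb := by
    refine h.color_eq_zero b ((mem_coloredInvSeq_iff_of_ofWord_eq cs ha hr ?_ b).2 hb)
    rw [ofWord_concat, ofWord_concat, e]
  isAlignedPair b hb := by
    rw [← coloredAct_eq_of_ofWord_eq cs ha hr e (isPosRoot_simpleRoot x)]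
    exact h.isAlignedPair b ((mem_coloredInvSeq_iff_of_ofWord_eq cs ha hr e b).2 hb)

variable [Finite W] (hF : IsInvariantForm a F)
include hF

theorem haveCommonBase_of_disjoint {P₁ P₂ : List B} {x y : B}
    (h₁ : IsAlignedLetter a F c (H ++ P₁) x) (h₂ : IsAlignedLetter a F c (H ++ P₂) y)
    (h : coloredAct a (H ++ P₁) (simpleRoot x, 0) = coloredAct a (H ++ P₂) (simpleRoot y, 0))
    (hdisj : (coloredInvSeq a P₁).Disjoint (coloredInvSeq a P₂)) :
    HaveCommonBase (ofWord M (H ++ P₁)) (ofWord M (H ++ P₂)) x y := by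
  have hpos (P : List B) (z : B) : IsPosRoot a (coloredAct a P (simpleRoot z, 0)).1 :=
    (isPosRoot_simpleRoot z).coloredAct (b := (simpleRoot z, 0)) cs ha hr P
  rw [coloredAct_append, coloredAct_append] at h
  have hγ := coloredAct_injOn cs ha hr H (hpos P₁ x) (hpos P₂ y) h
  have hcolor₁ := h₁.color_eq_zero_right _ (mem_coloredInvSeq_concat.2 (Or.inr rfl))
  have hcolor₂ := h₂.color_eq_zero_right _ (mem_coloredInvSeq_concat.2 (Or.inr rfl))
  have hγ₁ := coloredAct_of_color_eq_zero cs ha hcolor₁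
  have hγ₂ := coloredAct_of_color_eq_zero cs ha hcolor₂
  have hred₁ := isReduced_of_color_eq_zero cs ha hr h₁.color_eq_zero_right
  have hred₂ := isReduced_of_color_eq_zero cs ha hr h₂.color_eq_zero_right
  have hgeom := congrArg Prod.fst ((hγ₂.symm.trans hγ.symm).trans hγ₁)
  obtain ⟨e, he⟩ := exists_eq_simpleRoot_of_disjoint cs ha hr hF (c := c)
    (by simpa using hred₁.take P₁.length) (by simpa using hred₂.take P₂.length) rfl hgeom
    (by simpa only [hγ₁] using hpos P₁ x) hdisj (ha.geomRep cs (cs.wordProd H)) fun ρ hρ =>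
      hρ.elim (h₁.isAlignedPair_geomRep cs ha hγ₁)
        (h₂.isAlignedPair_geomRep cs ha (hγ.symm.trans hγ₁))
  exact ⟨ofWord M H, ofWord M P₁, ofWord M P₂, e, ofWord_append _ _, ofWord_append _ _,
    semiconjBy_of_geomRep_eq cs ha hF hred₁ he,
    semiconjBy_of_geomRep_eq cs ha hF hred₂ (hgeom.trans he)⟩

theorem haveCommonBase {V₁ V₂ : List B} {x y : B} (h₁ : IsAlignedLetter a F c V₁ x)
    (h₂ : IsAlignedLetter a F c V₂ y)
    (h : coloredAct a V₁ (simpleRoot x, 0) = coloredAct a V₂ (simpleRoot y, 0))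
    (hmeet : IsMeetCompatible a (ofWord M V₁) (ofWord M V₂)) :
    HaveCommonBase (ofWord M V₁) (ofWord M V₂) x y := by
  obtain ⟨g, hg⟩ := exists_isGLB cs ha (ofWord M V₁) (ofWord M V₂)
  obtain ⟨hg₁, hg₂⟩ := (le_iff_of_isGLB_pair hg).1 le_rfl
  obtain ⟨p₁, e₁⟩ := le_iff.1 hg₁
  obtain ⟨p₂, e₂⟩ := le_iff.1 hg₂
  obtain ⟨H, rfl⟩ := ofWord_surjective g
  obtain ⟨P₁, rfl⟩ := ofWord_surjective p₁
  obtain ⟨P₂, rfl⟩ := ofWord_surjective p₂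
  rw [← ofWord_append, eq_comm] at e₁ e₂
  have hinv := hmeet.coloredInv_eq hg
  rw [e₁, e₂] at hinv ⊢
  rw [coloredAct_eq_of_ofWord_eq cs ha hr e₁ (isPosRoot_simpleRoot x),
    coloredAct_eq_of_ofWord_eq cs ha hr e₂ (isPosRoot_simpleRoot y)] at h
  refine (h₁.congr cs ha hr e₁).haveCommonBase_of_disjoint cs ha hr hF (h₂.congr cs ha hr e₂) h
    fun b hb₁ hb₂ => ?_
  have hmem : coloredAct a H b ∈ coloredInv a (ofWord M H) := by
    rw [hinv]
    constructor <;> rw [mem_coloredInv_ofWord cs ha hr]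
    exacts [mem_coloredInvSeq_append.2 (Or.inr ⟨b, hb₁, rfl⟩),
      mem_coloredInvSeq_append.2 (Or.inr ⟨b, hb₂, rfl⟩)]
  exact coloredAct_notMem_coloredInvSeq cs ha hr (isPosRoot_of_mem_coloredInvSeq cs ha hr hb₁)
    ((mem_coloredInv_ofWord cs ha hr).1 hmem)

end IsAlignedLetter

end AlignedLetter

section SortingMeet

open ArtinMonoid

variable {B : Type*} [Fintype B] {M : CoxeterMatrix B} {a : Matrix B B ℝ}
  {F : LinearMap.BilinForm ℝ (B → ℝ)} {c : List B}

theorem IsAligned.isAlignedLetter {Q V : List B} {x : B} (hQ : IsAligned a F c Q)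
    (h0 : ∀ b ∈ coloredInvSeq a Q, b.2 = 0) (hV : V ++ [x] <+: Q) : IsAlignedLetter a F c V x := by
  obtain ⟨R, rfl⟩ := hV
  refine ⟨fun b hb => h0 b (mem_coloredInvSeq_append.2 (Or.inl hb)), ?_⟩
  rw [IsAligned, coloredInvSeq_append] at hQ
  exact (isAligned_concat.1 (List.pairwise_append.1 hQ).1).2

variable {W : Type*} [Group W] [Finite W] (cs : CoxeterSystem M W)
  (ha : IsGeneralizedCartanMatrix M a) (hr : IsReducedRoots a) (hF : IsInvariantForm a F)
include cs ha hr hF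

theorem IsAligned.isMeetCompatible {Q₁ Q₂ : List B} (h₁ : IsAligned a F c Q₁)
    (h₂ : IsAligned a F c Q₂) (h0₁ : ∀ b ∈ coloredInvSeq a Q₁, b.2 = 0)
    (h0₂ : ∀ b ∈ coloredInvSeq a Q₂, b.2 = 0) :
    IsMeetCompatible a (ofWord M Q₁) (ofWord M Q₂) :=
  isMeetCompatible_ofWord cs ha hr fun _ _ _ _ hV₁ hV₂ =>
    (h₁.isAlignedLetter h0₁ hV₁).haveCommonBase cs ha hr hF (h₂.isAlignedLetter h0₂ hV₂)

theorem IsAligned.haveCommonBase {V₁ V₂ : List B} {x y : B} (h₁ : IsAligned a F c (V₁ ++ [x]))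
    (h₂ : IsAligned a F c (V₂ ++ [y])) (h0₁ : ∀ b ∈ coloredInvSeq a (V₁ ++ [x]), b.2 = 0)
    (h0₂ : ∀ b ∈ coloredInvSeq a (V₂ ++ [y]), b.2 = 0)
    (h : coloredAct a V₁ (simpleRoot x, 0) = coloredAct a V₂ (simpleRoot y, 0)) :
    HaveCommonBase (ofWord M V₁) (ofWord M V₂) x y :=
  (h₁.isAlignedLetter h0₁ List.prefix_rfl).haveCommonBase cs ha hr hF
    (h₂.isAlignedLetter h0₂ List.prefix_rfl) h <|
    (isAligned_concat.1 h₁).1.isMeetCompatible cs ha hr hF (isAligned_concat.1 h₂).1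
      (fun b hb => h0₁ b (mem_coloredInvSeq_concat.2 (Or.inl hb)))
      fun b hb => h0₂ b (mem_coloredInvSeq_concat.2 (Or.inl hb))

theorem IsSortingSeq.haveCommonBase {V₁ V₂ : List B} {x y : B} (hc : c.Nodup)
    (h₁ : IsSortingSeq c (V₁ ++ [x])) (h₂ : IsSortingSeq c (V₂ ++ [y]))
    (h : coloredAct a V₁ (simpleRoot x, 0) = coloredAct a V₂ (simpleRoot y, 0)) :
    HaveCommonBase (ofWord M V₁) (ofWord M V₂) x y := by
  rcases hβ : coloredAct a V₁ (simpleRoot x, 0) with ⟨β, k⟩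
  obtain ⟨S₁, x', P₁, hS₁, hβ₁, eV₁, hP₁⟩ := h₁.exists_semiconjBy cs ha hr hF hc hβ
  obtain ⟨S₂, y', P₂, hS₂, hβ₂, eV₂, hP₂⟩ :=
    h₂.exists_semiconjBy cs ha hr hF hc (h.symm.trans hβ)
  have hal₁ := hS₁.isAligned cs ha hr hF hc
  have hal₂ := hS₂.isAligned cs ha hr hF hc
  obtain ⟨Z₁, U₁, eS₁, hU₁, hZ₁, hsplit₁⟩ := hal₁.exists_isColorSplit_concat cs ha hr hF hβ₁
  obtain ⟨Z₂, U₂, eS₂, hU₂, hZ₂, hsplit₂⟩ := hal₂.exists_isColorSplit_concat cs ha hr hF hβ₂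
  obtain ⟨g, p, q, e, eZ₁, eZ₂, hp, hq⟩ := (hsplit₁.isAligned hal₁).haveCommonBase cs ha hr hF
    (hsplit₂.isAligned hal₂) hsplit₁.color_eq_zero hsplit₂.color_eq_zero (hZ₁.trans hZ₂.symm)
  refine ⟨g, p * ofWord M U₁ * P₁, q * ofWord M U₂ * P₂, e, ?_, ?_,
    (hp.mul_left hU₁.semiconjBy).mul_left hP₁, (hq.mul_left hU₂.semiconjBy).mul_left hP₂⟩
  · rw [eV₁, eS₁, eZ₁, mul_assoc, mul_assoc, mul_assoc]
  · rw [eV₂, eS₂, eZ₂, mul_assoc, mul_assoc, mul_assoc]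

theorem IsSortingSeq.isMeetCompatible {Q₁ Q₂ : List B} (hc : c.Nodup) (h₁ : IsSortingSeq c Q₁)
    (h₂ : IsSortingSeq c Q₂) : IsMeetCompatible a (ofWord M Q₁) (ofWord M Q₂) := by
  refine isMeetCompatible_ofWord cs ha hr fun V₁ x V₂ y hV₁ hV₂ h _ => ?_
  obtain ⟨R₁, rfl⟩ := hV₁
  obtain ⟨R₂, rfl⟩ := hV₂
  exact h₁.left.haveCommonBase cs ha hr hF hc h₂.left h

end SortingMeet

/-! ### Sortable elements -/

section Sortable

variable {B : Type*}

-- `A j` says that the position `j` of the cyclic word `L` is available, `T j` that it is used.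
theorem isSortingSeq_filter (L : ℕ → B) {n : ℕ} (hn : 0 < n) (hL : ∀ j, L (j + n) = L j)
    (A T : ℕ → Prop) [DecidablePred A] [DecidablePred T] (hTA : ∀ j, T j → A j)
    (hAT : ∀ j, A (j + n) ↔ T j) (N m : ℕ) :
    IsSortingSeq (((List.range' N n).filter A).map L) (((List.range' N m).filter T).map L) := by
  induction m generalizing N with
  | zero => exact IsSortingSeq.empty _
  | succ m ih =>
    obtain ⟨n, rfl⟩ := Nat.exists_eq_add_of_lt hn
    rw [zero_add] at *
    have hlast : N + 1 + 1 * n = N + (n + 1) := by ring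
    have h := ih (N + 1)
    rw [List.range'_concat, hlast, List.filter_append, List.map_append] at h
    rw [List.range'_succ, List.range'_succ]
    by_cases hT : T N
    · simp only [List.filter_cons, hTA N hT, hT, decide_true, if_true, List.map_cons]
      simp only [List.filter_cons, hAT, hT, decide_true, if_true, List.filter_nil,
        List.map_cons, List.map_nil, hL] at h
      exact h.use
    · simp only [List.filter_cons, hAT, hT, decide_false, Bool.false_eq_true, if_false,
        List.filter_nil, List.map_nil, List.append_nil] at h ⊢
      by_cases hA : A N
      · simp only [hA, decide_true, if_true, List.map_cons]
        exact h.skip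
      · simpa only [hA, decide_false, Bool.false_eq_true, if_false] using h

theorem eq_map_filter_range' {X : Type*} [LinearOrder X] (e : ℕ ≃o X) {P : List X}
    (hP : P.Pairwise (· < ·)) :
    ∃ m, P = ((List.range' 0 m).filter fun j => e j ∈ P).map e := by
  obtain ⟨m, hm⟩ := (P.map e.symm).toFinset.exists_nat_subset_range
  refine ⟨m, List.Pairwise.eq_of_mem_iff (r := (· < ·)) hP ?_ fun x => ?_⟩
  · refine List.pairwise_map.2 (List.Pairwise.filter _ ?_)
    exact List.Pairwise.imp (fun h => e.strictMono h) List.pairwise_lt_range'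
  · have hx (h : x ∈ P) : e.symm x < m := Finset.mem_range.1 <| hm <|
      List.mem_toFinset.2 (List.mem_map_of_mem h)
    simp only [List.mem_map, List.mem_filter, List.mem_range'_1, decide_eq_true_eq]
    refine ⟨fun h => ⟨e.symm x, ⟨by simpa using hx h, by simpa using h⟩, e.apply_symm_apply x⟩, ?_⟩
    rintro ⟨j, ⟨-, h⟩, rfl⟩
    exact h

variable {n : ℕ} [NeZero n]

theorem strictMono_divModEquiv_symm :
    StrictMono fun p : ℕ ×ₗ Fin n => (Nat.divModEquiv n).symm (ofLex p) := by
  intro p q hpq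
  have hp := (ofLex p).2.isLt
  simp only [Nat.divModEquiv_symm_apply]
  rcases Prod.Lex.lt_iff.1 hpq with h | ⟨h, h'⟩
  · have hmul := Nat.mul_le_mul_right n (Nat.succ_le_of_lt h)
    rw [Nat.succ_mul] at hmul
    omega
  · rw [h]
    exact Nat.add_lt_add_left h' _

/-- The enumeration of the positions of `c c c ⋯`, for a word `c` of length `n`, in their order. -/
def positionIso (n : ℕ) [NeZero n] : ℕ ≃o ℕ ×ₗ Fin n where
  toEquiv := (Nat.divModEquiv n).trans toLex
  map_rel_iff' {i j} := by
    simpa [Nat.div_add_mod'] using (strictMono_divModEquiv_symm.le_iff_le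
      (a := toLex (Nat.divModEquiv n i)) (b := toLex (Nat.divModEquiv n j))).symm

theorem positionIso_apply (j : ℕ) : positionIso n j = toLex (j / n, Fin.ofNat n j) := rfl

theorem positionIso_add (j : ℕ) : positionIso n (j + n) = toLex (j / n + 1, Fin.ofNat n j) := by
  rw [positionIso_apply, Nat.add_div_right _ (NeZero.pos n)]
  congr 2
  exact Fin.ext (Nat.add_mod_right j n)

omit [NeZero n] in
theorem IsSortable.exists_isSortingSeq {M : CoxeterMatrix B} {c : Fin n ≃ B} {w : ArtinMonoid M}
    (h : IsSortable c w) : ∃ Q, ArtinMonoid.ofWord M Q = w ∧ IsSortingSeq (List.ofFn c) Q := by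
  classical
  obtain ⟨P, ⟨⟨hP, rfl⟩, -⟩, hnested⟩ := h
  refine ⟨_, rfl, ?_⟩
  rcases n.eq_zero_or_pos with rfl | hn
  · obtain rfl : P = [] := List.eq_nil_iff_forall_not_mem.2 fun p => (ofLex p).2.elim0
    exact IsSortingSeq.empty _
  have : NeZero n := ⟨hn.ne'⟩
  obtain ⟨m, hm⟩ := eq_map_filter_range' (positionIso n) hP
  let T (j : ℕ) : Prop := positionIso n j ∈ P
  have hT (j : ℕ) (h : T (j + n)) : T j := by
    change positionIso n (j + n) ∈ P at h
    rw [positionIso_add] at h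
    exact hnested (j / n) h
  have hseq := isSortingSeq_filter (fun j => c (Fin.ofNat n j)) hn
    (fun j => congrArg c (Fin.ext (Nat.add_mod_right j n))) (fun j => j < n ∨ T (j - n)) T
    (fun j h => (lt_or_ge j n).imp_right fun hj => hT _ (by rwa [Nat.sub_add_cancel hj]))
    (fun j => by simp) 0 m
  have hwindow : (List.range' 0 n).filter (fun j => j < n ∨ T (j - n)) = List.range' 0 n :=
    List.filter_eq_self.2 fun j hj =>
      decide_eq_true (Or.inl (by simpa using (List.mem_range'_1.1 hj).2))
  have hletters : (List.range' 0 n).map (fun j => c (Fin.ofNat n j)) = List.ofFn c :=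
    List.ext_getElem (by simp) fun i _ hi => by
      simp only [List.getElem_map, List.getElem_range', List.getElem_ofFn, zero_add, one_mul]
      exact congrArg c (Fin.ext (Nat.mod_eq_of_lt (by simpa using hi)))
  rw [hwindow, hletters] at hseq
  rw [hm, List.map_map]
  convert hseq
  rfl

end Sortable

section Main

open ArtinMonoid

variable {B : Type*} [Fintype B] {M : CoxeterMatrix B} {a : Matrix B B ℝ} {W : Type*} [Group W]
  (cs : CoxeterSystem M W) (ha : IsGeneralizedCartanMatrix M a) (hr : IsReducedRoots a)
include cs ha hr

theorem eq_of_le_of_coloredInv_eq {g u : ArtinMonoid M} (hle : g ≤ u)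
    (h : coloredInv a g = coloredInv a u) : g = u := by
  obtain ⟨z, rfl⟩ := le_iff.1 hle
  have hlength := congrArg Set.ncard h
  rw [ncard_coloredInv cs ha hr, ncard_coloredInv cs ha hr, length_mul] at hlength
  rw [eq_one_of_length_eq_zero (by omega : length z = 0), mul_one]

variable [Finite W] {n : ℕ} {c : Fin n ≃ B} {w u : ArtinMonoid M}

theorem IsSortable.isMeetCompatible (hw : IsSortable c w) (hu : IsSortable c u) :
    IsMeetCompatible a w u := by
  obtain ⟨F, hF⟩ := exists_isInvariantForm cs ha
  obtain ⟨P, rfl, hP⟩ := hw.exists_isSortingSeq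
  obtain ⟨Q, rfl, hQ⟩ := hu.exists_isSortingSeq
  exact hP.isMeetCompatible cs ha hr hF (List.nodup_ofFn.2 c.injective) hQ

theorem IsSortable.le_iff_coloredInv_subset (hw : IsSortable c w) (hu : IsSortable c u) :
    w ≤ u ↔ coloredInv a w ⊆ coloredInv a u := by
  refine ⟨coloredInv_mono, fun h => ?_⟩
  obtain ⟨g, hg⟩ := exists_isGLB cs ha w u
  obtain ⟨hgw, hgu⟩ := (le_iff_of_isGLB_pair hg).1 le_rfl
  have hinv := (hw.isMeetCompatible cs ha hr hu).coloredInv_eq hg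
  rw [Set.inter_eq_left.2 h] at hinv
  exact eq_of_le_of_coloredInv_eq cs ha hr hgw hinv ▸ hgu

end Main

end

theorem mainTheorem11 {B W : Type*} [Fintype B] [Group W] [Finite W] {M : CoxeterMatrix B}
    (cs : CoxeterSystem M W) (a : Matrix B B ℝ) (ha : IsGeneralizedCartanMatrix M a)
    (ha_red : IsReducedRoots a) (m : ℕ) {n : ℕ} (c : Fin n ≃ B)
    (w u : cs.mWeak m) (hw : w ∈ mSort cs m c) (hu : u ∈ mSort cs m c) :
    (w ≤ u ↔ coloredInv a (w : ArtinMonoid M) ⊆ coloredInv a (u : ArtinMonoid M)) ∧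
      ∃ v : cs.mWeak m, IsGLB {w, u} v ∧
        coloredInv a (v : ArtinMonoid M) =
          coloredInv a (w : ArtinMonoid M) ∩ coloredInv a (u : ArtinMonoid M) := by
  refine ⟨IsSortable.le_iff_coloredInv_subset cs ha ha_red hw hu, ?_⟩
  obtain ⟨g, hg⟩ := ArtinMonoid.exists_isGLB cs ha (w : ArtinMonoid M) u
  obtain ⟨hgw, hgu⟩ := (le_iff_of_isGLB_pair hg).1 le_rfl
  have hinv := (IsSortable.isMeetCompatible cs ha ha_red hw hu).coloredInv_eq hg
  refine ⟨⟨g, ArtinMonoid.one_le g, hgw.trans w.2.2⟩, ⟨?_, fun z hz => ?_⟩, hinv⟩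
  · rintro _ (rfl | rfl)
    exacts [hgw, hgu]
  · exact (le_iff_of_isGLB_pair hg).2 ⟨hz (Or.inl rfl), hz (Or.inr rfl)⟩
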